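/- **Setting.** Let $\gamma>3$, $\beta>2$, $p_\infty,c_v,a>0$, $g>0$. A compressible, heat-conducting Newtonian fluid with density $\rho\ge 0$, velocity $\mathbf u$ and temperature $\vartheta>0$ has pressure $p=p_\infty\rho^\gamma+c_v(\gamma-1)\rho\vartheta+\frac a3\vartheta^4$, internal energy $\rho e=\frac{p_\infty}{\gamma-1}\rho^\gamma+c_v\rho\vartheta+a\vartheta^4$, entropy $\rho s=c_v\rho\log(\vartheta/\rho^{\gamma-1})+\frac{4a}{3}\vartheta^3$, stress $$\mathbb S=2\mu(\vartheta)\big(\mathbb D(\mathbf u)-\tfrac13\operatorname{div}\mathbf u\,\mathbb I\big)+\eta(\vartheta)\operatorname{div}\mathbf u\,\mathbb I$$ and heat flux $\mathbf q=-\kappa(\vartheta)\nabla\vartheta$, where on $(0,\infty)$ the functions $\mu,\eta,\kappa$ are continuous, $\mu$ is Lipschitz with $1+\vartheta\lesssim\mu(\vartheta)$, $0\le\eta(\vartheta)\lesssim1+\vartheta$ and $\kappa(\vartheta)\sim1+\vartheta^\beta$. Let $\Omega\subset\mathbb R^3$ be a bounded domain of class $C^{1,\alpha}$, and let $B\subset\mathbb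 R^3$ be compact, simply connected, the closure of its interior, which is a domain of class $C^{1,\alpha}$, and rotationally symmetric about the $x_3$-axis. Put $r=\sqrt{x_1^2+x_2^2}$, and let $r_0,d_0>0$. Near the square $\Gamma=[-2r_0,2r_0]^2\times\{0\}$ the set $\Omega$ coincides with $\{x_3>0\}$; for $r\le 2r_0$ the lowest point of $B$ on the vertical line through $(x_1,x_2,0)$ has height $r^{1+\alpha}$. A homogeneous solid of density $\rho_{\mathcal S}>0$ occupies $\mathcal S(t)=B+h(t)\mathbf e_3\subset\overline\Omega$ with $h$ absolutely continuous and $h(0)>0$, $\mathcal S(0)\subset\Omega$; it rotates at most about the $x_3$-axis. The only possible contact point is the origin, and $\operatorname{dist}(\mathcal S(t),\partial\Omega\setminus\Gamma)\ge d_0$ for all $t$. Let $\mathcal F(t)=\Omega\setminus\mathcal S(t)$, $m=\rho_{\mathcal S}|\mathcal S(0)|$, and let $\mathbf G(t)$ be the centre of mass. The fields are extended to the solid by $\rho=\rho_{\mathcal S}$, $\mathbf u=\dot h\,\mathbf e_3+\omega(t)\mathbf e_3\times(x-\mathbf G(t))$ and the solid's temperature. A *weak solution* on $[0,T)$ has $\rho\in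 L^\infty(0,T;L^\gamma(\Omega))$, $\mathbf u\in L^2(0,T;W^{1,2}_0(\Omega))$, $\rho|\mathbf u|^2\in L^\infty(0,T;L^1(\Omega))$, $\vartheta\in L^\infty(0,T;L^4(\Omega))$, $\vartheta,\log\vartheta,\vartheta^{\beta/2}\in L^2(0,T;W^{1,2}(\Omega))$, and satisfies: the weak continuity equation in $\Omega$; the weak momentum equation $$\int_0^T\!\!\int_\Omega\rho\mathbf u\cdot\partial_t\phi+\rho\mathbf u\otimes\mathbf u:\nabla\phi+p\operatorname{div}\phi-\mathbb S:\nabla\phi-\rho g\,\mathbf e_3\cdot\phi\,dx\,dt=-\int_\Omega\mathbf m_0\cdot\phi(0)\,dx$$ for all $\phi\in C_c^\infty([0,T)\times\Omega;\mathbb R^3)$ with $\mathbb D(\phi)=0$ in a neighbourhood of the solid; and the weak form of $\partial_t(\rho s)+\operatorname{div}(\rho s\mathbf u)+\operatorname{div}(\mathbf q/\vartheta)\ge\frac1\vartheta\big(\mathbb S:\nabla\mathbf u-\frac{\mathbf q\cdot\nabla\vartheta}{\vartheta}\big)$ in the fluid with $\mathbf q\cdot\mathbf n=0$ on $\partial\Omega$,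 the right-hand side being integrable. The initial data $\rho_0\ge0$, $\vartheta_0>0$, $\mathbf m_0$ are compatible ($\mathbf m_0=0$ where $\rho_0=0$; $\rho_0=\rho_{\mathcal S}$ and $\mathbf m_0=\rho_{\mathcal S}(V_0\mathbf e_3+\omega_0\mathbf e_3\times(x-\mathbf G(0)))$ on $\mathcal S(0)$), with $\rho_0\in L^\gamma(\Omega)$, $\mathbf m_0\in L^{2\gamma/(\gamma+1)}(\Omega)$, $|\mathbf m_0|^2/\rho_0\in L^1(\Omega)$, and the initial internal energy and entropy of the fluid are integrable. With $\mathbb J(0)$ the inertia tensor of $\mathcal S(0)$, set $$E_0=\int_{\mathcal F(0)}\frac{|\mathbf m_0|^2}{2\rho_0}+\rho_0e(\rho_0,\vartheta_0)\,dx+\frac m2V_0^2+\frac12\,\mathbb J(0)\omega_0\mathbf e_3\cdot\omega_0\mathbf e_3 .$$ A weak solution *enjoys the uniform bounds with constant $K$* if each of $\|\rho\|^\gamma_{L^\infty(0,T;L^\gamma(\mathcal F(\cdot)))}$, $\|\mathbf u\|^2_{L^2(0,T;W^{1,2}_0(\Omega))}$, $\|\rho|\mathbf u|^2\|_{L^\infty(0,T;L^1(\Omega))}$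 and $\|\vartheta^{\beta/2}\|^2_{L^2(0,T;W^{1,2}(\Omega))}$ is at most $K(E_0+1)$. **Theorem.** Let $$0<\alpha<\min\Big\{\frac{3(\gamma-3)}{4\gamma+3},\ \frac{3(\beta-2)}{9\beta+2}\Big\}$$ and let $K>0$. There is a constant $C_0>0$, depending only on the fluid model, $\alpha,g,\Omega,B,r_0,d_0$ and $K$ (in particular not on $m$, $T$, $h(0)$ or the other initial data), such that the following holds. If the mass is large and the initial velocities of the solid are small in the sense that $$A:=C_0\max\{m^{-1/2},m^{-3/2}\}\Big(1+E_0^{\frac12+\frac1\gamma+\frac12}\Big)<1,$$ then for every weak solution as above that enjoys the uniform bounds with constant $K$ on $(0,T)$ with $T>\frac{A}{1-A}$, the solid touches $\partial\Omega$ in finite time: $\mathcal S(t)\cap\partial\Omega\neq\emptyset$ for some $0<t\le\frac{A}{1-A}$. Equivalently, no such solution stays collision-free beyond the time $A/(1-A)$. -/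

import Mathlib

open MeasureTheory Set
open scoped ENNReal NNReal

noncomputable section

namespace Collision

/-- Three-dimensional Euclidean space; the coordinates `x 0, x 1, x 2` are `x₁, x₂, x₃`. -/
abbrev E3 := EuclideanSpace ℝ (Fin 3)

/-- Real `3 × 3` matrices. -/
abbrev Mat3 := Matrix (Fin 3) (Fin 3) ℝ

/-- The `j`-th unit vector. -/
def unitVec (j : Fin 3) : E3 := EuclideanSpace.single j 1

/-- The vertical unit vector `e₃`. -/
def e3 : E3 := unitVec 2

/-- Distance to the vertical axis, `r = √(x₁² + x₂²)`. -/
def axisDist (x : E3) : ℝ := √(x 0 ^ 2 + x 1 ^ 2)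

/-- Frobenius product `A : B`. -/
def ddot (A B : Mat3) : ℝ := ∑ i, ∑ j, A i j * B i j

/-- Cross product on `ℝ³`. -/
def cross (v w : E3) : E3 :=
  !₂[v 1 * w 2 - v 2 * w 1, v 2 * w 0 - v 0 * w 2, v 0 * w 1 - v 1 * w 0]

/-! ### Domains of class `C^{1,α}` -/

/-- `U` is an open set with boundary of class `C^{1,α}`: near each boundary point, after an
isometric change of coordinates, `U` is the strict epigraph of a `C¹` function of two variables
with `α`-Hölder derivative. -/
def IsC1HolderOpen (α : ℝ) (U : Set E3) : Prop :=
  IsOpen U ∧ ∀ x₀ ∈ frontier U,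
    ∃ (A : E3 ≃ₗᵢ[ℝ] E3) (δ C : ℝ) (f : EuclideanSpace ℝ (Fin 2) → ℝ),
      0 < δ ∧ ContDiff ℝ 1 f ∧
      (∀ y z, ‖fderiv ℝ f y - fderiv ℝ f z‖ ≤ C * ‖y - z‖ ^ α) ∧
      ∀ x, ‖x - x₀‖ < δ →
        (x ∈ U ↔ f !₂[A (x - x₀) 0, A (x - x₀) 1] < A (x - x₀) 2)

/-! ### Weak derivatives and Sobolev functions -/

/-- Smooth functions with compact support in the open set `Ω`. -/
def IsTestOn {F : Type*} [NormedAddCommGroup F] [NormedSpace ℝ F] (Ω : Set E3)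
    (ψ : E3 → F) : Prop :=
  ContDiff ℝ (⊤ : ℕ∞) ψ ∧ HasCompactSupport ψ ∧ tsupport ψ ⊆ Ω

/-- Jacobian matrix, `(∇v)ᵢⱼ = ∂ⱼ vᵢ`. -/
def jacobian (v : E3 → E3) (x : E3) : Mat3 := fun i j => fderiv ℝ v x (unitVec j) i

/-- `g` is the weak gradient of the scalar function `f` in `Ω`. -/
def HasWeakGrad (Ω : Set E3) (f : E3 → ℝ) (g : E3 → E3) : Prop :=
  LocallyIntegrableOn f Ω ∧ LocallyIntegrableOn g Ω ∧
  ∀ ψ : E3 → ℝ, IsTestOn Ω ψ → ∀ j,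
    ∫ x in Ω, f x * fderiv ℝ ψ x (unitVec j) = - ∫ x in Ω, g x j * ψ x

/-- `v ∈ W₀^{1,2}(Ω; ℝ³)` with weak gradient `A`: the pair `(v, A)` is a limit in `L²(Ω)` of pairs
`(ψ, ∇ψ)` with `ψ ∈ C_c^∞(Ω; ℝ³)`. -/
def IsW012 (Ω : Set E3) (v : E3 → E3) (A : E3 → Mat3) : Prop :=
  MemLp v 2 (volume.restrict Ω) ∧
  (∀ i j, MemLp (fun x => A x i j) 2 (volume.restrict Ω)) ∧
  ∀ ε : ℝ, 0 < ε → ∃ ψ : E3 → E3, IsTestOn Ω ψ ∧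
    ∫⁻ x in Ω, ENNReal.ofReal
      (‖v x - ψ x‖ ^ 2 + ddot (A x - jacobian ψ x) (A x - jacobian ψ x)) < ENNReal.ofReal ε

/-! ### The fluid model -/

/-- Parameters of the fluid: adiabatic exponent `γ`, growth exponent `β` of the heat conductivity,
pressure constant `p_∞`, specific heat `c_v`, Stefan–Boltzmann constant `a`, shear viscosity `μ`,
bulk viscosity `η`, heat conductivity `κ` (the last three as functions of the temperature). -/
structure FluidModel where
  γ : ℝ
  β : ℝ
  pInf : ℝ
  cv : ℝ
  a : ℝ
  μ : ℝ → ℝ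
  η : ℝ → ℝ
  κ : ℝ → ℝ

namespace FluidModel

/-- The structural assumptions: `1 + ϑ ≲ μ(ϑ)` with `μ` Lipschitz, `0 ≤ η(ϑ) ≲ 1 + ϑ`, and
`κ(ϑ) ∼ 1 + ϑ^β`, all on `(0, ∞)`. -/
structure Admissible (M : FluidModel) : Prop where
  pInf_pos : 0 < M.pInf
  cv_pos : 0 < M.cv
  a_pos : 0 < M.a
  μ_lipschitz : ∃ L : ℝ≥0, LipschitzOnWith L M.μ (Ioi 0)
  μ_lower : ∃ c > 0, ∀ θ > 0, c * (1 + θ) ≤ M.μ θ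
  η_cont : ContinuousOn M.η (Ioi 0)
  η_nonneg : ∀ θ > 0, 0 ≤ M.η θ
  η_upper : ∃ c : ℝ, ∀ θ > 0, M.η θ ≤ c * (1 + θ)
  κ_cont : ContinuousOn M.κ (Ioi 0)
  κ_lower : ∃ c > 0, ∀ θ > 0, c * (1 + θ ^ M.β) ≤ M.κ θ
  κ_upper : ∃ c : ℝ, ∀ θ > 0, M.κ θ ≤ c * (1 + θ ^ M.β)

variable (M : FluidModel)

/-- `p(ρ, ϑ) = p_∞ ρ^γ + c_v (γ - 1) ρ ϑ + (a/3) ϑ⁴`. -/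
def pressure (ρ θ : ℝ) : ℝ :=
  M.pInf * ρ ^ M.γ + M.cv * (M.γ - 1) * ρ * θ + M.a / 3 * θ ^ 4

/-- Internal energy per unit volume, `ρ e(ρ, ϑ) = p_∞/(γ-1) ρ^γ + c_v ρ ϑ + a ϑ⁴`; the product is
written out so that it is also meaningful where `ρ = 0`. -/
def energyDensity (ρ θ : ℝ) : ℝ :=
  M.pInf / (M.γ - 1) * ρ ^ M.γ + M.cv * ρ * θ + M.a * θ ^ 4

/-- Entropy per unit volume, `ρ s(ρ, ϑ) = c_v ρ log (ϑ / ρ^(γ-1)) + (4a/3) ϑ³`; at `ρ = 0` the first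
term is `0`. -/
def entropyDensity (ρ θ : ℝ) : ℝ :=
  M.cv * ρ * (Real.log θ - (M.γ - 1) * Real.log ρ) + 4 * M.a / 3 * θ ^ 3

/-- Newtonian stress as a function of the temperature and of the velocity gradient `A`:
`2 μ(ϑ) (D - ⅓ (tr D) I) + η(ϑ) (tr D) I`, where `D = (A + Aᵀ)/2`. -/
def stress (θ : ℝ) (A : Mat3) : Mat3 :=
  (2 * M.μ θ) • ((1 / 2 : ℝ) • (A + A.transpose) - (A.trace / 3) • (1 : Mat3))
    + (M.η θ * A.trace) • (1 : Mat3)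

/-- Fourier's law `q = -κ(ϑ) ∇ϑ`. -/
def heatFlux (θ : ℝ) (G : E3) : E3 := -(M.κ θ) • G

/-- `(S : ∇u - q · ∇ϑ / ϑ) / ϑ`. -/
def entropyProduction (θ : ℝ) (A : Mat3) (G : E3) : ℝ :=
  (ddot (M.stress θ A) A - inner ℝ (M.heatFlux θ G) G / θ) / θ

end FluidModel

/-! ### Container and body -/

/-- The body at height `h`: the reference body `B`, whose lower tip is the origin, translated by
`h e₃`. -/
def bodyAt (B : Set E3) (h : ℝ) : Set E3 := {x | x - h • e3 ∈ B}

/-- Centre of mass of a homogeneous body. -/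
def centerOfMass (S : Set E3) : E3 := ⨍ x in S, x

/-- The flat piece `[-2r₀, 2r₀]² × {0}`. -/
def flatPatch (r₀ : ℝ) : Set E3 := {x | |x 0| ≤ 2 * r₀ ∧ |x 1| ≤ 2 * r₀ ∧ x 2 = 0}

/-- Assumptions on the container `Ω` and the reference body `B`. -/
structure Geometry (Ω B : Set E3) (α r₀ : ℝ) : Prop where
  container_bounded : Bornology.IsBounded Ω
  container_connected : IsConnected Ω
  container_regular : IsC1HolderOpen α Ω
  body_compact : IsCompact B
  body_simplyConnected : SimplyConnectedSpace B
  body_connected : IsConnected (interior B)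
  body_closure : closure (interior B) = B
  body_regular : IsC1HolderOpen α (interior B)
  /-- `B` is rotationally symmetric about the vertical axis. -/
  body_symmetric : ∀ x y : E3, x ∈ B → axisDist x = axisDist y → x 2 = y 2 → y ∈ B
  /-- Near `r = 0` the boundary of `Ω` is flat and horizontal, with `Ω` above it. -/
  flat_bottom : ∃ ε > 0, ∀ x : E3, |x 0| ≤ 2 * r₀ → |x 1| ≤ 2 * r₀ → |x 2| < ε →
    (x ∈ Ω ↔ 0 < x 2)
  /-- The lower part of the boundary of `B` is `x₃ = r^(1+α)` for `r ≤ 2r₀`. -/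
  body_tip : ∀ s t : ℝ, √(s ^ 2 + t ^ 2) ≤ 2 * r₀ →
    IsLeast {z : ℝ | !₂[s, t, z] ∈ B} (√(s ^ 2 + t ^ 2) ^ (1 + α))

/-! ### Initial data -/

/-- Initial height `h₀`, density `ρ_S` of the solid, initial vertical velocity `V₀` and angular
velocity `ω₀` (about the vertical axis) of the solid, initial density, temperature and momentum. -/
structure InitialData where
  h₀ : ℝ
  ρS : ℝ
  V₀ : ℝ
  ω₀ : ℝ
  ρ₀ : E3 → ℝ
  θ₀ : E3 → ℝ
  m₀ : E3 → E3

/-- Velocity at `x` of a solid with centre of mass `G`, translational velocity `V e₃` and angular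
velocity `ω e₃`. -/
def rigidVelocity (G : E3) (V ω : ℝ) (x : E3) : E3 := V • e3 + cross (ω • e3) (x - G)

namespace InitialData

variable (D : InitialData)

/-- Mass of the solid. -/
def mass (B : Set E3) : ℝ := D.ρS * (volume (bodyAt B D.h₀)).toReal

/-- `J(0) ω · ω = ∫_{S(0)} ρ_S (|x - G|² |ω|² - ((x - G) · ω)²)`. -/
def inertia (B : Set E3) (ω : E3) : ℝ :=
  ∫ x in bodyAt B D.h₀, D.ρS * (‖x - centerOfMass (bodyAt B D.h₀)‖ ^ 2 * ‖ω‖ ^ 2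
    - (inner ℝ (x - centerOfMass (bodyAt B D.h₀)) ω) ^ 2)

/-- Initial energy `E₀`. -/
def energy (M : FluidModel) (Ω B : Set E3) : ℝ :=
  (∫ x in Ω \ bodyAt B D.h₀,
      (‖D.m₀ x‖ ^ 2 / (2 * D.ρ₀ x) + M.energyDensity (D.ρ₀ x) (D.θ₀ x)))
    + D.mass B / 2 * D.V₀ ^ 2 + 1 / 2 * D.inertia B (D.ω₀ • e3)

/-- Compatibility and finite energy of the initial data. -/
structure Admissible (M : FluidModel) (Ω B : Set E3) : Prop where
  height_pos : 0 < D.h₀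
  body_inside : bodyAt B D.h₀ ⊆ Ω
  solid_density_pos : 0 < D.ρS
  density_memLp : MemLp D.ρ₀ (ENNReal.ofReal M.γ) (volume.restrict Ω)
  momentum_memLp : MemLp D.m₀ (ENNReal.ofReal (2 * M.γ / (M.γ + 1))) (volume.restrict Ω)
  temperature_meas : AEMeasurable D.θ₀ (volume.restrict Ω)
  density_nonneg : ∀ᵐ x ∂volume.restrict Ω, 0 ≤ D.ρ₀ x
  temperature_pos : ∀ᵐ x ∂volume.restrict Ω, 0 < D.θ₀ x
  momentum_vacuum : ∀ᵐ x ∂volume.restrict Ω, D.ρ₀ x = 0 → D.m₀ x = 0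
  kinetic_integrable : IntegrableOn (fun x => ‖D.m₀ x‖ ^ 2 / D.ρ₀ x) Ω
  energy_integrable :
    IntegrableOn (fun x => M.energyDensity (D.ρ₀ x) (D.θ₀ x)) (Ω \ bodyAt B D.h₀)
  entropy_integrable :
    IntegrableOn (fun x => M.entropyDensity (D.ρ₀ x) (D.θ₀ x)) (Ω \ bodyAt B D.h₀)
  solid_density : ∀ᵐ x ∂volume.restrict (bodyAt B D.h₀), D.ρ₀ x = D.ρS
  solid_momentum : ∀ᵐ x ∂volume.restrict (bodyAt B D.h₀),
    D.m₀ x = D.ρS • rigidVelocity (centerOfMass (bodyAt B D.h₀)) D.V₀ D.ω₀ x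

end InitialData

/-! ### Weak solutions -/

/-- The unknowns: height `h`, vertical velocity `V` and angular velocity `ω` of the solid, and the
density, velocity and temperature, extended to the solid, as functions of `(t, x)`, together with
the spatial weak gradients of velocity and temperature. -/
structure Motion where
  h : ℝ → ℝ
  V : ℝ → ℝ
  ω : ℝ → ℝ
  ρ : ℝ × E3 → ℝ
  u : ℝ × E3 → E3
  θ : ℝ × E3 → ℝ
  gradu : ℝ × E3 → Mat3
  gradθ : ℝ × E3 → E3

/-- The space-time cylinder `(0,T) × Ω`. -/
def cylinder (T : ℝ) (Ω : Set E3) : Set (ℝ × E3) := Ioo 0 T ×ˢ Ω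

namespace Motion

variable (w : Motion)

/-- The solid at time `t`. -/
def solid (B : Set E3) (t : ℝ) : Set E3 := bodyAt B (w.h t)

/-- The space-time set occupied by the solid during `[0,T)`. -/
def solidRegion (B : Set E3) (T : ℝ) : Set (ℝ × E3) := {z | z.1 ∈ Ico 0 T ∧ z.2 ∈ w.solid B z.1}

/-- The space-time set occupied by the fluid during `(0,T)`. -/
def fluidRegion (Ω B : Set E3) (T : ℝ) : Set (ℝ × E3) :=
  {z | z.1 ∈ Ioo 0 T ∧ z.2 ∈ Ω \ w.solid B z.1}

end Motion

/-- Time derivative of a function of `(t, x)`. -/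
def dt {F : Type*} [NormedAddCommGroup F] [NormedSpace ℝ F] (φ : ℝ × E3 → F) (z : ℝ × E3) : F :=
  deriv (fun s => φ (s, z.2)) z.1

/-- Spatial gradient of a scalar function of `(t, x)`. -/
def gradX (ψ : ℝ × E3 → ℝ) (z : ℝ × E3) : E3 := gradient (fun y => ψ (z.1, y)) z.2

/-- Spatial Jacobian of a vector function of `(t, x)`. -/
def jacX (φ : ℝ × E3 → E3) (z : ℝ × E3) : Mat3 := jacobian (fun y => φ (z.1, y)) z.2

/-- Test functions in `C_c^∞([0,T) × Ω)`, as restrictions to `t ≥ 0` of smooth functions on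
`ℝ × ℝ³` with compact support in `(-∞,T) × Ω`. -/
def IsSpaceTimeTest {F : Type*} [NormedAddCommGroup F] [NormedSpace ℝ F] (T : ℝ) (Ω : Set E3)
    (φ : ℝ × E3 → F) : Prop :=
  ContDiff ℝ (⊤ : ℕ∞) φ ∧ HasCompactSupport φ ∧ tsupport φ ⊆ Iio T ×ˢ Ω

/-- `f(t)` is bounded for almost every `t ∈ (0,T)`. -/
def EssBddInTime (T : ℝ) (f : ℝ → ℝ≥0∞) : Prop :=
  ∃ C : ℝ≥0, ∀ᵐ t ∂volume.restrict (Ioo 0 T), f t ≤ C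

/-- `f ∈ L²(0,T; W^{1,2}(Ω))` with gradient `G` and squared norm
`∫₀ᵀ ∫_Ω |f|² + |∇f|² ≤ C`. -/
def L2W12Bound (T : ℝ) (Ω : Set E3) (f : ℝ × E3 → ℝ) (G : ℝ × E3 → E3) (C : ℝ≥0∞) : Prop :=
  AEMeasurable f (volume.restrict (cylinder T Ω)) ∧
  AEMeasurable G (volume.restrict (cylinder T Ω)) ∧
  (∀ᵐ t ∂volume.restrict (Ioo 0 T), HasWeakGrad Ω (fun x => f (t, x)) (fun x => G (t, x))) ∧
  ∫⁻ z in cylinder T Ω, ENNReal.ofReal (f z ^ 2 + ‖G z‖ ^ 2) ≤ C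

/-- Weak solutions on `[0,T)` of the compressible Navier–Stokes–Fourier system coupled with a rigid
body `S(t) = B + h(t) e₃` which translates vertically and rotates at most about the vertical axis,
under the gravity force `-g e₃`. -/
structure IsWeakSolution (M : FluidModel) (Ω B : Set E3) (g : ℝ) (D : InitialData) (T : ℝ)
    (w : Motion) : Prop where
  -- motion of the solid
  velocity_integrable : IntervalIntegrable w.V volume 0 T
  height_eq : ∀ t ∈ Ico 0 T, w.h t = D.h₀ + ∫ s in (0 : ℝ)..t, w.V s
  body_in_container : ∀ t ∈ Ico 0 T, w.solid B t ⊆ closure Ω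
  -- regularity class
  ρ_meas : AEMeasurable w.ρ (volume.restrict (cylinder T Ω))
  u_meas : AEMeasurable w.u (volume.restrict (cylinder T Ω))
  gradu_meas : ∀ i j, AEMeasurable (fun z => w.gradu z i j) (volume.restrict (cylinder T Ω))
  ρ_nonneg : ∀ᵐ z ∂volume.restrict (cylinder T Ω), 0 ≤ w.ρ z
  θ_pos : ∀ᵐ z ∂volume.restrict (cylinder T Ω), 0 < w.θ z
  ρ_bound : EssBddInTime T fun t => ∫⁻ x in Ω, ENNReal.ofReal (w.ρ (t, x) ^ M.γ)
  kinetic_bound :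
    EssBddInTime T fun t => ∫⁻ x in Ω, ENNReal.ofReal (w.ρ (t, x) * ‖w.u (t, x)‖ ^ 2)
  u_W012 : ∀ᵐ t ∂volume.restrict (Ioo 0 T),
    IsW012 Ω (fun x => w.u (t, x)) (fun x => w.gradu (t, x))
  u_bound : ∫⁻ z in cylinder T Ω,
    ENNReal.ofReal (‖w.u z‖ ^ 2 + ddot (w.gradu z) (w.gradu z)) < ∞
  θ_L4 : EssBddInTime T fun t => ∫⁻ x in Ω, ENNReal.ofReal (w.θ (t, x) ^ 4)
  θ_W12 : ∃ C : ℝ≥0, L2W12Bound T Ω w.θ w.gradθ C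
  θ_log_W12 : ∃ (G : ℝ × E3 → E3) (C : ℝ≥0), L2W12Bound T Ω (fun z => Real.log (w.θ z)) G C
  θ_pow_W12 : ∃ (G : ℝ × E3 → E3) (C : ℝ≥0), L2W12Bound T Ω (fun z => w.θ z ^ (M.β / 2)) G C
  -- on the solid the density is constant and the velocity is the rigid one
  ρ_solid : ∀ᵐ t ∂volume.restrict (Ioo 0 T), ∀ᵐ x ∂volume.restrict (w.solid B t),
    w.ρ (t, x) = D.ρS
  u_solid : ∀ᵐ t ∂volume.restrict (Ioo 0 T), ∀ᵐ x ∂volume.restrict (w.solid B t),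
    w.u (t, x) = rigidVelocity (centerOfMass (w.solid B t)) (w.V t) (w.ω t) x
  -- conservation of mass
  continuity : ∀ ψ : ℝ × E3 → ℝ, IsSpaceTimeTest T Ω ψ →
    ∫ z in cylinder T Ω, (w.ρ z * dt ψ z + w.ρ z * inner ℝ (w.u z) (gradX ψ z))
      = - ∫ x in Ω, D.ρ₀ x * ψ (0, x)
  -- conservation of momentum of fluid and solid, tested with functions whose symmetric gradient
  -- vanishes in a neighbourhood of the solid
  momentum : ∀ φ : ℝ × E3 → E3, IsSpaceTimeTest T Ω φ →
    (∃ U : Set (ℝ × E3), IsOpen U ∧ w.solidRegion B T ⊆ U ∧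
      ∀ z ∈ U, jacX φ z + (jacX φ z).transpose = 0) →
    ∫ z in cylinder T Ω,
        (w.ρ z * inner ℝ (w.u z) (dt φ z)
          + w.ρ z * ddot (fun i j => w.u z i * w.u z j) (jacX φ z)
          + M.pressure (w.ρ z) (w.θ z) * (jacX φ z).trace
          - ddot (M.stress (w.θ z) (w.gradu z)) (jacX φ z)
          + w.ρ z * inner ℝ (-g • e3) (φ z))
      = - ∫ x in Ω, inner ℝ (D.m₀ x) (φ (0, x))
  -- entropy inequality in the fluid, with no heat flux through the boundary of the container
  production_integrable : IntegrableOn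
    (fun z => M.entropyProduction (w.θ z) (w.gradu z) (w.gradθ z)) (w.fluidRegion Ω B T)
  entropy : ∀ ψ : ℝ × E3 → ℝ, IsSpaceTimeTest T univ ψ → (∀ z, 0 ≤ ψ z) →
    (∃ U : Set (ℝ × E3), IsOpen U ∧ w.solidRegion B T ⊆ U ∧ ∀ z ∈ U, ψ z = 0) →
    ∫ z in w.fluidRegion Ω B T,
        (M.entropyDensity (w.ρ z) (w.θ z) * dt ψ z
          + M.entropyDensity (w.ρ z) (w.θ z) * inner ℝ (w.u z) (gradX ψ z)
          + inner ℝ (M.heatFlux (w.θ z) (w.gradθ z)) (gradX ψ z) / w.θ z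
          + M.entropyProduction (w.θ z) (w.gradu z) (w.gradθ z) * ψ z)
      ≤ - ∫ x in Ω \ bodyAt B D.h₀, M.entropyDensity (D.ρ₀ x) (D.θ₀ x) * ψ (0, x)

/-- The uniform bounds on `(0,T)` for density, velocity and temperature, with constant `K`:
each of `‖ρ‖^γ` in `L^∞(0,T; L^γ(F))`, `‖u‖²` in `L²(0,T; W₀^{1,2}(Ω))`, `‖ρ|u|²‖` in
`L^∞(0,T; L¹(Ω))` and `‖ϑ^{β/2}‖²` in `L²(0,T; W^{1,2}(Ω))` is at most `K (E₀ + 1)`. -/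
structure UniformBounds (M : FluidModel) (Ω B : Set E3) (D : InitialData) (T K : ℝ)
    (w : Motion) : Prop where
  density : ∀ᵐ t ∂volume.restrict (Ioo 0 T),
    ∫⁻ x in Ω \ w.solid B t, ENNReal.ofReal (w.ρ (t, x) ^ M.γ)
      ≤ ENNReal.ofReal (K * (D.energy M Ω B + 1))
  velocity : ∫⁻ z in cylinder T Ω,
    ENNReal.ofReal (‖w.u z‖ ^ 2 + ddot (w.gradu z) (w.gradu z))
      ≤ ENNReal.ofReal (K * (D.energy M Ω B + 1))
  kinetic : ∀ᵐ t ∂volume.restrict (Ioo 0 T),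
    ∫⁻ x in Ω, ENNReal.ofReal (w.ρ (t, x) * ‖w.u (t, x)‖ ^ 2)
      ≤ ENNReal.ofReal (K * (D.energy M Ω B + 1))
  temperature : ∃ G : ℝ × E3 → E3, L2W12Bound T Ω (fun z => w.θ z ^ (M.β / 2)) G
    (ENNReal.ofReal (K * (D.energy M Ω B + 1)))

/-- During `[0,T)` the solid can meet the boundary of the container only at the origin, and stays
at distance at least `d₀` from the boundary outside the flat piece. -/
structure CollisionOnlyAtTip (Ω B : Set E3) (r₀ d₀ T : ℝ) (w : Motion) : Prop where
  contact_point : ∀ t ∈ Ico 0 T, w.solid B t ∩ frontier Ω ⊆ {0}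
  far_from_rest : ∀ t ∈ Ico 0 T, ∀ x ∈ w.solid B t, ∀ y ∈ frontier Ω \ flatPatch r₀,
    d₀ ≤ dist x y

/-- The quantity `C₀ max{m^{-1/2}, m^{-3/2}} (1 + E₀^{1/2 + 1/γ + 1/2})` whose smallness expresses
that the mass of the solid is large and its initial velocities are small. -/
def smallness (C₀ : ℝ) (M : FluidModel) (Ω B : Set E3) (D : InitialData) : ℝ :=
  C₀ * max (D.mass B ^ (-(1 / 2) : ℝ)) (D.mass B ^ (-(3 / 2) : ℝ))
    * (1 + D.energy M Ω B ^ (1 / 2 + 1 / M.γ + 1 / 2))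

end Collision

end

open Collision

/-! ### Coordinates and the distance to the vertical axis -/

namespace Collision

/-! The momentum equation is tested with a field that equals `ζ(t) e₃` near the solid and vanishes
near `∂Ω`. On the solid only inertia and gravity survive and give `m (∫ ζ' V - g ∫ ζ)`, where `∫ ζ`
is proportional to the length `T'` of the time interval. So a collision-free interval costs the
weight `m g c T'`, and all other terms must be small against it when the solid is heavy. The
difficulty is that the test field drops from `e₃` to `0` across a gap that may close, while the
bounds must not depend on the height of the solid.

The field. For height `s` let `ψ = s + r^(1+α)`, smoothed at the axis by a parameter `ε`, be the gap
width below the tip. Let `χ` be a cut-off that depends on `x₃ / ψ` near the tip, and let `W = curl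
(χ (-x₂, x₁, 0) / 2)`. Then `div W = 0`, so the pressure disappears. The factor `r` in the potential
softens the singularity: `|W| ≲ 1 + r/ψ`, while the derivatives in `x` and in `s` are `≲ 1 + 1/ψ +
r/ψ²`, singular only where `r ≤ r₀` and `0 < x₃ ≤ ψ`. Since there `ψ` dominates both `x₃` and
`r^(1+α)`, interpolation gives `1/ψ + r/ψ² ≲ |x₁x₂x₃|^(-τ)` with `τ = (1+2α)/(3+α)`
(`gap_weight_le`, `exists_field_bounds`). This weight does not see `s` or `ε`, and its `p`-th power
is integrable as soon as `τ p < 1`. `exists_testField` assembles the field.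

The fluid terms. Convection `ρ|u|²|∇φ|`, with `ρ ∈ L^γ` and `u ∈ L⁶`, requires the weight in `L^p`
with `p = 3γ/(2γ-3)`. The stress grows like `(1+ϑ)|∇u|`, so `ϑ|∇φ|` must be in `L²`; as `ϑ^(β/2) ∈
L⁶` near the flat bottom, this requires `p = 6β/(3β-2)`. The two conditions `τ p < 1` are exactly
the two bounds on `α`. The estimate at fixed time is `exists_lintegral_momentumDensity_le`; the
Sobolev inequality for the temperature, which has no zero trace, is `exists_sobolev_tipZone`.

Time. The kinetic energy of the solid is part of `∫ ρ|u|²`, so `|V| ≤ σ √Q` with `σ = m^(-1/2)` and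
`Q = K (E₀+1)`. Hence the height is Lipschitz, and the field can follow a smooth approximation of it
with the same Lipschitz constant (`exists_movingTest`).

Conclusion. `exists_momentum_balance_le` bounds `m g c T'` by quantities that are together at most
`C (mσ + 1 + σ)(1 + T')(1 + E₀^(1+1/γ))`. Since `σ² m = 1`, dividing by `m` turns the first bracket
into `σ + σ² + σ³ ≤ 3 max(σ, σ³)`. For `T' = A/(1-A)`, that is `T' = A (1 + T')`, this contradicts
the definition of `A` once `C₀` is large (`exists_smallness_constant`). -/

theorem dist_sq_eq (x y : E3) :
    dist x y ^ 2 = (x 0 - y 0) ^ 2 + (x 1 - y 1) ^ 2 + (x 2 - y 2) ^ 2 := by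
  rw [EuclideanSpace.dist_eq, Real.sq_sqrt (by positivity), Fin.sum_univ_three]
  simp [Real.dist_eq, sq_abs]

theorem norm_sq_eq_coords (x : E3) : ‖x‖ ^ 2 = x 0 ^ 2 + x 1 ^ 2 + x 2 ^ 2 := by
  rw [EuclideanSpace.norm_eq, Real.sq_sqrt (by positivity), Fin.sum_univ_three]
  simp [sq_abs]

theorem abs_coord_sub_le_dist (x y : E3) (i : Fin 3) : |x i - y i| ≤ dist x y := by
  rw [dist_eq_norm]
  simpa using PiLp.norm_apply_le (x - y) i

theorem abs_coord_le_norm (x : E3) (i : Fin 3) : |x i| ≤ ‖x‖ := by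
  simpa using PiLp.norm_apply_le x i

theorem norm_le_sum_abs (x : E3) : ‖x‖ ≤ |x 0| + |x 1| + |x 2| := by
  refine abs_le_of_sq_le_sq' ?_ (by positivity) |>.2
  rw [norm_sq_eq_coords, ← sq_abs (x 0), ← sq_abs (x 1), ← sq_abs (x 2)]
  nlinarith [mul_nonneg (abs_nonneg (x 0)) (abs_nonneg (x 1)),
    mul_nonneg (abs_nonneg (x 0)) (abs_nonneg (x 2)),
    mul_nonneg (abs_nonneg (x 1)) (abs_nonneg (x 2))]

theorem axisDist_nonneg (x : E3) : 0 ≤ axisDist x := Real.sqrt_nonneg _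

theorem axisDist_sq (x : E3) : axisDist x ^ 2 = x 0 ^ 2 + x 1 ^ 2 :=
  Real.sq_sqrt (by positivity)

theorem abs_coord_zero_le_axisDist (x : E3) : |x 0| ≤ axisDist x :=
  Real.abs_le_sqrt (by nlinarith [sq_nonneg (x 1)])

theorem abs_coord_one_le_axisDist (x : E3) : |x 1| ≤ axisDist x :=
  Real.abs_le_sqrt (by nlinarith [sq_nonneg (x 0)])

theorem axisDist_le_add_dist (x y : E3) : axisDist x ≤ axisDist y + dist x y := by
  have h1 := dist_sq_eq x y
  have hx := axisDist_sq x
  have hy := axisDist_sq y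
  have ha := axisDist_nonneg y
  have hd : 0 ≤ dist x y := dist_nonneg
  refine abs_le_of_sq_le_sq' ?_ (by positivity) |>.2
  have h2 : (x 0 - y 0) ^ 2 + (x 1 - y 1) ^ 2 ≤ dist x y ^ 2 := by nlinarith [sq_nonneg (x 2 - y 2)]
  have h3 : (x 0 - y 0) * y 0 + (x 1 - y 1) * y 1 ≤ axisDist y * dist x y := by
    refine abs_le_of_sq_le_sq' ?_ (by positivity) |>.2
    rw [mul_pow, hy]
    calc ((x 0 - y 0) * y 0 + (x 1 - y 1) * y 1) ^ 2
        ≤ (y 0 ^ 2 + y 1 ^ 2) * ((x 0 - y 0) ^ 2 + (x 1 - y 1) ^ 2) := by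
          nlinarith [sq_nonneg ((x 0 - y 0) * y 1 - (x 1 - y 1) * y 0)]
      _ ≤ _ := by gcongr
  nlinarith

theorem continuous_axisDist : Continuous axisDist := by
  unfold axisDist; fun_prop

/-- A segment that misses the frontier would be separated by the open sets `interior Ω` and
`(closure Ω)ᶜ`, against its connectedness. -/
theorem exists_mem_frontier_segment {Ω : Set E3} {a b : E3} (ha : a ∈ Ω) (hb : b ∉ Ω) :
    ∃ y ∈ segment ℝ a b, y ∈ frontier Ω := by
  by_contra! h
  have hs : IsPreconnected (segment ℝ a b) := (convex_segment a b).isPreconnected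
  have hcov : segment ℝ a b ⊆ interior Ω ∪ (closure Ω)ᶜ := by
    intro y hy
    by_cases hc : y ∈ closure Ω
    · left
      by_contra hi
      exact h y hy ⟨hc, hi⟩
    · exact Or.inr hc
  have ha' : a ∈ interior Ω := by
    rcases hcov (left_mem_segment ℝ a b) with h | h
    · exact h
    · exact absurd (subset_closure ha) h
  have hb' : b ∈ (closure Ω)ᶜ := by
    rcases hcov (right_mem_segment ℝ a b) with h | h
    · exact absurd (interior_subset h) hb
    · exact h
  obtain ⟨z, -, hz1, hz2⟩ := hs _ _ isOpen_interior isClosed_closure.isOpen_compl hcov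
    ⟨a, left_mem_segment ℝ a b, ha'⟩ ⟨b, right_mem_segment ℝ a b, hb'⟩
  exact hz2 (subset_closure (interior_subset hz1))

variable {Ω B : Set E3} {α r₀ : ℝ}

/-! ### The solid near the flat bottom -/

namespace Geometry

theorem mem_frontier_of_mem_flatPatch (hgeo : Geometry Ω B α r₀) {x : E3} (hx : x ∈ flatPatch r₀) :
    x ∈ frontier Ω := by
  obtain ⟨ε, hε, hf⟩ := hgeo.flat_bottom
  obtain ⟨h0, h1, h2⟩ := hx
  rw [hgeo.container_regular.1.frontier_eq]
  refine ⟨?_, fun h => ?_⟩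
  · rw [Metric.mem_closure_iff]
    intro δ hδ
    refine ⟨!₂[x 0, x 1, min δ ε / 2], ?_, ?_⟩
    · have : 0 < min δ ε := lt_min hδ hε
      rw [hf _ (by simpa using h0) (by simpa using h1)]
      · simpa using this
      · have := min_le_right δ ε
        simp only [Matrix.cons_val]
        rw [abs_of_pos (by positivity)]; linarith
    · have h3 : 0 < min δ ε := lt_min hδ hε
      have h4 := min_le_left δ ε
      have h5 := dist_sq_eq x !₂[x 0, x 1, min δ ε / 2]
      simp only [Matrix.cons_val, h2] at h5
      refine lt_of_pow_lt_pow_left₀ 2 hδ.le ?_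
      rw [h5]; nlinarith
  · rw [hf x h0 h1 (by simpa [h2] using hε)] at h
    exact absurd h2 h.ne'

/-- Points of the edge of the flat square are limits of boundary points outside the square. -/
theorem edge_mem_closure (hgeo : Geometry Ω B α r₀) (hr₀ : 0 < r₀) {y : E3}
    (hy : y ∈ flatPatch r₀) (hedge : |y 0| = 2 * r₀ ∨ |y 1| = 2 * r₀) :
    y ∈ closure (frontier Ω \ flatPatch r₀) := by
  obtain ⟨ε, hε, hf⟩ := hgeo.flat_bottom
  obtain ⟨h0, h1, h2⟩ := hy
  rw [Metric.mem_closure_iff]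
  intro δ hδ
  -- an outward horizontal direction
  obtain ⟨n0, n1, hn, hin, hout⟩ : ∃ n0 n1 : ℝ, n0 ^ 2 + n1 ^ 2 = 1 ∧
      (∀ s, 0 < s → s ≤ r₀ → |y 0 - s * n0| ≤ 2 * r₀ ∧ |y 1 - s * n1| ≤ 2 * r₀) ∧
      (∀ s, 0 < s → 2 * r₀ < |y 0 + s * n0| ∨ 2 * r₀ < |y 1 + s * n1|) := by
    rcases hedge with h | h
    · rcases abs_eq (by positivity : (0 : ℝ) ≤ 2 * r₀) |>.1 h with h' | h'
      · refine ⟨1, 0, by norm_num, fun s hs hs' => ⟨?_, by simpa using h1⟩, fun s hs => Or.inl ?_⟩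
        · rw [h', abs_le]; constructor <;> linarith
        · rw [h', abs_of_pos (by linarith)]; linarith
      · refine ⟨-1, 0, by norm_num, fun s hs hs' => ⟨?_, by simpa using h1⟩, fun s hs => Or.inl ?_⟩
        · rw [h', abs_le]; constructor <;> linarith
        · rw [h', abs_of_neg (by linarith)]; linarith
    · rcases abs_eq (by positivity : (0 : ℝ) ≤ 2 * r₀) |>.1 h with h' | h'
      · refine ⟨0, 1, by norm_num, fun s hs hs' => ⟨by simpa using h0, ?_⟩, fun s hs => Or.inr ?_⟩
        · rw [h', abs_le]; constructor <;> linarith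
        · rw [h', abs_of_pos (by linarith)]; linarith
      · refine ⟨0, -1, by norm_num, fun s hs hs' => ⟨by simpa using h0, ?_⟩, fun s hs => Or.inr ?_⟩
        · rw [h', abs_le]; constructor <;> linarith
        · rw [h', abs_of_neg (by linarith)]; linarith
  obtain ⟨s, hs, hsr, hsε, hsδ⟩ : ∃ s : ℝ, 0 < s ∧ s ≤ r₀ ∧ s < ε ∧ s * 2 < δ := by
    refine ⟨min r₀ (min (ε / 2) (δ / 4)), by positivity, min_le_left _ _, ?_, ?_⟩
    · have := (min_le_right r₀ _).trans (min_le_left (ε / 2) (δ / 4)); linarith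
    · have := (min_le_right r₀ _).trans (min_le_right (ε / 2) (δ / 4)); linarith
  obtain ⟨hin0, hin1⟩ := hin s hs hsr
  set q : E3 := !₂[y 0 + s * n0, y 1 + s * n1, 0] with hq
  -- The point `q` lies in the plane of the square just outside an edge. A segment from height `σ ≠
  -- 0` above or below the square to `q` meets this plane only at `q`, so no frontier point on it
  -- belongs to the flat patch.
  have key : ∀ σ : ℝ, |σ| = s → ∀ z ∈ segment ℝ (!₂[y 0 - s * n0, y 1 - s * n1, σ] : E3) q,
      z ∈ frontier Ω → ∃ b ∈ frontier Ω \ flatPatch r₀, dist y b < δ := by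
    intro σ hσ z hz hzf
    rw [segment_eq_image] at hz
    obtain ⟨u, ⟨hu0, hu1⟩, rfl⟩ := hz
    have hσ0 : σ ≠ 0 := by rintro rfl; simp at hσ; linarith
    refine ⟨_, ⟨hzf, ?_⟩, ?_⟩
    · rintro ⟨ha, hb, hc⟩
      simp [hq] at ha hb hc
      rcases hc with hc | hc
      · have hu : u = 1 := by linarith
        subst hu
        rcases hout s hs with h | h
        · norm_num at ha; linarith
        · norm_num at hb; linarith
      · exact hσ0 hc
    · refine lt_of_pow_lt_pow_left₀ 2 hδ.le ?_
      rw [dist_sq_eq]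
      have hσ2 : σ ^ 2 = s ^ 2 := by rw [← sq_abs, hσ]
      simp only [hq, PiLp.add_apply, PiLp.smul_apply, Matrix.cons_val, smul_eq_mul,
        h2]
      have e : (y 0 - ((1 - u) * (y 0 - s * n0) + u * (y 0 + s * n0))) ^ 2 +
          (y 1 - ((1 - u) * (y 1 - s * n1) + u * (y 1 + s * n1))) ^ 2 +
          (0 - ((1 - u) * σ + u * 0)) ^ 2
          = (1 - 2 * u) ^ 2 * s ^ 2 * (n0 ^ 2 + n1 ^ 2) + (1 - u) ^ 2 * σ ^ 2 := by ring
      rw [e, hn, hσ2]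
      have h3 : (1 - 2 * u) ^ 2 ≤ 1 := by nlinarith
      have h4 : (1 - u) ^ 2 ≤ 1 := by nlinarith
      have h5 : s ^ 2 * 4 < δ ^ 2 := by nlinarith
      nlinarith [sq_nonneg s, mul_nonneg (sub_nonneg.2 h3) (sq_nonneg s),
        mul_nonneg (sub_nonneg.2 h4) (sq_nonneg s)]
  -- Nothing is known about `Ω` at `q`, so the other endpoint is taken on the opposite side: below
  -- the bottom if `q ∈ Ω`, above it otherwise.
  by_cases hqΩ : q ∈ Ω
  · have hbot : (!₂[y 0 - s * n0, y 1 - s * n1, -s] : E3) ∉ Ω := by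
      rw [hf _ (by simpa using hin0) (by simpa using hin1) (by simpa [abs_of_pos hs] using hsε)]
      simpa using hs.le
    obtain ⟨z, hz, hzf⟩ := exists_mem_frontier_segment hqΩ hbot
    exact key (-s) (by simp [abs_of_pos hs]) z (by rwa [segment_symm]) hzf
  · have htop : (!₂[y 0 - s * n0, y 1 - s * n1, s] : E3) ∈ Ω := by
      rw [hf _ (by simpa using hin0) (by simpa using hin1) (by simpa [abs_of_pos hs] using hsε)]
      simpa using hs
    obtain ⟨z, hz, hzf⟩ := exists_mem_frontier_segment htop hqΩ
    exact key s (abs_of_pos hs) z hz hzf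

theorem symmetric_bodyAt (hgeo : Geometry Ω B α r₀) {h : ℝ} {x y : E3} (hx : x ∈ bodyAt B h)
    (hr : axisDist x = axisDist y) (h2 : x 2 = y 2) : y ∈ bodyAt B h := by
  refine hgeo.body_symmetric (x - h • e3) (y - h • e3) hx ?_ ?_
  · simpa [axisDist, e3, unitVec] using hr
  · simp [e3, unitVec, h2]

/-- Points of the solid at distance more than `2r₀` from the axis are far from the flat patch. -/
theorem dist_flatPatch (hgeo : Geometry Ω B α r₀) (hr₀ : 0 < r₀) {h d₀ : ℝ}
    (hfar : ∀ x ∈ bodyAt B h, ∀ y ∈ frontier Ω \ flatPatch r₀, d₀ ≤ dist x y)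
    {b : E3} (hb : b ∈ bodyAt B h) (hbr : 2 * r₀ < axisDist b) {y : E3} (hy : y ∈ flatPatch r₀) :
    d₀ ≤ dist b y := by
  have hcl : ∀ x ∈ bodyAt B h, ∀ y ∈ closure (frontier Ω \ flatPatch r₀), d₀ ≤ dist x y := by
    intro x hx y hy
    exact (isClosed_Ici (a := d₀).preimage (continuous_const.dist continuous_id)).closure_subset_iff.2
      (fun z hz => hfar x hx z hz) hy
  -- If `b` lies over the square, it lies over one of its corners, as `r > 2r₀`. Rotational symmetry
  -- moves `b`, at the same height, to a point of the solid directly above or below an edge, where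
  -- the vertical distance is at least `d₀`; that distance is at most `dist b y`.
  by_cases hcol : |b 0| ≤ 2 * r₀ ∧ |b 1| ≤ 2 * r₀
  · have hbsq := axisDist_sq b
    have hr2 : (2 * r₀) ^ 2 ≤ axisDist b ^ 2 := by gcongr
    have h0 : b 0 ^ 2 ≤ (2 * r₀) ^ 2 := by rw [← sq_abs]; gcongr; exact hcol.1
    have h1 : b 1 ^ 2 ≤ (2 * r₀) ^ 2 := by rw [← sq_abs]; gcongr; exact hcol.2
    set v := √(axisDist b ^ 2 - (2 * r₀) ^ 2) with hv
    have hv2 : v ^ 2 = axisDist b ^ 2 - (2 * r₀) ^ 2 := Real.sq_sqrt (by linarith)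
    have hv0 : 0 ≤ v := Real.sqrt_nonneg _
    have hvle : v ≤ 2 * r₀ := abs_le_of_sq_le_sq' (by linarith) (by positivity) |>.2
    have hmem : (!₂[2 * r₀, v, b 2] : E3) ∈ bodyAt B h := by
      refine hgeo.symmetric_bodyAt hb ?_ (by simp)
      conv_rhs => rw [axisDist]
      simp only [Matrix.cons_val]
      rw [hv2, add_sub_cancel, Real.sqrt_sq (axisDist_nonneg b)]
    have hpe : (!₂[2 * r₀, v, 0] : E3) ∈ flatPatch r₀ := by
      refine ⟨?_, ?_, by simp⟩
      · simp [abs_of_pos hr₀]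
      · simpa [abs_of_nonneg hv0] using hvle
    have h3 := hcl _ hmem _ (hgeo.edge_mem_closure hr₀ hpe (Or.inl (by simp [abs_of_pos hr₀])))
    refine h3.trans (abs_le_of_sq_le_sq' ?_ dist_nonneg).2
    rw [dist_sq_eq, dist_sq_eq, hy.2.2]
    simp
    positivity
  -- If `b` does not lie over the square, the nearest point `c` of the square lies on an edge and is
  -- no farther from `b` than `y`.
  · set c : E3 := !₂[max (-(2 * r₀)) (min (b 0) (2 * r₀)), max (-(2 * r₀)) (min (b 1) (2 * r₀)), 0]
      with hc
    have clamp : ∀ u v : ℝ, |v| ≤ 2 * r₀ →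
        |max (-(2 * r₀)) (min u (2 * r₀))| ≤ 2 * r₀ ∧
        (u - max (-(2 * r₀)) (min u (2 * r₀))) ^ 2 ≤ (u - v) ^ 2 ∧
        (2 * r₀ < |u| → |max (-(2 * r₀)) (min u (2 * r₀))| = 2 * r₀) := by
      intro u v hv
      rw [abs_le] at hv
      rcases le_total u (2 * r₀) with h | h
      · rw [min_eq_left h]
        rcases le_total (-(2 * r₀)) u with h' | h'
        · rw [max_eq_right h']
          exact ⟨abs_le.2 ⟨h', h⟩, by simpa using sq_nonneg _,
            fun h3 => absurd (abs_le.2 ⟨h', h⟩) (not_le.2 h3)⟩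
        · rw [max_eq_left h', abs_neg, abs_of_pos (by positivity)]
          exact ⟨le_rfl, by nlinarith, fun _ => rfl⟩
      · rw [min_eq_right h, max_eq_right (by linarith), abs_of_pos (by positivity)]
        exact ⟨le_rfl, by nlinarith, fun _ => rfl⟩
    obtain ⟨ha0, hb0, hc0⟩ := clamp (b 0) (y 0) hy.1
    obtain ⟨ha1, hb1, hc1⟩ := clamp (b 1) (y 1) hy.2.1
    have hcp : c ∈ flatPatch r₀ := ⟨by simpa [hc] using ha0, by simpa [hc] using ha1, by simp [hc]⟩
    have hce : |c 0| = 2 * r₀ ∨ |c 1| = 2 * r₀ := by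
      rw [not_and_or, not_le, not_le] at hcol
      rcases hcol with h | h
      · left; simpa [hc] using hc0 h
      · right; simpa [hc] using hc1 h
    refine (hcl b hb c (hgeo.edge_mem_closure hr₀ hcp hce)).trans
      (abs_le_of_sq_le_sq' ?_ dist_nonneg).2
    rw [dist_sq_eq, dist_sq_eq, hy.2.2]
    simp only [hc, Matrix.cons_val]
    linarith

theorem bodyAt_tip_le (hgeo : Geometry Ω B α r₀) {h : ℝ} {x : E3} (hx : x ∈ bodyAt B h)
    (hr : axisDist x ≤ 2 * r₀) : h + axisDist x ^ (1 + α) ≤ x 2 := by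
  have e : (!₂[x 0, x 1, x 2 - h] : E3) = x - h • e3 := by
    ext i; fin_cases i <;> simp [e3, unitVec]
  have hmem : x 2 - h ∈ {z : ℝ | !₂[x 0, x 1, z] ∈ B} := by
    rw [mem_ofPred_eq, e]; exact hx
  have := mem_lowerBounds.1 (hgeo.body_tip (x 0) (x 1) hr).2 _ hmem
  unfold axisDist; linarith

theorem tip_mem_bodyAt (hgeo : Geometry Ω B α r₀) (hα : 0 < α) (hr₀ : 0 < r₀) (h : ℝ) :
    (h • e3) ∈ bodyAt B h := by
  have := (hgeo.body_tip 0 0 (by simp; positivity)).1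
  have e : (!₂[0, 0, (0:ℝ)] : E3) = 0 := by ext i; fin_cases i <;> simp
  have e' : (√((0:ℝ) ^ 2 + 0 ^ 2)) ^ (1 + α) = 0 := by
    simp [Real.zero_rpow (by linarith : 1 + α ≠ 0)]
  rw [e'] at this
  simpa [bodyAt, e] using this

/-- A point outside `Ω` close to a solid that stays above the flat patch lies below the tip. -/
theorem exists_near_radius (hgeo : Geometry Ω B α r₀) (hα : 0 < α) (hr₀ : 0 < r₀) {d₀ : ℝ}
    (hd₀ : 0 < d₀) : ∃ d > 0, ∀ h > 0, bodyAt B h ⊆ Ω →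
      (∀ x ∈ bodyAt B h, ∀ y ∈ frontier Ω \ flatPatch r₀, d₀ ≤ dist x y) →
      ∀ b ∈ bodyAt B h, ∀ x ∉ Ω, dist x b ≤ d → axisDist x < r₀ / 2 ∧ x 2 ≤ 0 := by
  obtain ⟨ε, hε, hf⟩ := hgeo.flat_bottom
  have hq : 0 < (r₀ / 8) ^ (1 + α) := by positivity
  -- The bound `d₀/2` forces the boundary point between `b` and `x` onto the flat patch and keeps
  -- `b` within `2r₀` of the axis; `(r₀/8)^(1+α)` then makes the low point `b` close to the axis,
  -- `r₀/8` passes this on to `x`, and `ε/4` keeps `x` in the range where the bottom is flat.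
  refine ⟨min (min (d₀ / 2) (ε / 4)) (min (r₀ / 8) ((r₀ / 8) ^ (1 + α))), by positivity, ?_⟩
  set d := min (min (d₀ / 2) (ε / 4)) (min (r₀ / 8) ((r₀ / 8) ^ (1 + α))) with hd
  have hdd : d ≤ d₀ / 2 := (min_le_left _ _).trans (min_le_left _ _)
  have hdε : d ≤ ε / 4 := (min_le_left _ _).trans (min_le_right _ _)
  have hdr : d ≤ r₀ / 8 := (min_le_right _ _).trans (min_le_left _ _)
  have hdq : d ≤ (r₀ / 8) ^ (1 + α) := (min_le_right _ _).trans (min_le_right _ _)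
  intro h hh hsub hfar b hb x hx hxb
  obtain ⟨y, hy, hyf⟩ := exists_mem_frontier_segment (hsub hb) hx
  have hby : dist b y ≤ d := by
    refine le_trans ?_ hxb
    have := segment_subset_closedBall_left b x hy
    rw [Metric.mem_closedBall] at this
    rw [dist_comm b y]; rwa [dist_comm x b]
  have hyp : y ∈ flatPatch r₀ := by
    by_contra hn
    have := hfar b hb y ⟨hyf, hn⟩
    linarith
  have hbr : axisDist b ≤ 2 * r₀ := by
    by_contra! hn
    have := hgeo.dist_flatPatch hr₀ hfar hb hn hyp
    linarith
  have htip := hgeo.bodyAt_tip_le hb hbr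
  have hb2 : b 2 ≤ d := by
    have := (abs_le.1 (abs_coord_sub_le_dist b y 2)).2
    rw [hyp.2.2] at this; linarith
  have hbr' : axisDist b ≤ r₀ / 8 := by
    by_contra! hn
    have : (r₀ / 8) ^ (1 + α) < axisDist b ^ (1 + α) := by gcongr
    linarith
  have hxr := axisDist_le_add_dist x b
  have hxr' : axisDist x < r₀ / 2 := by linarith
  refine ⟨hxr', ?_⟩
  by_contra! hpos
  apply hx
  have h0 := abs_coord_zero_le_axisDist x
  have h1 := abs_coord_one_le_axisDist x
  rw [hf x (by linarith) (by linarith)]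
  · exact hpos
  · rw [abs_of_pos hpos]
    have := (abs_le.1 (abs_coord_sub_le_dist x b 2)).2
    linarith

end Geometry

/-! ### Volume of the translated body and singular product weights -/

theorem bodyAt_eq_preimage (B : Set E3) (h : ℝ) : bodyAt B h = (fun x => x - h • e3) ⁻¹' B := rfl

theorem volume_bodyAt (B : Set E3) (h : ℝ) : volume (bodyAt B h) = volume B := by
  rw [bodyAt_eq_preimage]
  simp only [sub_eq_add_neg]
  exact measure_preimage_add_right _ _ _

/-- The singular weight `|x₁ x₂ x₃|^(-s)`. -/
noncomputable def singWeight (s : ℝ) (x : E3) : ℝ := ∏ i, |x i| ^ (-s)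

theorem singWeight_nonneg (s : ℝ) (x : E3) : 0 ≤ singWeight s x :=
  Finset.prod_nonneg fun _ _ => by positivity

theorem measurable_singWeight (s : ℝ) : Measurable (singWeight s) := by
  unfold singWeight; fun_prop

theorem singWeight_rpow (s p : ℝ) (x : E3) : singWeight s x ^ p = singWeight (s * p) x := by
  unfold singWeight
  rw [← Real.finsetProd_rpow _ _ (fun _ _ => by positivity)]
  refine Finset.prod_congr rfl fun i _ => ?_
  rw [← Real.rpow_mul (abs_nonneg _)]; ring_nf

/-- By Fubini the integral over a cube is the product of three integrals of `|y|^(-s)` over an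
interval, which converge for `s < 1`. This is why a product weight is used instead of powers of `r`
and `x₃`. -/
theorem integrableOn_singWeight {s : ℝ} (hs : s < 1) (R : ℝ) :
    IntegrableOn (singWeight s) {x | ∀ i, |x i| ≤ R} := by
  have h1 : IntegrableOn (fun y : ℝ => |y| ^ (-s)) (Icc (-R) R) := by
    rcases lt_or_ge R 0 with hR | hR
    · rw [Icc_eq_empty (by linarith)]; simp
    have h2 : IntegrableOn (fun y : ℝ => |y| ^ (-s)) (Icc 0 R) := by
      rw [integrableOn_Icc_iff_integrableOn_Ioc]
      have := (intervalIntegrable_iff_integrableOn_Ioc_of_le hR).1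
        (intervalIntegral.intervalIntegrable_rpow' (a := 0) (b := R) (r := -s) (by linarith))
      refine this.congr_fun (fun y hy => ?_) measurableSet_Ioc
      simp only [abs_of_pos hy.1]
    have h3 : IntegrableOn (fun y : ℝ => |y| ^ (-s)) (Icc (-R) 0) := by
      have := h2.comp_neg
      simpa using this
    have := h3.union h2
    rwa [Icc_union_Icc_eq_Icc (by linarith) hR] at this
  have h2 : Integrable (fun y : ℝ => (Icc (-R) R).indicator (fun y => |y| ^ (-s)) y) :=
    (integrable_indicator_iff measurableSet_Icc).2 h1
  have h3 := Integrable.fintype_prod (ι := Fin 3) (μ := fun _ => (volume : Measure ℝ))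
    (f := fun _ => fun y : ℝ => (Icc (-R) R).indicator (fun y => |y| ^ (-s)) y) (fun _ => h2)
  have hmp := EuclideanSpace.volume_preserving_symm_measurableEquiv_toLp (Fin 3)
  have h4 := hmp.integrable_comp_of_integrable h3
  have hms : MeasurableSet {x : E3 | ∀ i, |x i| ≤ R} := by
    have : IsClosed {x : E3 | ∀ i, |x i| ≤ R} := by
      simp only [ofPred_forall]
      exact isClosed_iInter fun i => isClosed_le (by fun_prop) continuous_const
    exact this.measurableSet
  rw [← integrable_indicator_iff hms]
  refine h4.congr (Filter.Eventually.of_forall fun x => ?_)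
  simp only [Function.comp, indicator, mem_Icc, singWeight, mem_ofPred_eq, abs_le]
  split_ifs with h
  · refine Finset.prod_congr rfl fun i _ => ?_
    exact if_pos (h i)
  · push Not at h
    obtain ⟨i, hi⟩ := h
    refine Finset.prod_eq_zero (Finset.mem_univ i) (if_neg ?_)
    exact fun hh => absurd hh.2 (not_le.2 (hi hh.1))

theorem lintegral_singWeight_lt_top {s : ℝ} (hs : s < 1) {Ω : Set E3}
    (hΩ : Bornology.IsBounded Ω) : ∫⁻ x in Ω, ENNReal.ofReal (singWeight s x) < ∞ := by
  obtain ⟨R, hR⟩ := hΩ.exists_norm_le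
  have h := integrableOn_singWeight hs R
  have h2 : IntegrableOn (singWeight s) Ω := h.mono_set fun x hx i =>
    (abs_coord_le_norm x i).trans (hR x hx)
  exact h2.lintegral_lt_top

/-- The pointwise bounds involve negative powers of the coordinates and are stated off the
coordinate planes; under the integral this restriction is free. -/
theorem ae_coord_ne_zero : ∀ᵐ x : E3, ∀ i, x i ≠ 0 := by
  rw [MeasureTheory.ae_all_iff]
  intro i
  have hmp := EuclideanSpace.volume_preserving_symm_measurableEquiv_toLp (Fin 3)
  have h1 : ∀ᵐ y : Fin 3 → ℝ, y i ≠ 0 := by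
    have := Measure.quasiMeasurePreserving_eval (fun _ : Fin 3 => (volume : Measure ℝ)) i
    exact this.ae (p := fun y : ℝ => y ≠ 0) (Measure.ae_ne volume 0)
  exact hmp.quasiMeasurePreserving.ae h1

/-- `|x₁ x₂|^(-s) ≥ c r^(-2s)`. -/
theorem rpow_axisDist_mul_le_singWeight {s : ℝ} (hs : 0 ≤ s) {x : E3} (hx : ∀ i, x i ≠ 0) :
    axisDist x ^ (-(2 * s)) * |x 2| ^ (-s) ≤ singWeight s x := by
  have h0 : 0 < |x 0| := abs_pos.2 (hx 0)
  have h1 : 0 < |x 1| := abs_pos.2 (hx 1)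
  rw [singWeight, Fin.prod_univ_three]
  gcongr
  rw [← Real.mul_rpow h0.le h1.le, neg_mul_eq_mul_neg, Real.rpow_mul (axisDist_nonneg x)]
  apply Real.rpow_le_rpow_of_nonpos (by positivity) _ (by linarith)
  rw [Real.rpow_two, axisDist_sq, ← sq_abs (x 0), ← sq_abs (x 1)]
  nlinarith [sq_nonneg (|x 0| - |x 1|)]

/-! ### Calculus of bounds for second-order jets -/

section Jets

variable {E : Type*} [NormedAddCommGroup E] [NormedSpace ℝ E]

/-- `f` is `C²` at `z`, with bounds for its value and its first two derivatives there. -/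
structure JetBound (f : E → ℝ) (z : E) (a b c : ℝ) : Prop where
  contDiffAt : ContDiffAt ℝ 2 f z
  value : |f z| ≤ a
  first : ‖fderiv ℝ f z‖ ≤ b
  second : ‖fderiv ℝ (fderiv ℝ f) z‖ ≤ c

theorem _root_.ContDiffAt.eventually_differentiableAt_two {F : Type*} [NormedAddCommGroup F]
    [NormedSpace ℝ F] {f : E → F} {z : E} (h : ContDiffAt ℝ 2 f z) :
    ∀ᶠ y in nhds z, DifferentiableAt ℝ f y :=
  (h.eventually (by simp)).mono fun _ hy => hy.differentiableAt (by simp)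

theorem _root_.ContDiffAt.differentiableAt_fderiv {F : Type*} [NormedAddCommGroup F]
    [NormedSpace ℝ F] {f : E → F} {z : E} (h : ContDiffAt ℝ 2 f z) :
    DifferentiableAt ℝ (fderiv ℝ f) z :=
  (h.fderiv_right (m := 1) (by norm_num)).differentiableAt (by simp)

theorem norm_fderiv_smul_le {F : Type*} [NormedAddCommGroup F] [NormedSpace ℝ F]
    {u : E → ℝ} {L : E → F} {z : E} (hu : DifferentiableAt ℝ u z) (hL : DifferentiableAt ℝ L z) :
    ‖fderiv ℝ (fun y => u y • L y) z‖ ≤ |u z| * ‖fderiv ℝ L z‖ + ‖fderiv ℝ u z‖ * ‖L z‖ := by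
  rw [fderiv_fun_smul hu hL]
  refine (norm_add_le _ _).trans ?_
  gcongr
  · exact norm_smul_le (u z) (fderiv ℝ L z)
  · exact (ContinuousLinearMap.norm_smulRight_apply (fderiv ℝ u z) (L z)).le

theorem norm_fderiv_nonneg {F : Type*} [NormedAddCommGroup F] [NormedSpace ℝ F] (L : E → F)
    (z : E) : 0 ≤ ‖fderiv ℝ L z‖ := norm_nonneg _

theorem norm_fderiv_fun_add_le {F : Type*} [NormedAddCommGroup F] [NormedSpace ℝ F]
    {K L : E → F} {z : E} (hK : DifferentiableAt ℝ K z) (hL : DifferentiableAt ℝ L z) :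
    ‖fderiv ℝ (fun y => K y + L y) z‖ ≤ ‖fderiv ℝ K z‖ + ‖fderiv ℝ L z‖ := by
  rw [fderiv_fun_add hK hL]; exact norm_add_le _ _

theorem norm_fderiv_fun_neg {F : Type*} [NormedAddCommGroup F] [NormedSpace ℝ F]
    (L : E → F) (z : E) : ‖fderiv ℝ (fun y => - L y) z‖ = ‖fderiv ℝ L z‖ := by
  rw [fderiv_fun_neg, norm_neg]

theorem norm_fderiv_fun_const {F : Type*} [NormedAddCommGroup F] [NormedSpace ℝ F]
    (c : F) (z : E) : ‖fderiv ℝ (fun _ => c) z‖ ≤ 0 := by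
  simp

theorem exists_bound_norm_fderiv {F : Type*} [NormedAddCommGroup F] [NormedSpace ℝ F]
    {L : E → F} (hL : ContDiff ℝ 1 L) {K : Set E} (hK : IsCompact K) :
    ∃ A, ∀ z ∈ K, ‖fderiv ℝ L z‖ ≤ A :=
  hK.exists_bound_of_continuousOn (hL.continuous_fderiv (by simp)).continuousOn

namespace JetBound

variable {f g : E → ℝ} {z : E} {a b c a' b' c' : ℝ}

theorem mono (h : JetBound f z a b c) (ha : a ≤ a') (hb : b ≤ b') (hc : c ≤ c') :
    JetBound f z a' b' c' :=
  ⟨h.1, h.2.trans ha, h.3.trans hb, h.4.trans hc⟩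

theorem congr (h : JetBound f z a b c) (hfg : f =ᶠ[nhds z] g) : JetBound g z a b c := by
  refine ⟨h.1.congr_of_eventuallyEq hfg.symm, ?_, ?_, ?_⟩
  · rw [← hfg.eq_of_nhds]; exact h.2
  · rw [← hfg.fderiv_eq]; exact h.3
  · rw [← hfg.fderiv.fderiv_eq]; exact h.4

theorem of_const (r : ℝ) (z : E) : JetBound (fun _ => r) z |r| 0 0 :=
  ⟨contDiffAt_const, le_rfl, by simp, by
    have : fderiv ℝ (fun _ : E => r) = fun _ => 0 := by ext1 y; simp
    rw [this]; exact norm_fderiv_fun_const _ _⟩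

theorem of_clm (L : E →L[ℝ] ℝ) (z : E) : JetBound L z |L z| ‖L‖ 0 := by
  refine ⟨L.contDiff.contDiffAt, le_rfl, by simp, ?_⟩
  have : fderiv ℝ (L : E → ℝ) = fun _ => L := by ext1 y; exact L.fderiv
  rw [this]; exact norm_fderiv_fun_const _ _

theorem add (hf : JetBound f z a b c) (hg : JetBound g z a' b' c') :
    JetBound (fun y => f y + g y) z (a + a') (b + b') (c + c') := by
  have hd : fderiv ℝ (fun y => f y + g y) =ᶠ[nhds z] fun y => fderiv ℝ f y + fderiv ℝ g y := by
    filter_upwards [hf.1.eventually_differentiableAt_two, hg.1.eventually_differentiableAt_two]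
      with y h1 h2
    exact fderiv_fun_add h1 h2
  refine ⟨hf.1.add hg.1, (abs_add_le _ _).trans (add_le_add hf.2 hg.2), ?_, ?_⟩
  · rw [hd.eq_of_nhds]
    exact (norm_add_le _ _).trans (add_le_add hf.3 hg.3)
  · rw [hd.fderiv_eq]
    exact (norm_fderiv_fun_add_le hf.1.differentiableAt_fderiv hg.1.differentiableAt_fderiv).trans
      (add_le_add hf.4 hg.4)

theorem neg (hf : JetBound f z a b c) : JetBound (fun y => - f y) z a b c := by
  have hd : fderiv ℝ (fun y => - f y) = fun y => - fderiv ℝ f y := by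
    ext1 y; exact fderiv_fun_neg
  refine ⟨hf.1.neg, by simpa using hf.2, ?_, ?_⟩
  · rw [hd, norm_neg]; exact hf.3
  · rw [hd, norm_fderiv_fun_neg]; exact hf.4

theorem mul (hf : JetBound f z a b c) (hg : JetBound g z a' b' c') :
    JetBound (fun y => f y * g y) z (a * a') (a * b' + b * a') (a * c' + 2 * (b * b') + c * a') := by
  have hd : fderiv ℝ (fun y => f y * g y) =ᶠ[nhds z]
      fun y => f y • fderiv ℝ g y + g y • fderiv ℝ f y := by
    filter_upwards [hf.1.eventually_differentiableAt_two, hg.1.eventually_differentiableAt_two]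
      with y h1 h2
    exact fderiv_fun_mul h1 h2
  have hfd := hf.1.differentiableAt (by simp)
  have hgd := hg.1.differentiableAt (by simp)
  have ha : 0 ≤ a := (abs_nonneg _).trans hf.2
  have ha' : 0 ≤ a' := (abs_nonneg _).trans hg.2
  have hb : 0 ≤ b := (norm_nonneg _).trans hf.3
  have hb' : 0 ≤ b' := (norm_nonneg _).trans hg.3
  refine ⟨hf.1.mul hg.1, ?_, ?_, ?_⟩
  · rw [abs_mul]; exact mul_le_mul hf.2 hg.2 (abs_nonneg _) ha
  · rw [hd.eq_of_nhds]
    refine (norm_add_le _ _).trans ?_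
    rw [norm_smul, norm_smul, Real.norm_eq_abs, Real.norm_eq_abs, mul_comm b]
    exact add_le_add (mul_le_mul hf.2 hg.3 (norm_nonneg _) ha)
      (mul_le_mul hg.2 hf.3 (norm_nonneg _) ha')
  · rw [hd.fderiv_eq]
    have h1 := norm_fderiv_smul_le hfd hg.1.differentiableAt_fderiv
    have h2 := norm_fderiv_smul_le hgd hf.1.differentiableAt_fderiv
    have e1 := mul_le_mul hf.2 hg.4 (norm_fderiv_nonneg _ _) ha
    have e2 := mul_le_mul hg.2 hf.4 (norm_fderiv_nonneg _ _) ha'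
    have e3 := mul_le_mul hf.3 hg.3 (norm_nonneg _) hb
    have e4 := mul_le_mul hg.3 hf.3 (norm_nonneg _) hb'
    refine (norm_fderiv_fun_add_le (hfd.fun_smul hg.1.differentiableAt_fderiv)
      (hgd.fun_smul hf.1.differentiableAt_fderiv)).trans ?_
    linarith

theorem comp {φ : ℝ → ℝ} {p q r : ℝ} (hf : JetBound f z a b c) (hφ : ContDiffAt ℝ 2 φ (f z))
    (hp : |φ (f z)| ≤ p) (hq : |deriv φ (f z)| ≤ q) (hr : |deriv (deriv φ) (f z)| ≤ r) :
    JetBound (fun y => φ (f y)) z p (q * b) (r * b ^ 2 + q * c) := by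
  have hd : fderiv ℝ (fun y => φ (f y)) =ᶠ[nhds z] fun y => deriv φ (f y) • fderiv ℝ f y := by
    filter_upwards [hf.1.eventually_differentiableAt_two,
      hf.1.continuousAt.eventually hφ.eventually_differentiableAt_two] with y h1 h2
    exact (h2.hasDerivAt.comp_hasFDerivAt y h1.hasFDerivAt).fderiv
  have hfd := hf.1.differentiableAt (by simp)
  have hq0 : 0 ≤ q := (abs_nonneg _).trans hq
  have hr0 : 0 ≤ r := (abs_nonneg _).trans hr
  have hb : 0 ≤ b := (norm_nonneg _).trans hf.3
  have hφ' : DifferentiableAt ℝ (deriv φ) (f z) := by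
    have e : deriv φ = fun y => fderiv ℝ φ y 1 := by ext y; simp
    rw [e]
    exact hφ.differentiableAt_fderiv.clm_apply (differentiableAt_const _)
  refine ⟨hφ.comp z hf.1, hp, ?_, ?_⟩
  · rw [hd.eq_of_nhds, norm_smul, Real.norm_eq_abs]
    exact mul_le_mul hq hf.3 (norm_nonneg _) hq0
  · rw [hd.fderiv_eq]
    have hD : HasFDerivAt (fun y => deriv φ (f y)) (deriv (deriv φ) (f z) • fderiv ℝ f z) z :=
      hφ'.hasDerivAt.comp_hasFDerivAt z hfd.hasFDerivAt
    refine (norm_fderiv_smul_le hD.differentiableAt hf.1.differentiableAt_fderiv).trans ?_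
    rw [hD.fderiv, norm_smul, Real.norm_eq_abs]
    have e1 := mul_le_mul hq hf.4 (norm_fderiv_nonneg _ _) hq0
    have e2 := mul_le_mul (mul_le_mul hr hf.3 (norm_nonneg _) hr0) hf.3 (norm_nonneg _)
      (by positivity)
    nlinarith

/-- Smooth functions have uniformly bounded jets on compact sets. -/
theorem exists_of_isCompact {K : Set E} (hK : IsCompact K) (hf : ContDiff ℝ (⊤ : ℕ∞) f) :
    ∃ A, 1 ≤ A ∧ ∀ z ∈ K, JetBound f z A A A := by
  have h2 : ContDiff ℝ 2 f := contDiff_infty.1 hf 2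
  have hc1 : Continuous (fderiv ℝ f) := h2.continuous_fderiv (by simp)
  obtain ⟨A0, h0⟩ := hK.exists_bound_of_continuousOn h2.continuous.continuousOn
  obtain ⟨A1, h1⟩ := hK.exists_bound_of_continuousOn hc1.continuousOn
  obtain ⟨A2, h3⟩ := exists_bound_norm_fderiv (h2.fderiv_right (m := 1) (by norm_num)) hK
  refine ⟨max 1 (max A0 (max A1 A2)), le_max_left _ _, fun z hz => ⟨h2.contDiffAt, ?_, ?_, ?_⟩⟩
  · exact (h0 z hz).trans (by simp)
  · exact (h1 z hz).trans (by simp)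
  · exact (h3 z hz).trans (by simp)

end JetBound

end Jets

/-! ### The divergence-free field generated by a cut-off -/

/-- The coordinate `x_i` of `(s, x)`. -/
noncomputable def coordCLM (i : Fin 3) : ℝ × E3 →L[ℝ] ℝ :=
  (EuclideanSpace.proj i : E3 →L[ℝ] ℝ).comp (ContinuousLinearMap.snd ℝ ℝ E3)

@[simp] theorem coordCLM_apply (i : Fin 3) (z : ℝ × E3) : coordCLM i z = z.2 i := rfl

theorem norm_coordCLM_le (i : Fin 3) : ‖coordCLM i‖ ≤ 1 :=
  ContinuousLinearMap.opNorm_le_bound _ zero_le_one fun z => by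
    rw [coordCLM_apply, Real.norm_eq_abs, one_mul]
    exact (abs_coord_le_norm _ _).trans (norm_snd_le z)

theorem JetBound.coord (i : Fin 3) (z : ℝ × E3) : JetBound (fun y : ℝ × E3 => y.2 i) z |z.2 i| 1 0 :=
  (JetBound.of_clm (coordCLM i) z).mono le_rfl (norm_coordCLM_le i) le_rfl

/-- The spatial direction `j` in `ℝ × ℝ³`. -/
noncomputable def spaceDir (j : Fin 3) : ℝ × E3 := (0, unitVec j)

theorem norm_spaceDir (j : Fin 3) : ‖spaceDir j‖ = 1 := by
  simp [spaceDir, unitVec, Prod.norm_def]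

/-- The curl of `χ (-x₂, x₁, 0) / 2` with respect to `x`. -/
noncomputable def streamField (χ : ℝ × E3 → ℝ) (z : ℝ × E3) : E3 :=
  !₂[-(z.2 0 / 2 * fderiv ℝ χ z (spaceDir 2)), -(z.2 1 / 2 * fderiv ℝ χ z (spaceDir 2)),
    χ z + (z.2 0 / 2 * fderiv ℝ χ z (spaceDir 0) + z.2 1 / 2 * fderiv ℝ χ z (spaceDir 1))]

section Stream

variable {χ : ℝ × E3 → ℝ} {z : ℝ × E3}

theorem contDiffAt_streamField (h : ContDiffAt ℝ (⊤ : ℕ∞) χ z) :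
    ContDiffAt ℝ (⊤ : ℕ∞) (streamField χ) z := by
  have h1 : ContDiffAt ℝ (⊤ : ℕ∞) (fderiv ℝ χ) z := h.fderiv_right (by simp)
  have hx : ∀ i : Fin 3, ContDiffAt ℝ (⊤ : ℕ∞) (fun z : ℝ × E3 => z.2 i) z := fun i =>
    (coordCLM i).contDiff.contDiffAt
  have hd : ∀ j, ContDiffAt ℝ (⊤ : ℕ∞) (fun z => fderiv ℝ χ z (spaceDir j)) z := fun j =>
    h1.clm_apply contDiffAt_const
  rw [contDiffAt_euclidean]
  intro i
  fin_cases i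
  · exact (((hx 0).div_const 2).mul (hd 2)).neg
  · exact (((hx 1).div_const 2).mul (hd 2)).neg
  · exact h.add ((((hx 0).div_const 2).mul (hd 0)).add (((hx 1).div_const 2).mul (hd 1)))

/-- The potential is then `(-x₂, x₁, 0)/2`, whose curl is `e₃`. Equality on a neighbourhood is
needed since the field contains derivatives of `χ`. -/
theorem streamField_eventuallyEq_of_one (h : ∀ᶠ y in nhds z, χ y = 1) :
    ∀ᶠ y in nhds z, streamField χ y = e3 := by
  filter_upwards [h.eventually_nhds] with y hy
  have h1 : fderiv ℝ χ y = 0 := by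
    rw [Filter.EventuallyEq.fderiv_eq (f := fun _ => (1 : ℝ)) hy]; simp
  ext i
  fin_cases i <;> simp [streamField, h1, hy.self_of_nhds, e3, unitVec]

theorem streamField_eventuallyEq_of_zero (h : ∀ᶠ y in nhds z, χ y = 0) :
    ∀ᶠ y in nhds z, streamField χ y = 0 := by
  filter_upwards [h.eventually_nhds] with y hy
  have h1 : fderiv ℝ χ y = 0 := by
    rw [Filter.EventuallyEq.fderiv_eq (f := fun _ => (0 : ℝ)) hy]; simp
  ext i
  fin_cases i <;> simp [streamField, h1, hy.self_of_nhds]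

/-- Derivative of `x_i ∂_jχ / 2`. -/
noncomputable def halfCoordDeriv (χ : ℝ × E3 → ℝ) (z : ℝ × E3) (i j : Fin 3) : ℝ × E3 →L[ℝ] ℝ :=
  (z.2 i / 2) • (fderiv ℝ (fderiv ℝ χ) z).flip (spaceDir j)
    + (fderiv ℝ χ z (spaceDir j) / 2) • coordCLM i

theorem hasFDerivAt_halfCoord (h : ContDiffAt ℝ 2 χ z) (i j : Fin 3) :
    HasFDerivAt (fun y => y.2 i / 2 * fderiv ℝ χ y (spaceDir j)) (halfCoordDeriv χ z i j) z := by
  have h1 : HasFDerivAt (fun y => fderiv ℝ χ y (spaceDir j))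
      ((fderiv ℝ (fderiv ℝ χ) z).flip (spaceDir j)) z := by
    have := h.differentiableAt_fderiv.hasFDerivAt.clm_apply (hasFDerivAt_const (spaceDir j) z)
    simpa using this
  have h2 : HasFDerivAt (fun y : ℝ × E3 => y.2 i / 2) ((1 / 2 : ℝ) • coordCLM i) z := by
    have := ((coordCLM i).hasFDerivAt (x := z)).const_mul (1 / 2 : ℝ)
    refine this.congr_of_eventuallyEq (Filter.Eventually.of_forall fun y => ?_)
    simp; ring
  refine (h2.mul h1).congr_fderiv ?_
  rw [halfCoordDeriv, smul_smul]
  congr 2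
  ring

theorem norm_halfCoordDeriv_le {i : Fin 3} (hi : |z.2 i| ≤ axisDist z.2) (j : Fin 3) :
    ‖halfCoordDeriv χ z i j‖
      ≤ ‖fderiv ℝ χ z‖ + axisDist z.2 * ‖fderiv ℝ (fderiv ℝ χ) z‖ := by
  have hr := axisDist_nonneg z.2
  have e1 : ‖(fderiv ℝ (fderiv ℝ χ) z).flip (spaceDir j)‖ ≤ ‖fderiv ℝ (fderiv ℝ χ) z‖ := by
    refine (ContinuousLinearMap.le_opNorm _ _).trans ?_
    rw [norm_spaceDir, mul_one, ContinuousLinearMap.opNorm_flip]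
  have e2 : |fderiv ℝ χ z (spaceDir j)| ≤ ‖fderiv ℝ χ z‖ := by
    have := (fderiv ℝ χ z).le_opNorm (spaceDir j)
    rwa [norm_spaceDir, mul_one] at this
  refine (norm_add_le _ _).trans ?_
  rw [norm_smul, norm_smul, Real.norm_eq_abs, Real.norm_eq_abs, abs_div, abs_div, abs_two]
  have h3 := norm_coordCLM_le i
  have h4 : |z.2 i| / 2 * ‖(fderiv ℝ (fderiv ℝ χ) z).flip (spaceDir j)‖
      ≤ axisDist z.2 * ‖fderiv ℝ (fderiv ℝ χ) z‖ := by
    gcongr; linarith [abs_nonneg (z.2 i)]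
  have h5 : |fderiv ℝ χ z (spaceDir j)| / 2 * ‖coordCLM i‖ ≤ ‖fderiv ℝ χ z‖ * 1 := by
    gcongr; linarith [abs_nonneg (fderiv ℝ χ z (spaceDir j))]
  linarith

theorem hasFDerivAt_streamField_coord (h : ContDiffAt ℝ 2 χ z) :
    HasFDerivAt (fun y => streamField χ y 0) (-halfCoordDeriv χ z 0 2) z ∧
    HasFDerivAt (fun y => streamField χ y 1) (-halfCoordDeriv χ z 1 2) z ∧
    HasFDerivAt (fun y => streamField χ y 2)
      (fderiv ℝ χ z + (halfCoordDeriv χ z 0 0 + halfCoordDeriv χ z 1 1)) z := by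
  refine ⟨?_, ?_, ?_⟩
  · exact (hasFDerivAt_halfCoord h 0 2).neg
  · exact (hasFDerivAt_halfCoord h 1 2).neg
  · exact (h.differentiableAt (by simp)).hasFDerivAt.add
      ((hasFDerivAt_halfCoord h 0 0).add (hasFDerivAt_halfCoord h 1 1))

theorem fderiv_apply_coord {W : ℝ × E3 → E3} {L : ℝ × E3 →L[ℝ] ℝ} {i : Fin 3}
    (hW : DifferentiableAt ℝ W z) (hL : HasFDerivAt (fun y => W y i) L z) (v : ℝ × E3) :
    fderiv ℝ W z v i = L v := by
  have e := ((EuclideanSpace.proj i : E3 →L[ℝ] ℝ).hasFDerivAt.comp z hW.hasFDerivAt).unique hL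
  rw [← e]; rfl

theorem differentiableAt_streamField (h : ContDiffAt ℝ 2 χ z) :
    DifferentiableAt ℝ (streamField χ) z := by
  obtain ⟨h0, h1, h2⟩ := hasFDerivAt_streamField_coord h
  rw [differentiableAt_euclidean]
  intro i
  fin_cases i
  · exact h0.differentiableAt
  · exact h1.differentiableAt
  · exact h2.differentiableAt

/-- The field consists of `χ` and products `x_i ∂_jχ / 2` with `i` horizontal. A derivative either
hits the coordinate and leaves `∇χ`, or produces `D²χ` multiplied by `|x_i| ≤ r`. The factor `r` on
the most singular term is the gain of the construction. The derivative is taken in `(s, x)`, so it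
also covers the variation with the height. -/
theorem norm_fderiv_streamField_le (h : ContDiffAt ℝ 2 χ z) :
    ‖fderiv ℝ (streamField χ) z‖
      ≤ 5 * (‖fderiv ℝ χ z‖ + axisDist z.2 * ‖fderiv ℝ (fderiv ℝ χ) z‖) := by
  obtain ⟨h0, h1, h2⟩ := hasFDerivAt_streamField_coord h
  have hd := differentiableAt_streamField h
  have hr := axisDist_nonneg z.2
  refine ContinuousLinearMap.opNorm_le_bound _ (by positivity) fun v => ?_
  refine (norm_le_sum_abs _).trans ?_
  rw [fderiv_apply_coord hd h0, fderiv_apply_coord hd h1, fderiv_apply_coord hd h2]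
  set N := ‖fderiv ℝ χ z‖ + axisDist z.2 * ‖fderiv ℝ (fderiv ℝ χ) z‖ with hN
  have b0 := abs_coord_zero_le_axisDist z.2
  have b1 := abs_coord_one_le_axisDist z.2
  have key : ∀ L : ℝ × E3 →L[ℝ] ℝ, ‖L‖ ≤ N → |L v| ≤ N * ‖v‖ := fun L hL =>
    (L.le_opNorm v).trans (by gcongr)
  have k1 := key _ (norm_halfCoordDeriv_le (χ := χ) b0 2)
  have k2 := key _ (norm_halfCoordDeriv_le (χ := χ) b1 2)
  have k3 := key _ (norm_halfCoordDeriv_le (χ := χ) b0 0)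
  have k4 := key _ (norm_halfCoordDeriv_le (χ := χ) b1 1)
  have k5 := key (fderiv ℝ χ z) (by rw [hN]; linarith [mul_nonneg hr (norm_nonneg (fderiv ℝ (fderiv ℝ χ) z))])
  simp only [neg_apply, add_apply, abs_neg]
  have t1 := abs_add_le (fderiv ℝ χ z v) (halfCoordDeriv χ z 0 0 v + halfCoordDeriv χ z 1 1 v)
  have t2 := abs_add_le (halfCoordDeriv χ z 0 0 v) (halfCoordDeriv χ z 1 1 v)
  linarith

theorem norm_streamField_le :
    ‖streamField χ z‖ ≤ |χ z| + 2 * (axisDist z.2 * ‖fderiv ℝ χ z‖) := by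
  have b0 := abs_coord_zero_le_axisDist z.2
  have b1 := abs_coord_one_le_axisDist z.2
  have key : ∀ i j : Fin 3, |z.2 i| ≤ axisDist z.2 →
      |z.2 i / 2 * fderiv ℝ χ z (spaceDir j)| ≤ axisDist z.2 * ‖fderiv ℝ χ z‖ / 2 := by
    intro i j hi
    have := (fderiv ℝ χ z).le_opNorm (spaceDir j)
    rw [norm_spaceDir, mul_one] at this
    rw [abs_mul, abs_div, abs_two, div_mul_eq_mul_div]
    have h0 := axisDist_nonneg z.2
    exact div_le_div_of_nonneg_right
      (mul_le_mul hi this (abs_nonneg _) h0) zero_le_two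
  refine (norm_le_sum_abs _).trans ?_
  have k0 := key 0 2 b0
  have k1 := key 1 2 b1
  have k2 := key 0 0 b0
  have k3 := key 1 1 b1
  have t1 := abs_add_le (χ z) (z.2 0 / 2 * fderiv ℝ χ z (spaceDir 0)
    + z.2 1 / 2 * fderiv ℝ χ z (spaceDir 1))
  have t2 := abs_add_le (z.2 0 / 2 * fderiv ℝ χ z (spaceDir 0))
    (z.2 1 / 2 * fderiv ℝ χ z (spaceDir 1))
  simp only [streamField, Matrix.cons_val, abs_neg]
  linarith

/-- The field is divergence free in `x`. -/
theorem trace_fderiv_streamField (h : ContDiffAt ℝ 2 χ z) :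
    ∑ j, fderiv ℝ (streamField χ) z (spaceDir j) j = 0 := by
  obtain ⟨h0, h1, h2⟩ := hasFDerivAt_streamField_coord h
  have hd := differentiableAt_streamField h
  -- The divergence of a curl vanishes because second derivatives commute.
  have hs : ∀ v w, fderiv ℝ (fderiv ℝ χ) z v w = fderiv ℝ (fderiv ℝ χ) z w v :=
    fun v w => (h.isSymmSndFDerivAt (by simp)).eq v w
  have hc : ∀ i j, coordCLM i (spaceDir j) = if i = j then 1 else 0 := by
    intro i j
    simp [spaceDir, unitVec]
  rw [Fin.sum_univ_three, fderiv_apply_coord hd h0, fderiv_apply_coord hd h1,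
    fderiv_apply_coord hd h2]
  simp only [halfCoordDeriv, neg_apply, add_apply,
    smul_apply, ContinuousLinearMap.flip_apply, smul_eq_mul, hc]
  rw [hs (spaceDir 0) (spaceDir 2), hs (spaceDir 1) (spaceDir 2)]
  simp
  ring

end Stream

/-! ### The cut-off in the gap below the tip -/

/-- A smooth step, `0` on `(-∞, 1/3]` and `1` on `[2/3, ∞)`. -/
noncomputable def smoothStep (y : ℝ) : ℝ := Real.smoothTransition (3 * y - 1)

theorem contDiff_smoothStep : ContDiff ℝ (⊤ : ℕ∞) smoothStep :=
  Real.smoothTransition.contDiff.comp (by fun_prop)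

theorem smoothStep_of_le {y : ℝ} (h : y ≤ 1 / 3) : smoothStep y = 0 :=
  Real.smoothTransition.zero_of_nonpos (by linarith)

theorem smoothStep_of_ge {y : ℝ} (h : 2 / 3 ≤ y) : smoothStep y = 1 :=
  Real.smoothTransition.one_of_one_le (by linarith)

/-- The regularized squared distance to the axis. -/
noncomputable def radiusSq (ε : ℝ) (z : ℝ × E3) : ℝ := z.2 0 * z.2 0 + z.2 1 * z.2 1 + ε ^ 2

/-- The regularized height of the lower boundary of the solid. -/
noncomputable def profile (α ε : ℝ) (z : ℝ × E3) : ℝ := z.1 + radiusSq ε z ^ ((1 + α) / 2)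

theorem radiusSq_eq (ε : ℝ) (z : ℝ × E3) : radiusSq ε z = axisDist z.2 ^ 2 + ε ^ 2 := by
  rw [axisDist_sq, radiusSq]; ring

theorem radiusSq_pos {ε : ℝ} (hε : 0 < ε) (z : ℝ × E3) : 0 < radiusSq ε z := by
  rw [radiusSq_eq]; positivity

theorem jetBound_radiusSq (ε : ℝ) (z : ℝ × E3) :
    JetBound (radiusSq ε) z (radiusSq ε z) (4 * √(radiusSq ε z)) 4 := by
  have h := ((((JetBound.coord 0 z).mul (JetBound.coord 0 z)).add
    ((JetBound.coord 1 z).mul (JetBound.coord 1 z))).add (JetBound.of_const (ε ^ 2) z))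
  have h0 : |z.2 0| ≤ √(radiusSq ε z) := Real.abs_le_sqrt (by
    rw [radiusSq]; nlinarith [sq_nonneg (z.2 1), sq_nonneg ε])
  have h1 : |z.2 1| ≤ √(radiusSq ε z) := Real.abs_le_sqrt (by
    rw [radiusSq]; nlinarith [sq_nonneg (z.2 0), sq_nonneg ε])
  refine h.mono ?_ (by linarith) (by norm_num)
  rw [abs_mul_abs_self, abs_mul_abs_self, abs_of_nonneg (sq_nonneg ε), radiusSq]

/-- With `M = r² + ε²` one has `|∇M| ≲ √M`, so each derivative of `M^((1+α)/2)` costs a factor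
`M^(-1/2)`. The gradient of the profile thus stays bounded on bounded sets uniformly in `ε`, while
the second derivative carries the weight `M^((α-1)/2)`, which degenerates at the axis and is later
absorbed by a factor `r ≤ √M`. -/
theorem jetBound_profile {α ε : ℝ} (hα : 0 < α) (hα1 : α ≤ 1) (hε : 0 < ε) {z : ℝ × E3}
    (hz : 0 < z.1) :
    JetBound (profile α ε) z (profile α ε z) (1 + 4 * radiusSq ε z ^ (α / 2))
      (20 * radiusSq ε z ^ ((α - 1) / 2)) := by
  set M := radiusSq ε z with hM
  have hMp : 0 < M := radiusSq_pos hε z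
  set σ := (1 + α) / 2 with hσ
  have hd : ∀ y : ℝ, 0 < y → HasDerivAt (fun y : ℝ => y ^ σ) (σ * y ^ (σ - 1)) y := fun y hy =>
    Real.hasDerivAt_rpow_const (Or.inl hy.ne')
  have hd1 : deriv (fun y : ℝ => y ^ σ) =ᶠ[nhds M] fun y => σ * y ^ (σ - 1) := by
    filter_upwards [lt_mem_nhds hMp] with y hy using (hd y hy).deriv
  have hd2 : deriv (deriv (fun y : ℝ => y ^ σ)) M = σ * ((σ - 1) * M ^ (σ - 1 - 1)) := by
    rw [hd1.deriv_eq]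
    exact ((Real.hasDerivAt_rpow_const (Or.inl hMp.ne')).const_mul σ).deriv
  have hq := (jetBound_radiusSq ε z).comp (φ := fun y => y ^ σ) (p := M ^ σ) (q := M ^ (σ - 1))
    (r := M ^ (σ - 2)) (Real.contDiffAt_rpow_const (Or.inl hMp.ne'))
    (by rw [abs_of_nonneg (by positivity)])
    (by
      rw [(hd M hMp).deriv, abs_of_nonneg (by positivity)]
      have : σ ≤ 1 := by rw [hσ]; linarith
      have h2 : 0 ≤ M ^ (σ - 1) := by positivity
      nlinarith)
    (by
      rw [hd2, ← mul_assoc, abs_mul, abs_of_nonneg (a := M ^ (σ - 1 - 1)) (by positivity),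
        show σ - 1 - 1 = σ - 2 by ring]
      have h2 : 0 ≤ M ^ (σ - 2) := by positivity
      have h3 : |σ * (σ - 1)| ≤ 1 := by rw [abs_le, hσ]; constructor <;> nlinarith
      nlinarith)
  have h1 : JetBound (fun y : ℝ × E3 => y.1) z |z.1| 1 0 :=
    (JetBound.of_clm (ContinuousLinearMap.fst ℝ ℝ E3) z).mono le_rfl
      (ContinuousLinearMap.norm_fst_le ..) le_rfl
  have hs : √M = M ^ (1 / 2 : ℝ) := Real.sqrt_eq_rpow M
  refine (h1.add hq).mono ?_ ?_ ?_
  · rw [abs_of_pos hz, profile]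
  · rw [hs, mul_left_comm, ← Real.rpow_add hMp]
    ring_nf
    rw [hσ]; ring_nf; rfl
  · have e1 : M ^ (σ - 2) * (4 * √M) ^ 2 = 16 * M ^ ((α - 1) / 2) := by
      rw [mul_pow, Real.sq_sqrt hMp.le]
      have : M ^ (σ - 2) * M = M ^ ((α - 1) / 2) := by
        nth_rewrite 2 [← Real.rpow_one M]
        rw [← Real.rpow_add hMp]; congr 1; rw [hσ]; ring
      linarith
    have e2 : M ^ (σ - 1) = M ^ ((α - 1) / 2) := by congr 1; rw [hσ]; ring
    rw [e1, e2]; linarith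

/-- In the layer `|x₃| ≤ ψ` the factor `x₃` pays for one power of `1/ψ`, so every derivative of
`x₃/ψ` costs only one factor `1/ψ`; the curvature of `ψ` adds `c/ψ`. -/
theorem jetBound_div {ψ : ℝ × E3 → ℝ} {z : ℝ × E3} {L c : ℝ} (hψ : JetBound ψ z (ψ z) L c)
    (hpos : 0 < ψ z) (hL : 1 ≤ L) (hx : |z.2 2| ≤ ψ z) :
    JetBound (fun y => y.2 2 * (ψ y)⁻¹) z 1 (2 * L / ψ z) (4 * L ^ 2 / ψ z ^ 2 + c / ψ z) := by
  have hne := hpos.ne'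
  have hc : 0 ≤ c := (norm_fderiv_nonneg _ _).trans hψ.4
  have hinv := hψ.comp (φ := fun y => y⁻¹) (p := (ψ z)⁻¹) (q := 1 / ψ z ^ 2) (r := 2 / ψ z ^ 3)
    (contDiffAt_inv ℝ hne) (by rw [abs_of_pos (by positivity)])
    (by
      rw [deriv_inv, abs_neg, abs_of_pos (by positivity), one_div])
    (by
      have : deriv (fun y : ℝ => y⁻¹) = fun y => -(y ^ 2)⁻¹ := by ext y; exact deriv_inv
      rw [this]
      have h2 : HasDerivAt (fun y : ℝ => -(y ^ 2)⁻¹) (2 / ψ z ^ 3) (ψ z) := by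
        have := ((hasDerivAt_pow 2 (ψ z)).inv (pow_ne_zero 2 hne)).neg
        refine this.congr_deriv ?_
        field_simp
        norm_num
        ring
      rw [h2.deriv, abs_of_pos (by positivity)])
  refine ((JetBound.coord 2 z).mul hinv).mono ?_ ?_ ?_
  · rw [← div_eq_mul_inv, div_le_one hpos]; exact hx
  · have : |z.2 2| * (1 / ψ z ^ 2 * L) ≤ ψ z * (1 / ψ z ^ 2 * L) := by gcongr
    refine (add_le_add_left this _).trans ?_
    have e : ψ z * (1 / ψ z ^ 2 * L) + 1 * (ψ z)⁻¹ = (L + 1) / ψ z := by field_simp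
    rw [e]; gcongr; linarith
  · have : |z.2 2| * (2 / ψ z ^ 3 * L ^ 2 + 1 / ψ z ^ 2 * c)
        ≤ ψ z * (2 / ψ z ^ 3 * L ^ 2 + 1 / ψ z ^ 2 * c) := by gcongr
    have e : ψ z * (2 / ψ z ^ 3 * L ^ 2 + 1 / ψ z ^ 2 * c) + 2 * (1 * (1 / ψ z ^ 2 * L))
        + 0 * (ψ z)⁻¹ = (2 * L ^ 2 + 2 * L) / ψ z ^ 2 + c / ψ z := by field_simp; ring
    have e2 : (2 * L ^ 2 + 2 * L) / ψ z ^ 2 ≤ 4 * L ^ 2 / ψ z ^ 2 := by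
      gcongr; nlinarith
    linarith

/-- The jet of `f` at `z` is bounded by `A`, `A Q₁`, `A Q₂`. -/
def WeightedJet (Q₁ Q₂ : ℝ) (f : ℝ × E3 → ℝ) (z : ℝ × E3) (A : ℝ) : Prop :=
  JetBound f z A (A * Q₁) (A * Q₂)

namespace WeightedJet

variable {Q₁ Q₂ A A' : ℝ} {f g : ℝ × E3 → ℝ} {z : ℝ × E3}

theorem nonneg (h : WeightedJet Q₁ Q₂ f z A) : 0 ≤ A := (abs_nonneg _).trans h.2

/-- The condition `Q₁² ≤ Q₂` lets the cross term of the two first derivatives be absorbed by the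
second-order weight. -/
theorem mul (hf : WeightedJet Q₁ Q₂ f z A) (hg : WeightedJet Q₁ Q₂ g z A') (h1 : 0 ≤ Q₁)
    (h2 : Q₁ ^ 2 ≤ Q₂) : WeightedJet Q₁ Q₂ (fun y => f y * g y) z (4 * (A * A')) := by
  have ha := hf.nonneg
  have ha' := hg.nonneg
  have haa : 0 ≤ A * A' := by positivity
  refine (JetBound.mul hf hg).mono (by linarith) ?_ ?_
  · nlinarith [mul_nonneg haa h1]
  · nlinarith [mul_nonneg haa (sub_nonneg.2 h2)]

theorem mono (hf : WeightedJet Q₁ Q₂ f z A) (h : A ≤ A') (h1 : 0 ≤ Q₁) (h2 : 0 ≤ Q₂) :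
    WeightedJet Q₁ Q₂ f z A' :=
  JetBound.mono hf h (mul_le_mul_of_nonneg_right h h1) (mul_le_mul_of_nonneg_right h h2)

theorem one_sub (hf : WeightedJet Q₁ Q₂ f z A) (h1 : 0 ≤ Q₁) (h2 : 0 ≤ Q₂) :
    WeightedJet Q₁ Q₂ (fun y => 1 - f y) z (1 + A) := by
  have := (JetBound.of_const 1 z).add (JetBound.neg hf)
  refine (this.congr (Filter.Eventually.of_forall fun y => (sub_eq_add_neg _ _).symm)).mono
    (by simp) (by nlinarith) (by nlinarith)

/-- As the profile is bounded above, the weights are bounded below, so ordinary bounded factors fit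
the singular scale after multiplication by a constant. -/
theorem of_bounded {C : ℝ} (hf : JetBound f z A A A) (hA : 0 ≤ A) (hC : 1 ≤ C) (h1 : 1 ≤ C * Q₁)
    (h2 : 1 ≤ C * Q₂) : WeightedJet Q₁ Q₂ f z (A * C) :=
  hf.mono (by nlinarith) (by nlinarith) (by nlinarith)

end WeightedJet

/-- The cut-off whose stream field is the test velocity: `1` near the solid at height `s`, `0` near
the boundary of the container. -/
noncomputable def tipCutoff (α ε : ℝ) (Ξ κ : ℝ × E3 → ℝ) (z : ℝ × E3) : ℝ :=
  Ξ z * (1 - κ z * (1 - smoothStep (z.2 2 * (profile α ε z)⁻¹)))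

theorem profile_pos {α ε : ℝ} (hε : 0 < ε) {z : ℝ × E3} (hz : 0 < z.1) : 0 < profile α ε z := by
  have := radiusSq_pos hε z
  rw [profile]; positivity

theorem contDiffAt_profile {α ε : ℝ} (hε : 0 < ε) (z : ℝ × E3) :
    ContDiffAt ℝ (⊤ : ℕ∞) (profile α ε) z := by
  have h : ContDiff ℝ (⊤ : ℕ∞) (radiusSq ε) := by
    have hx : ∀ i : Fin 3, ContDiff ℝ (⊤ : ℕ∞) (fun z : ℝ × E3 => z.2 i) := fun i =>
      (coordCLM i).contDiff
    exact (((hx 0).mul (hx 0)).add ((hx 1).mul (hx 1))).add contDiff_const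
  exact contDiffAt_fst.add (h.contDiffAt.rpow_const_of_ne (radiusSq_pos hε z).ne')

theorem contDiffAt_tipCutoff {α ε : ℝ} (hε : 0 < ε) {Ξ κ : ℝ × E3 → ℝ}
    (hΞ : ContDiff ℝ (⊤ : ℕ∞) Ξ) (hκ : ContDiff ℝ (⊤ : ℕ∞) κ) {z : ℝ × E3} (hz : 0 < z.1) :
    ContDiffAt ℝ (⊤ : ℕ∞) (tipCutoff α ε Ξ κ) z := by
  have h1 : ContDiffAt ℝ (⊤ : ℕ∞) (fun z : ℝ × E3 => z.2 2 * (profile α ε z)⁻¹) z :=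
    (coordCLM 2).contDiff.contDiffAt.mul
      ((contDiffAt_profile hε z).inv (profile_pos hε hz).ne')
  have h2 : ContDiffAt ℝ (⊤ : ℕ∞) (fun z => smoothStep (z.2 2 * (profile α ε z)⁻¹)) z :=
    contDiff_smoothStep.contDiffAt.comp z h1
  exact hΞ.contDiffAt.mul (contDiffAt_const.sub (hκ.contDiffAt.mul (contDiffAt_const.sub h2)))

/-- In the chain rule the term `f''(F)|∇F|²` has the same size `1/p²` as the worst part of `D²F`, so
composing with a fixed smooth function preserves the scale `1/p`, `1/p² + c/p`. -/
theorem weightedJet_smoothStep {F : ℝ × E3 → ℝ} {z : ℝ × E3} {A p c L : ℝ}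
    (hs : JetBound smoothStep (F z) A A A) (hA : 1 ≤ A)
    (hj : JetBound F z 1 (2 * L / p) (4 * L ^ 2 / p ^ 2 + 20 * c / p)) (hp : 0 < p) (hL : 1 ≤ L)
    (hc : 0 ≤ c) :
    WeightedJet (1 / p) (1 / p ^ 2 + c / p) (fun y => smoothStep (F y)) z
      (A * (8 * L ^ 2 + 20)) := by
  have hd1 : |deriv smoothStep (F z)| ≤ A := by
    rw [← Real.norm_eq_abs, ← fderiv_apply_one_eq_deriv]
    exact ((fderiv ℝ smoothStep _).le_opNorm 1).trans (by simpa using hs.3)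
  have hd2 : |deriv (deriv smoothStep) (F z)| ≤ A := by
    have e : deriv smoothStep = fun y => fderiv ℝ smoothStep y 1 := by ext y; simp
    have h4 := hs.1.differentiableAt_fderiv.hasFDerivAt.clm_apply
      (hasFDerivAt_const (1 : ℝ) (F z))
    have h5 : deriv (deriv smoothStep) (F z) = fderiv ℝ (fderiv ℝ smoothStep) (F z) 1 1 := by
      rw [e, ← fderiv_apply_one_eq_deriv, h4.fderiv]; simp
    rw [h5, ← Real.norm_eq_abs]
    refine (ContinuousLinearMap.le_opNorm₂ _ _ _).trans ?_
    simpa using hs.4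
  refine (hj.comp (φ := smoothStep) hs.1 hs.2 hd1 hd2).mono ?_ ?_ ?_
  · nlinarith
  · have : 2 * L ≤ 8 * L ^ 2 + 20 := by nlinarith
    calc A * (2 * L / p) = A * (2 * L) * (1 / p) := by ring
      _ ≤ A * (8 * L ^ 2 + 20) * (1 / p) := by gcongr
  · have e : A * (2 * L / p) ^ 2 + A * (4 * L ^ 2 / p ^ 2 + 20 * c / p)
        = A * (8 * L ^ 2) * (1 / p ^ 2) + A * 20 * (c / p) := by field_simp; ring
    rw [e, mul_add]
    have t3 : A * (8 * L ^ 2) ≤ A * (8 * L ^ 2 + 20) := by gcongr; linarith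
    have t4 : A * 20 ≤ A * (8 * L ^ 2 + 20) := by gcongr; nlinarith
    gcongr

set_option maxHeartbeats 800000 in
/-- Bounds for the cut-off, uniform in the height and in the regularization: singular only in the
gap below the tip. -/
theorem exists_jet_tipCutoff {α r₀ : ℝ} (hα : 0 < α) (hα1 : α ≤ 1) (R : ℝ)
    {Ξ κ : ℝ × E3 → ℝ} (hΞ : ContDiff ℝ (⊤ : ℕ∞) Ξ) (hκ : ContDiff ℝ (⊤ : ℕ∞) κ)
    (hκ0 : ∀ z, r₀ < axisDist z.2 → κ z = 0) :
    ∃ A, 0 < A ∧ ∀ ε, 0 < ε → ε ≤ 1 → ∀ z : ℝ × E3, 0 < z.1 → z.1 ≤ R → ‖z.2‖ ≤ R →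
      JetBound (tipCutoff α ε Ξ κ) z A A A ∨
      (axisDist z.2 ≤ r₀ ∧ 0 < z.2 2 ∧ z.2 2 ≤ profile α ε z ∧
        JetBound (tipCutoff α ε Ξ κ) z A (A * (1 / profile α ε z))
          (A * (1 / profile α ε z ^ 2
            + radiusSq ε z ^ ((α - 1) / 2) / profile α ε z))) := by
  have hK : IsCompact (Icc 0 R ×ˢ Metric.closedBall (0 : E3) R) :=
    isCompact_Icc.prod (isCompact_closedBall 0 R)
  obtain ⟨A1, hA1, h1⟩ := JetBound.exists_of_isCompact hK hΞ
  obtain ⟨A2, hA2, h2⟩ := JetBound.exists_of_isCompact hK hκ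
  obtain ⟨A3, hA3, h3⟩ := JetBound.exists_of_isCompact (isCompact_Icc (a := (0:ℝ)) (b := 1))
    contDiff_smoothStep
  -- `L` will bound the gradient of the profile and `Ψ` the profile itself, for heights and points
  -- within `R` and all `ε ≤ 1`.
  obtain ⟨L, hL⟩ : ∃ L : ℝ, L = 1 + 4 * (R ^ 2 + 1) := ⟨_, rfl⟩
  have hL1 : 1 ≤ L := by rw [hL]; nlinarith [sq_nonneg R]
  obtain ⟨Ψ, hΨ⟩ : ∃ Ψ : ℝ, Ψ = 1 + |R| + (R ^ 2 + 1) := ⟨_, rfl⟩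
  have hΨ1 : 1 ≤ Ψ := by rw [hΨ]; nlinarith [sq_nonneg R, abs_nonneg R]
  obtain ⟨AH, hAH⟩ : ∃ AH : ℝ, AH = A3 * (8 * L ^ 2 + 20) := ⟨_, rfl⟩
  obtain ⟨AA, hAA⟩ : ∃ AA : ℝ, AA = 4 * (A1 * Ψ ^ 2 * (1 + 4 * (A2 * Ψ ^ 2 * (1 + AH)))) :=
    ⟨_, rfl⟩
  have hAHpos : 0 ≤ AH := by rw [hAH]; positivity
  refine ⟨max AA (4 * (A1 * (1 + A2))), lt_max_of_lt_right (by positivity), ?_⟩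
  intro ε hε hε1 z hz hzR hxR
  have hzK : z ∈ Icc 0 R ×ˢ Metric.closedBall (0 : E3) R :=
    ⟨⟨hz.le, hzR⟩, by simpa using hxR⟩
  have hψ := profile_pos (α := α) hε hz
  have hM := radiusSq_pos hε z
  have hrR : axisDist z.2 ≤ R := by
    refine le_trans ?_ hxR
    refine abs_le_of_sq_le_sq' ?_ (norm_nonneg _) |>.2
    rw [axisDist_sq, norm_sq_eq_coords]; nlinarith [sq_nonneg (z.2 2)]
  have hMR : radiusSq ε z ≤ R ^ 2 + 1 := by
    rw [radiusSq_eq]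
    have := axisDist_nonneg z.2
    nlinarith
  have hcont : ContinuousAt (fun z : ℝ × E3 => z.2 2 * (profile α ε z)⁻¹) z :=
    ((coordCLM 2).continuous.continuousAt).mul
      ((contDiffAt_profile hε z).continuousAt.inv₀ hψ.ne')
  have w1 : WeightedJet 1 1 Ξ z A1 := by simpa [WeightedJet] using h1 z hzK
  have w2 : WeightedJet 1 1 κ z A2 := by simpa [WeightedJet] using h2 z hzK
  -- Outside the layer `1/3 ≤ x₃/ψ ≤ 2/3` near the axis the cut-off coincides locally with `Ξ` or
  -- with `Ξ (1 - κ)`, whose jets do not depend on `ε`. Only the layer gives the second alternative.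
  by_cases hr : r₀ < axisDist z.2
  · left
    have he : Ξ =ᶠ[nhds z] tipCutoff α ε Ξ κ := by
      have : ∀ᶠ y : ℝ × E3 in nhds z, r₀ < axisDist y.2 :=
        (continuous_axisDist.comp continuous_snd).continuousAt.eventually (lt_mem_nhds hr)
      filter_upwards [this] with y hy
      simp [tipCutoff, hκ0 y hy]
    have hle : A1 ≤ max AA (4 * (A1 * (1 + A2))) := le_max_of_le_right (by nlinarith)
    exact ((h1 z hzK).congr he).mono hle hle hle
  rcases lt_or_ge (z.2 2 * (profile α ε z)⁻¹) (1 / 3) with hF | hF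
  · left
    have he : (fun y => Ξ y * (1 - κ y)) =ᶠ[nhds z] tipCutoff α ε Ξ κ := by
      filter_upwards [hcont.eventually (gt_mem_nhds hF)] with y hy
      simp [tipCutoff, smoothStep_of_le hy.le]
    have := (w1.mul (w2.one_sub zero_le_one zero_le_one) zero_le_one (by norm_num))
    simp only [WeightedJet, mul_one] at this
    exact (this.congr he).mono (le_max_right _ _) (le_max_right _ _) (le_max_right _ _)
  rcases lt_or_ge (2 / 3) (z.2 2 * (profile α ε z)⁻¹) with hF' | hF'
  · left
    have he : Ξ =ᶠ[nhds z] tipCutoff α ε Ξ κ := by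
      filter_upwards [hcont.eventually (lt_mem_nhds hF')] with y hy
      simp [tipCutoff, smoothStep_of_ge hy.le]
    have hle : A1 ≤ max AA (4 * (A1 * (1 + A2))) := le_max_of_le_right (by nlinarith)
    exact ((h1 z hzK).congr he).mono hle hle hle
  right
  have hx2 : 0 < z.2 2 := by
    by_contra! hn
    have : z.2 2 * (profile α ε z)⁻¹ ≤ 0 := mul_nonpos_of_nonpos_of_nonneg hn (by positivity)
    linarith
  have hx2' : z.2 2 ≤ profile α ε z := by
    rw [← div_eq_mul_inv, div_le_iff₀ hψ] at hF'; linarith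
  refine ⟨not_lt.1 hr, hx2, hx2', ?_⟩
  set p := profile α ε z with hp
  set c := radiusSq ε z ^ ((α - 1) / 2) with hc
  have hc0 : 0 ≤ c := by positivity
  have hpL : 1 + 4 * radiusSq ε z ^ (α / 2) ≤ L := by
    rw [hL]; gcongr
    calc radiusSq ε z ^ (α / 2) ≤ (R ^ 2 + 1) ^ (α / 2) := by gcongr
      _ ≤ (R ^ 2 + 1) ^ (1 : ℝ) := by
        apply Real.rpow_le_rpow_of_exponent_le <;> nlinarith [sq_nonneg R]
      _ = _ := Real.rpow_one _
  have hpΨ : p ≤ Ψ := by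
    rw [hp, profile, hΨ]
    have : radiusSq ε z ^ ((1 + α) / 2) ≤ R ^ 2 + 1 := by
      calc radiusSq ε z ^ ((1 + α) / 2) ≤ (R ^ 2 + 1) ^ ((1 + α) / 2) := by gcongr
        _ ≤ (R ^ 2 + 1) ^ (1 : ℝ) := by
          apply Real.rpow_le_rpow_of_exponent_le <;> nlinarith [sq_nonneg R]
        _ = _ := Real.rpow_one _
    linarith [le_abs_self R]
  have hQ1 : 0 ≤ 1 / p := by positivity
  have hQ2 : (1 / p) ^ 2 ≤ 1 / p ^ 2 + c / p := by
    rw [div_pow, one_pow]; linarith [div_nonneg hc0 hψ.le]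
  have hQ2' : 0 ≤ 1 / p ^ 2 + c / p := (sq_nonneg _).trans hQ2
  have hj := jetBound_div ((jetBound_profile hα hα1 hε hz).mono le_rfl hpL le_rfl) hψ hL1
    (by rwa [abs_of_pos hx2])
  have hmem : z.2 2 * p⁻¹ ∈ Icc (0 : ℝ) 1 := ⟨by linarith, by linarith⟩
  have wH := weightedJet_smoothStep (h3 _ hmem) hA3 hj hψ hL1 hc0
  have hC1 : 1 ≤ Ψ ^ 2 := one_le_pow₀ hΨ1
  have hC2 : 1 ≤ Ψ ^ 2 * (1 / p) := by
    rw [mul_one_div, le_div_iff₀ hψ]; nlinarith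
  have hC3 : 1 ≤ Ψ ^ 2 * (1 / p ^ 2 + c / p) := by
    have : 1 ≤ Ψ ^ 2 * (1 / p ^ 2) := by
      rw [mul_one_div, le_div_iff₀ (by positivity), one_mul]; gcongr
    have t2 : 0 ≤ Ψ ^ 2 * (c / p) := by positivity
    linarith
  have v1 := WeightedJet.of_bounded (Q₁ := 1 / p) (Q₂ := 1 / p ^ 2 + c / p) (h1 z hzK)
    (by linarith) hC1 hC2 hC3
  have v2 := WeightedJet.of_bounded (Q₁ := 1 / p) (Q₂ := 1 / p ^ 2 + c / p) (h2 z hzK)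
    (by linarith) hC1 hC2 hC3
  rw [← hAH] at wH
  have w := v1.mul ((v2.mul (wH.one_sub hQ1 hQ2') hQ1 hQ2).one_sub hQ1 hQ2') hQ1 hQ2
  rw [← hAA] at w
  exact w.mono (le_max_left _ _) hQ1 hQ2'

/-! ### Height-independent bounds for the field -/

theorem axisDist_pos {x : E3} (hx : ∀ i, x i ≠ 0) : 0 < axisDist x := by
  have : 0 < |x 0| := abs_pos.2 (hx 0)
  exact this.trans_le (abs_coord_zero_le_axisDist x)

theorem axisDist_le_norm (x : E3) : axisDist x ≤ ‖x‖ := by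
  refine abs_le_of_sq_le_sq' ?_ (norm_nonneg _) |>.2
  rw [axisDist_sq, norm_sq_eq_coords]; nlinarith [sq_nonneg (x 2)]

/-- The singular part of the gradient is controlled by a product weight. -/
theorem gap_weight_le {α r₀ p : ℝ} (hα : 0 < α) (hα1 : α ≤ 1 / 3) {x : E3} (hx : ∀ i, x i ≠ 0)
    (hr : axisDist x ≤ r₀) (hx2 : 0 < x 2) (hp : x 2 ≤ p) (hp' : axisDist x ^ (1 + α) ≤ p) :
    1 / p + axisDist x / p ^ 2 ≤ (2 + r₀) * singWeight ((1 + 2 * α) / (3 + α)) x := by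
  have hr0 := axisDist_pos hx
  set r := axisDist x with hrdef
  set τ := (1 + 2 * α) / (3 + α) with hτ
  have hτ0 : 0 < τ := by rw [hτ]; positivity
  -- This choice of `τ` solves `1 - (1+α)(2-τ) = -2τ`: when `r/p²` is split into powers of `x₃` and
  -- `r`, it becomes `x₃^(-τ) r^(-2τ)`, which puts the same exponent on all three coordinates.
  have hτα : τ * (3 + α) = 1 + 2 * α := by rw [hτ]; field_simp
  have hτ1 : τ ≤ 1 / 2 := by rw [hτ, div_le_iff₀ (by linarith)]; linarith
  have hp0 : 0 < p := hx2.trans_le hp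
  have hS := rpow_axisDist_mul_le_singWeight hτ0.le hx
  rw [← hrdef, abs_of_pos hx2] at hS
  have hS0 : 0 ≤ r ^ (-(2 * τ)) * x 2 ^ (-τ) := by positivity
  -- Interpolation between the two lower bounds for `p`: the power `τ` is estimated by `x₃ ≤ p`, the
  -- remaining power by `r^(1+α) ≤ p`.
  have key : ∀ e : ℝ, τ ≤ e → x 2 ^ τ * r ^ ((1 + α) * (e - τ)) ≤ p ^ e := by
    intro e he
    have : p ^ e = p ^ τ * p ^ (e - τ) := by rw [← Real.rpow_add hp0]; ring_nf
    rw [this, Real.rpow_mul hr0.le]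
    gcongr
  have h1 : 1 / p ≤ (1 + r₀) * (r ^ (-(2 * τ)) * x 2 ^ (-τ)) := by
    have k := key 1 (by linarith)
    rw [Real.rpow_one] at k
    have e : (r ^ (-(2 * τ)) * x 2 ^ (-τ)) * (x 2 ^ τ * r ^ ((1 + α) * (1 - τ))) = r ^ (-α) := by
      have e1 : x 2 ^ (-τ) * x 2 ^ τ = 1 := by rw [← Real.rpow_add hx2]; simp
      have e2 : r ^ (-(2 * τ)) * r ^ ((1 + α) * (1 - τ)) = r ^ (-α) := by
        rw [← Real.rpow_add hr0]; congr 1; linarith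
      calc _ = (x 2 ^ (-τ) * x 2 ^ τ) * (r ^ (-(2 * τ)) * r ^ ((1 + α) * (1 - τ))) := by ring
        _ = _ := by rw [e1, e2, one_mul]
    have h3 : r ^ α ≤ 1 + r₀ := by
      calc r ^ α ≤ (1 + r₀) ^ α := by gcongr; linarith
        _ ≤ (1 + r₀) ^ (1 : ℝ) := Real.rpow_le_rpow_of_exponent_le (by linarith) (by linarith)
        _ = _ := Real.rpow_one _
    have h4 : 1 ≤ (1 + r₀) * r ^ (-α) := by
      calc (1 : ℝ) = r ^ α * r ^ (-α) := by rw [← Real.rpow_add hr0]; simp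
        _ ≤ _ := by gcongr
    rw [div_le_iff₀ hp0]
    calc (1 : ℝ) ≤ (1 + r₀) * r ^ (-α) := h4
      _ = (1 + r₀) * (r ^ (-(2 * τ)) * x 2 ^ (-τ)) * (x 2 ^ τ * r ^ ((1 + α) * (1 - τ))) := by
        rw [← e]; ring
      _ ≤ _ := by
        refine mul_le_mul_of_nonneg_left k (mul_nonneg ?_ hS0)
        linarith
  have h2 : r / p ^ 2 ≤ r ^ (-(2 * τ)) * x 2 ^ (-τ) := by
    have k := key 2 (by linarith)
    rw [Real.rpow_two] at k
    rw [div_le_iff₀ (by positivity)]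
    have e : (r ^ (-(2 * τ)) * x 2 ^ (-τ)) * (x 2 ^ τ * r ^ ((1 + α) * (2 - τ))) = r := by
      have e1 : x 2 ^ (-τ) * x 2 ^ τ = 1 := by rw [← Real.rpow_add hx2]; simp
      have e2 : r ^ (-(2 * τ)) * r ^ ((1 + α) * (2 - τ)) = r := by
        rw [← Real.rpow_add hr0]
        nth_rewrite 2 [← Real.rpow_one r]
        congr 1; linarith
      calc _ = (x 2 ^ (-τ) * x 2 ^ τ) * (r ^ (-(2 * τ)) * r ^ ((1 + α) * (2 - τ))) := by ring
        _ = _ := by rw [e1, e2, one_mul]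
    calc r = (r ^ (-(2 * τ)) * x 2 ^ (-τ)) * (x 2 ^ τ * r ^ ((1 + α) * (2 - τ))) := e.symm
      _ ≤ _ := by gcongr
  calc 1 / p + r / p ^ 2 ≤ (2 + r₀) * (r ^ (-(2 * τ)) * x 2 ^ (-τ)) := by linarith
    _ ≤ _ := by
      refine mul_le_mul_of_nonneg_left hS ?_
      linarith

/-- The weight `|x₁ x₂ x₃|^(-1/6)` controls constants and `r^(-α)`, `α ≤ 1/3`, on bounded sets. -/
theorem one_add_rpow_le_singWeight {α R : ℝ} (hα : 0 < α) (hα1 : α ≤ 1 / 3) {x : E3}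
    (hx : ∀ i, x i ≠ 0) (hR : ‖x‖ ≤ R) :
    1 + axisDist x ^ (-α) ≤ 2 * (1 + R) ^ 2 * singWeight (1 / 6) x := by
  have hr0 := axisDist_pos hx
  have hrR := (axisDist_le_norm x).trans hR
  set r := axisDist x with hrdef
  have hx2 : 0 < |x 2| := abs_pos.2 (hx 2)
  have hx2R := (abs_coord_le_norm x 2).trans hR
  have hS := rpow_axisDist_mul_le_singWeight (s := 1 / 6) (by norm_num) hx
  rw [← hrdef] at hS
  have hsmall : ∀ y e : ℝ, 0 < y → y ≤ R → 0 ≤ e → e ≤ 1 → y ^ e ≤ 1 + R := by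
    intro y e hy hyR he he1
    calc y ^ e ≤ (1 + R) ^ e := by gcongr; linarith
      _ ≤ (1 + R) ^ (1 : ℝ) := Real.rpow_le_rpow_of_exponent_le (by linarith) (by linarith)
      _ = _ := Real.rpow_one _
  have key : ∀ e : ℝ, 0 ≤ e → e ≤ 1 / 3 → r ^ (-e) ≤ (1 + R) ^ 2 * singWeight (1 / 6) x := by
    intro e he he1
    have h1 := hsmall r (1 / 3 - e) hr0 hrR (by linarith) (by linarith)
    have h2 := hsmall |x 2| (1 / 6) hx2 hx2R (by norm_num) (by norm_num)
    calc r ^ (-e) = (r ^ (1 / 3 - e) * |x 2| ^ (1 / 6 : ℝ))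
          * (r ^ (-(2 * (1 / 6)) : ℝ) * |x 2| ^ (-(1 / 6) : ℝ)) := by
          have e1 : |x 2| ^ (1 / 6 : ℝ) * |x 2| ^ (-(1 / 6) : ℝ) = 1 := by
            rw [← Real.rpow_add hx2]; simp
          have e2 : r ^ (1 / 3 - e) * r ^ (-(2 * (1 / 6)) : ℝ) = r ^ (-e) := by
            rw [← Real.rpow_add hr0]; congr 1; ring
          calc r ^ (-e) = r ^ (-e) * 1 := by rw [mul_one]
            _ = (r ^ (1 / 3 - e) * r ^ (-(2 * (1 / 6)) : ℝ))
                * (|x 2| ^ (1 / 6 : ℝ) * |x 2| ^ (-(1 / 6) : ℝ)) := by rw [e1, e2]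
            _ = _ := mul_mul_mul_comm _ _ _ _
      _ ≤ ((1 + R) * (1 + R)) * singWeight (1 / 6) x := by
        have hR0 : 0 ≤ 1 + R := by linarith
        gcongr
      _ = _ := by ring
  have k1 := key 0 le_rfl (by norm_num)
  have k2 := key α hα.le hα1
  rw [neg_zero, Real.rpow_zero] at k1
  linarith

/-- The part of the container below the tip of the solid. -/
def tipZone (r₀ z₁ : ℝ) : Set E3 := {x | axisDist x ≤ r₀ ∧ 0 < x 2 ∧ x 2 < z₁}

set_option maxHeartbeats 800000 in
-- The jets of the cut-off give `|W| ≲ 1 + r/p`, and `r/p ≤ r^(-α)` because `p ≥ r^(1+α)`. The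
-- derivatives are bounded by `1/p + r/p²` and by `r M^((α-1)/2)/p`, with `M = r² + ε²`; the last is
-- of order `1/p` since `r ≤ √M`. The product weights then remove every trace of the height and of
-- `ε`. The indicator records that only the part of the gap below `z₁` is singular: the temperature
-- will be controlled in `L⁶` only there.
theorem exists_field_bounds {α r₀ R z₁ : ℝ} (hα : 0 < α) (hα1 : α ≤ 1 / 3) (hr₀ : 0 < r₀)
    (hz₁ : 0 < z₁) {Ξ κ : ℝ × E3 → ℝ} (hΞ : ContDiff ℝ (⊤ : ℕ∞) Ξ) (hκ : ContDiff ℝ (⊤ : ℕ∞) κ)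
    (hκ0 : ∀ z, r₀ < axisDist z.2 → κ z = 0) :
    ∃ C, 0 < C ∧ ∀ ε, 0 < ε → ε ≤ 1 → ∀ s x, 0 < s → s ≤ R → ‖x‖ ≤ R → (∀ i, x i ≠ 0) →
      ‖streamField (tipCutoff α ε Ξ κ) (s, x)‖ ≤ C * singWeight (1 / 6) x ∧
      ‖fderiv ℝ (streamField (tipCutoff α ε Ξ κ)) (s, x)‖
        ≤ C * (1 + (tipZone r₀ z₁).indicator (singWeight ((1 + 2 * α) / (3 + α))) x) := by
  obtain ⟨A, hA, hAb⟩ := exists_jet_tipCutoff (α := α) hα (by linarith) R hΞ hκ hκ0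
  set τ := (1 + 2 * α) / (3 + α) with hτ
  rcases lt_or_ge R 0 with hR | hR
  · exact ⟨1, one_pos, fun ε _ _ s x h1 h2 _ _ => by linarith⟩
  obtain ⟨C1, hC1⟩ : ∃ C1, C1 = A * (3 + 2 * R) * (2 * (1 + R) ^ 2) := ⟨_, rfl⟩
  obtain ⟨C2, hC2⟩ : ∃ C2, C2 = 5 * A * (1 + R)
    + 5 * A * ((2 + R ^ 2) * ((2 + r₀) + (1 / z₁ + r₀ / z₁ ^ 2))) := ⟨_, rfl⟩
  have hC1p : 0 < C1 := by rw [hC1]; positivity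
  have hC2p : 0 < C2 := by rw [hC2]; positivity
  refine ⟨C1 + C2, by positivity, fun ε hε hε1 s x hs hsR hxR hx => ?_⟩
  have hsm : ContDiffAt ℝ 2 (tipCutoff α ε Ξ κ) (s, x) :=
    contDiffAt_infty.1 (contDiffAt_tipCutoff hε hΞ hκ hs) 2
  have hW := norm_streamField_le (χ := tipCutoff α ε Ξ κ) (z := (s, x))
  have hDW := norm_fderiv_streamField_le hsm
  have hr0 := axisDist_pos hx
  have hrR := (axisDist_le_norm x).trans hxR
  have hone := one_add_rpow_le_singWeight hα hα1 hx hxR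
  have hS6 := singWeight_nonneg (1 / 6) x
  have hI : 0 ≤ (tipZone r₀ z₁).indicator (singWeight τ) x :=
    indicator_nonneg (fun y _ => singWeight_nonneg τ y) x
  have hrα : 0 ≤ axisDist x ^ (-α) := by positivity
  set I := (tipZone r₀ z₁).indicator (singWeight τ) x with hIdef
  dsimp only at hW hDW
  -- reduction to unweighted bounds
  suffices h : ‖streamField (tipCutoff α ε Ξ κ) (s, x)‖ ≤ A * (3 + 2 * R) * (1 + axisDist x ^ (-α)) ∧
      ‖fderiv ℝ (streamField (tipCutoff α ε Ξ κ)) (s, x)‖ ≤ C2 * (1 + I) by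
    constructor
    · refine h.1.trans ?_
      calc A * (3 + 2 * R) * (1 + axisDist x ^ (-α))
          ≤ A * (3 + 2 * R) * (2 * (1 + R) ^ 2 * singWeight (1 / 6) x) := by gcongr
        _ = C1 * singWeight (1 / 6) x := by rw [hC1]; ring
        _ ≤ (C1 + C2) * singWeight (1 / 6) x := by gcongr; linarith
    · refine h.2.trans ?_
      gcongr; linarith
  rcases hAb ε hε hε1 (s, x) hs hsR hxR with hj | ⟨hr, hx2, hxp, hj⟩
  · constructor
    · calc _ ≤ _ := hW
        _ ≤ A + 2 * (R * A) := by
          gcongr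
          · exact hj.2
          · exact hj.3
        _ ≤ A * (3 + 2 * R) * 1 := by nlinarith
        _ ≤ _ := by gcongr; linarith
    · calc _ ≤ _ := hDW
        _ ≤ 5 * (A + R * A) := by
          gcongr
          · exact hj.3
          · exact hj.4
        _ = 5 * A * (1 + R) * 1 := by ring
        _ ≤ C2 * (1 + I) := by
          rw [hC2]
          gcongr
          · exact le_add_of_nonneg_right (by positivity)
          · linarith
  · dsimp only at hr hx2 hxp
    set p := profile α ε (s, x) with hp
    have hp0 : 0 < p := hx2.trans_le hxp
    have hM := radiusSq_pos hε (s, x)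
    set M := radiusSq ε (s, x) with hMdef
    have hMr : axisDist x ^ 2 ≤ M := by rw [hMdef, radiusSq_eq]; nlinarith [sq_nonneg ε]
    have hMR : M ≤ 1 + R ^ 2 := by
      rw [hMdef, radiusSq_eq]; dsimp only; nlinarith
    have hpr : axisDist x ^ (1 + α) ≤ p := by
      have : axisDist x ^ (1 + α) = (axisDist x ^ 2) ^ ((1 + α) / 2) := by
        rw [← Real.rpow_two, ← Real.rpow_mul hr0.le]; congr 1; ring
      rw [this, hp, profile]
      have : (axisDist x ^ 2) ^ ((1 + α) / 2) ≤ M ^ ((1 + α) / 2) := by gcongr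
      dsimp only; linarith
    have hrp : axisDist x * (1 / p) ≤ axisDist x ^ (-α) := by
      rw [mul_one_div, div_le_iff₀ hp0]
      calc axisDist x = axisDist x ^ (-α) * axisDist x ^ (1 + α) := by
            rw [← Real.rpow_add hr0]; simp
        _ ≤ _ := by gcongr
    have hrM : axisDist x * M ^ ((α - 1) / 2) ≤ 1 + R ^ 2 := by
      have h1 : axisDist x ≤ M ^ (1 / 2 : ℝ) := by
        rw [← Real.sqrt_eq_rpow]; exact Real.le_sqrt_of_sq_le hMr
      calc axisDist x * M ^ ((α - 1) / 2) ≤ M ^ (1 / 2 : ℝ) * M ^ ((α - 1) / 2) := by gcongr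
        _ = M ^ (α / 2) := by rw [← Real.rpow_add hM]; congr 1; ring
        _ ≤ (1 + R ^ 2) ^ (α / 2) := by gcongr
        _ ≤ (1 + R ^ 2) ^ (1 : ℝ) :=
          Real.rpow_le_rpow_of_exponent_le (by nlinarith [sq_nonneg R]) (by linarith)
        _ = _ := Real.rpow_one _
    constructor
    · calc _ ≤ _ := hW
        _ ≤ A + 2 * (axisDist x * (A * (1 / p))) := by
          gcongr
          · exact hj.2
          · exact hj.3
        _ = A + 2 * A * (axisDist x * (1 / p)) := by ring
        _ ≤ A + 2 * A * axisDist x ^ (-α) := by gcongr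
        _ ≤ _ := by
          have t1 := mul_nonneg hA.le hrα
          have t2 := mul_nonneg (mul_nonneg hA.le hR) hrα
          have t3 := mul_nonneg hA.le hR
          linarith
    · have h1 : ‖fderiv ℝ (streamField (tipCutoff α ε Ξ κ)) (s, x)‖
          ≤ 5 * A * ((2 + R ^ 2) * (1 / p + axisDist x / p ^ 2)) := by
        have e : axisDist x * (A * (1 / p ^ 2 + M ^ ((α - 1) / 2) / p))
            = A * (axisDist x / p ^ 2 + (axisDist x * M ^ ((α - 1) / 2)) * (1 / p)) := by
          field_simp
        calc _ ≤ _ := hDW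
          _ ≤ 5 * (A * (1 / p) + axisDist x * (A * (1 / p ^ 2 + M ^ ((α - 1) / 2) / p))) := by
            gcongr
            · exact hj.3
            · exact hj.4
          _ ≤ 5 * (A * (1 / p) + A * (axisDist x / p ^ 2 + (1 + R ^ 2) * (1 / p))) := by
            rw [e]; gcongr
          _ ≤ _ := by
            have : 0 ≤ A * (axisDist x / p ^ 2) := by positivity
            have t2 := mul_nonneg this (sq_nonneg R)
            linarith
      have h2 : 1 / p + axisDist x / p ^ 2
          ≤ ((2 + r₀) + (1 / z₁ + r₀ / z₁ ^ 2)) * (1 + I) := by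
        have hz0 : 0 ≤ 1 / z₁ + r₀ / z₁ ^ 2 := by positivity
        -- Above height `z₁` the layer forces `p ≥ x₃ ≥ z₁`, so the singular expression is bounded.
        rcases lt_or_ge (x 2) z₁ with hlt | hge
        · have hmem : x ∈ tipZone r₀ z₁ := ⟨hr, hx2, hlt⟩
          have hIe : I = singWeight τ x := by rw [hIdef, indicator_of_mem hmem]
          have := gap_weight_le hα hα1 hx hr hx2 hxp hpr
          rw [← hτ, ← hIe] at this
          nlinarith [mul_nonneg hz0 hI]
        · have hpz : z₁ ≤ p := hge.trans hxp
          have : 1 / p + axisDist x / p ^ 2 ≤ 1 / z₁ + r₀ / z₁ ^ 2 := by gcongr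
          nlinarith [mul_nonneg hz0 hI]
      calc _ ≤ _ := h1
        _ ≤ 5 * A * ((2 + R ^ 2) * (((2 + r₀) + (1 / z₁ + r₀ / z₁ ^ 2)) * (1 + I))) := by gcongr
        _ = 5 * A * ((2 + R ^ 2) * ((2 + r₀) + (1 / z₁ + r₀ / z₁ ^ 2))) * (1 + I) := by ring
        _ ≤ C2 * (1 + I) := by
          rw [hC2]; gcongr
          exact le_add_of_nonneg_left (by positivity)

/-! ### Test velocities for all positive heights -/

theorem exists_smooth_bodyCutoff {B : Set E3} {d : ℝ} (hd : 0 < d) :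
    ∃ Ξ : E3 → ℝ, ContDiff ℝ (⊤ : ℕ∞) Ξ ∧ (∀ x, Metric.infDist x B ≤ d → Ξ x = 1) ∧
      ∀ x, 2 * d ≤ Metric.infDist x B → Ξ x = 0 := by
  obtain ⟨f, h0, h1, -⟩ := exists_contMDiffMap_zero_one_of_isClosed (n := (⊤ : ℕ∞))
    (modelWithCornersSelf ℝ E3)
    (s := {x | 2 * d ≤ Metric.infDist x B}) (t := {x | Metric.infDist x B ≤ d})
    (isClosed_le continuous_const (Metric.continuous_infDist_pt B))
    (isClosed_le (Metric.continuous_infDist_pt B) continuous_const)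
    (by
      rw [Set.disjoint_left]
      intro x hx hx'
      have h1 : 2 * d ≤ Metric.infDist x B := hx
      have h2 : Metric.infDist x B ≤ d := hx'
      linarith)
  exact ⟨f, f.contMDiff.contDiff, fun x hx => h1 hx, fun x hx => h0 hx⟩

/-- A cut-off around the axis: `1` for `r ≤ r₀ / 2` and `0` for `r ≥ r₀`. -/
noncomputable def axisCutoff (r₀ : ℝ) (z : ℝ × E3) : ℝ :=
  Real.smoothTransition ((r₀ ^ 2 - (z.2 0 ^ 2 + z.2 1 ^ 2)) / (3 / 4 * r₀ ^ 2))

theorem contDiff_axisCutoff (r₀ : ℝ) : ContDiff ℝ (⊤ : ℕ∞) (axisCutoff r₀) := by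
  have hx : ∀ i : Fin 3, ContDiff ℝ (⊤ : ℕ∞) (fun z : ℝ × E3 => z.2 i) := fun i =>
    (coordCLM i).contDiff
  exact Real.smoothTransition.contDiff.comp
    ((contDiff_const.sub (((hx 0).pow 2).add ((hx 1).pow 2))).div_const _)

theorem axisCutoff_of_gt {r₀ : ℝ} (hr₀ : 0 < r₀) (z : ℝ × E3) (h : r₀ < axisDist z.2) :
    axisCutoff r₀ z = 0 := by
  refine Real.smoothTransition.zero_of_nonpos ?_
  rw [← axisDist_sq]
  exact div_nonpos_of_nonpos_of_nonneg (by nlinarith) (by positivity)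

theorem axisCutoff_of_lt {r₀ : ℝ} (hr₀ : 0 < r₀) (z : ℝ × E3) (h : axisDist z.2 < r₀ / 2) :
    axisCutoff r₀ z = 1 := by
  refine Real.smoothTransition.one_of_one_le ?_
  rw [← axisDist_sq, le_div_iff₀ (by positivity)]
  nlinarith [axisDist_nonneg z.2]

/-- Test velocities for all positive heights: divergence free, `e₃` near the solid, `0` near the
complement of the container, with bounds that do not depend on the least height `δ`. -/
theorem exists_testField {Ω B : Set E3} {α r₀ d₀ R z₁ : ℝ} (hgeo : Geometry Ω B α r₀)
    (hα : 0 < α) (hα1 : α ≤ 1 / 3) (hr₀ : 0 < r₀) (hd₀ : 0 < d₀) (hz₁ : 0 < z₁) :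
    ∃ C, 0 < C ∧ ∀ δ > 0, ∃ η > 0, ∃ W : ℝ × E3 → E3,
      (∀ z, 0 < z.1 → ContDiffAt ℝ (⊤ : ℕ∞) W z) ∧
      (∀ z, 0 < z.1 → ∑ j, fderiv ℝ W z (spaceDir j) j = 0) ∧
      (∀ s h x, δ ≤ h → |s - h| ≤ η → x ∈ bodyAt B h → ∀ᶠ z in nhds (s, x), W z = e3) ∧
      (∀ s h x, δ ≤ h → |s - h| ≤ η → bodyAt B h ⊆ Ω →
        (∀ x ∈ bodyAt B h, ∀ y ∈ frontier Ω \ flatPatch r₀, d₀ ≤ dist x y) → x ∉ Ω →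
        ∀ᶠ z in nhds (s, x), W z = 0) ∧
      (∀ s x, 0 < s → s ≤ R → ‖x‖ ≤ R → (∀ i, x i ≠ 0) →
        ‖W (s, x)‖ ≤ C * singWeight (1 / 6) x ∧
        ‖fderiv ℝ W (s, x)‖
          ≤ C * (1 + (tipZone r₀ z₁).indicator (singWeight ((1 + 2 * α) / (3 + α))) x)) := by
  obtain ⟨d, hd, hnear⟩ := hgeo.exists_near_radius hα hr₀ hd₀
  obtain ⟨Ξ₀, hΞ₀, hΞ1, hΞ0⟩ := exists_smooth_bodyCutoff (B := B) (d := d / 3) (by positivity)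
  set Ξ : ℝ × E3 → ℝ := fun z => Ξ₀ (z.2 - z.1 • e3) with hΞdef
  have hΞ : ContDiff ℝ (⊤ : ℕ∞) Ξ :=
    hΞ₀.comp (contDiff_snd.sub (contDiff_fst.smul contDiff_const))
  obtain ⟨C, hC, hbound⟩ := exists_field_bounds (R := R) hα hα1 hr₀ hz₁ hΞ (contDiff_axisCutoff r₀)
    (axisCutoff_of_gt hr₀)
  refine ⟨C, hC, fun δ hδ => ?_⟩
  have hBne : B.Nonempty := by
    have := hgeo.tip_mem_bodyAt hα hr₀ 0
    exact ⟨_, this⟩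
  have hinf : Continuous fun z : ℝ × E3 => Metric.infDist (z.2 - z.1 • e3) B :=
    (Metric.continuous_infDist_pt B).comp (by fun_prop)
  -- the regularization
  obtain ⟨ε, hε, hε1, hεδ⟩ : ∃ ε : ℝ, 0 < ε ∧ ε ≤ 1 ∧ ε ^ (1 + α) ≤ δ / 4 := by
    refine ⟨min 1 (δ / 4), by positivity, min_le_left _ _, ?_⟩
    calc (min 1 (δ / 4)) ^ (1 + α) ≤ (min 1 (δ / 4)) ^ (1 : ℝ) :=
          Real.rpow_le_rpow_of_exponent_ge (by positivity) (min_le_left _ _) (by linarith)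
      _ = min 1 (δ / 4) := Real.rpow_one _
      _ ≤ δ / 4 := min_le_right _ _
  -- The tolerance for using the field of height `s` with the solid at height `h`: small against the
  -- gap, and small against the distance at which the body cut-off starts to decay.
  set η := min (δ / 8) (d / 4) with hη
  have hη0 : 0 < η := by positivity
  have hηδ : η ≤ δ / 8 := min_le_left _ _
  have hηd : η ≤ d / 4 := min_le_right _ _
  have hpos : ∀ s h : ℝ, δ ≤ h → |s - h| ≤ η → 0 < s := by
    intro s h hh hs
    have := (abs_le.1 hs).1
    linarith
  have hFc : ∀ s x, 0 < s →
      ContinuousAt (fun z : ℝ × E3 => z.2 2 * (profile α ε z)⁻¹) (s, x) := fun s x hs =>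
    ((coordCLM 2).continuous.continuousAt).mul
      ((contDiffAt_profile hε (s, x)).continuousAt.inv₀ (profile_pos hε hs).ne')
  refine ⟨η, hη0, streamField (tipCutoff α ε Ξ (axisCutoff r₀)), ?_, ?_, ?_, ?_, ?_⟩
  · exact fun z hz => contDiffAt_streamField (contDiffAt_tipCutoff hε hΞ (contDiff_axisCutoff r₀) hz)
  · exact fun z hz => trace_fderiv_streamField
      (contDiffAt_infty.1 (contDiffAt_tipCutoff hε hΞ (contDiff_axisCutoff r₀) hz) 2)
  · intro s h x hh hs hx
    have hs0 := hpos s h hh hs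
    apply streamField_eventuallyEq_of_one
    have hd1 : Metric.infDist (x - s • e3) B < d / 3 := by
      refine (Metric.infDist_le_dist_of_mem (show x - h • e3 ∈ B from hx)).trans_lt ?_
      have e : (x - s • e3) - (x - h • e3) = -((s - h) • e3) := by rw [sub_smul]; abel
      rw [dist_eq_norm, e, norm_neg, norm_smul, e3, unitVec]
      simp
      linarith
    have hev1 : ∀ᶠ z : ℝ × E3 in nhds (s, x), Ξ z = 1 := by
      filter_upwards [hinf.continuousAt.eventually (gt_mem_nhds hd1)] with z hz
      exact hΞ1 _ hz.le
    by_cases hr : r₀ < axisDist x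
    · have : ∀ᶠ z : ℝ × E3 in nhds (s, x), r₀ < axisDist z.2 :=
        (continuous_axisDist.comp continuous_snd).continuousAt.eventually (lt_mem_nhds hr)
      filter_upwards [hev1, this] with z hz1 hz2
      simp [tipCutoff, hz1, axisCutoff_of_gt hr₀ z hz2]
    · rw [not_lt] at hr
      have htip := hgeo.bodyAt_tip_le hx (by linarith)
      -- Points of the solid satisfy `x₃ ≥ h + r^(1+α)`, while subadditivity of the power `(1+α)/2 ≤
      -- 1` gives `ψ ≤ s + r^(1+α) + ε^(1+α)`. The errors `s - h ≤ δ/8` and `ε^(1+α) ≤ δ/4` cost two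
      -- thirds of `3δ/8`, that is `δ/4 < h/3`.
      have hF : 2 / 3 < x 2 * (profile α ε (s, x))⁻¹ := by
        have hp := profile_pos (α := α) (z := (s, x)) hε hs0
        rw [← div_eq_mul_inv, lt_div_iff₀ hp]
        have hq : radiusSq ε (s, x) ^ ((1 + α) / 2) ≤ axisDist x ^ (1 + α) + ε ^ (1 + α) := by
          rw [radiusSq_eq]
          refine (Real.rpow_add_le_add_rpow (sq_nonneg _) (sq_nonneg _) (by linarith)
            (by linarith)).trans_eq ?_
          rw [← Real.rpow_two, ← Real.rpow_two, ← Real.rpow_mul (axisDist_nonneg x),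
            ← Real.rpow_mul hε.le]
          congr 2 <;> ring
        have h1 := (abs_le.1 hs).2
        have h2 : 0 ≤ axisDist x ^ (1 + α) := Real.rpow_nonneg (axisDist_nonneg x) _
        rw [profile]; dsimp only
        linarith
      filter_upwards [hev1, (hFc s x hs0).eventually (lt_mem_nhds hF)] with z hz1 hz2
      simp [tipCutoff, hz1, smoothStep_of_ge hz2.le]
  · intro s h x hh hs hsub hfar hx
    have hs0 := hpos s h hh hs
    apply streamField_eventuallyEq_of_zero
    -- Far from the body `Ξ` vanishes. Otherwise `x` is within `d` of the solid at height `h`, hence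
    -- near the axis and at `x₃ ≤ 0`, where the axis cut-off is `1` and the step is `0`.
    by_cases hd2 : 2 * (d / 3) < Metric.infDist (x - s • e3) B
    · filter_upwards [hinf.continuousAt.eventually (lt_mem_nhds hd2)] with z hz
      have : Ξ z = 0 := hΞ0 _ hz.le
      simp [tipCutoff, this]
    · rw [not_lt] at hd2
      obtain ⟨b, hb, hbd⟩ := hgeo.body_compact.exists_infDist_eq_dist hBne (x - s • e3)
      rw [hbd] at hd2
      have hbm : b + h • e3 ∈ bodyAt B h := by simpa [bodyAt] using hb
      have hdist : dist x (b + h • e3) ≤ d := by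
        have e : x - (b + h • e3) = (x - s • e3 - b) + (s - h) • e3 := by rw [sub_smul]; abel
        rw [dist_eq_norm, e]
        refine (norm_add_le _ _).trans ?_
        have hn : ‖(s - h) • e3‖ = |s - h| := by rw [norm_smul, e3, unitVec]; simp
        rw [← dist_eq_norm, hn]
        linarith
      obtain ⟨hr, hx2⟩ := hnear h (hδ.trans_le hh) hsub hfar _ hbm x hx hdist
      have hF : x 2 * (profile α ε (s, x))⁻¹ < 1 / 3 := by
        have hp := profile_pos (α := α) (z := (s, x)) hε hs0
        have : x 2 * (profile α ε (s, x))⁻¹ ≤ 0 :=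
          mul_nonpos_of_nonpos_of_nonneg hx2 (by positivity)
        linarith
      have hr' : ∀ᶠ z : ℝ × E3 in nhds (s, x), axisDist z.2 < r₀ / 2 :=
        (continuous_axisDist.comp continuous_snd).continuousAt.eventually (gt_mem_nhds hr)
      filter_upwards [hr', (hFc s x hs0).eventually (gt_mem_nhds hF)] with z hz1 hz2
      simp [tipCutoff, axisCutoff_of_lt hr₀ z hz1, smoothStep_of_le hz2.le]
  · exact fun s x h1 h2 h3 h4 => hbound ε hε hε1 s x h1 h2 h3 h4

/-! ### Sobolev's inequality for zero boundary values -/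

theorem eLpNorm_natCast_pow {X F : Type*} [MeasurableSpace X] [NormedAddCommGroup F]
    {μ : Measure X} (f : X → F) {n : ℕ} (hn : n ≠ 0) :
    eLpNorm f n μ ^ n = ∫⁻ x, ‖f x‖ₑ ^ n ∂μ := by
  have h := eLpNorm_nnreal_pow_eq_lintegral (f := f) (μ := μ) (p := (n : ℝ≥0))
    (by exact_mod_cast hn)
  simpa using h

/-- The Sobolev inequality `W₀^{1,2} ⊂ L⁶` in three dimensions. -/
theorem exists_sobolev (F : Type*) [NormedAddCommGroup F] [NormedSpace ℝ F]
    [FiniteDimensional ℝ F] :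
    ∃ C : ℝ≥0, ∀ u : E3 → F, ContDiff ℝ 1 u → HasCompactSupport u →
      ∫⁻ x, ‖u x‖ₑ ^ 6 ≤ C * (∫⁻ x, ‖fderiv ℝ u x‖ₑ ^ 2) ^ 3 := by
  refine ⟨(SNormLESNormFDerivOfEqConst F (volume : Measure E3) ((2 : ℝ≥0) : ℝ)) ^ 6,
    fun u hu hs => ?_⟩
  have h := eLpNorm_le_eLpNorm_fderiv_of_eq (volume : Measure E3) hu hs (p := 2) (p' := 6)
    (by norm_num) (by simp) (by simp; norm_num)
  have h2 := pow_le_pow_left' h 6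
  have e1 := eLpNorm_natCast_pow (μ := (volume : Measure E3)) u (n := 6) (by norm_num)
  have e2 := eLpNorm_natCast_pow (μ := (volume : Measure E3)) (fderiv ℝ u) (n := 2) (by norm_num)
  rw [← e1, ← e2, ← pow_mul, ENNReal.coe_pow, ← mul_pow]
  exact_mod_cast h2

theorem ddot_self_nonneg (A : Mat3) : 0 ≤ ddot A A :=
  Finset.sum_nonneg fun _ _ => Finset.sum_nonneg fun _ _ => mul_self_nonneg _

theorem ddot_add_self_le (A B : Mat3) :
    ddot (A + B) (A + B) ≤ 2 * ddot A A + 2 * ddot B B := by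
  simp only [ddot, Finset.mul_sum, ← Finset.sum_add_distrib, Matrix.add_apply]
  exact Finset.sum_le_sum fun i _ => Finset.sum_le_sum fun j _ => by
    nlinarith [sq_nonneg (A i j - B i j)]

theorem ddot_neg_self (A : Mat3) : ddot (-A) (-A) = ddot A A := by simp [ddot]

theorem eq_sum_unitVec (v : E3) : v = ∑ j, v j • unitVec j := by
  ext i
  simp [unitVec, Finset.sum_apply, Pi.single_apply]

/-- The operator norm of the derivative is at most the Frobenius norm of the Jacobian. -/
theorem norm_fderiv_sq_le_ddot_jacobian (v : E3 → E3) (x : E3) :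
    ‖fderiv ℝ v x‖ ^ 2 ≤ ddot (jacobian v x) (jacobian v x) := by
  have hJ := ddot_self_nonneg (jacobian v x)
  rw [← Real.sq_sqrt hJ]
  gcongr
  refine ContinuousLinearMap.opNorm_le_bound _ (Real.sqrt_nonneg _) fun w => ?_
  refine abs_le_of_sq_le_sq' ?_ (by positivity) |>.2
  rw [mul_pow, Real.sq_sqrt hJ, norm_sq_eq_coords, norm_sq_eq_coords]
  have hc : ∀ i, fderiv ℝ v x w i = ∑ j, jacobian v x i j * w j := by
    intro i
    conv_lhs => rw [eq_sum_unitVec w, map_sum]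
    simp [jacobian, mul_comm]
  have hcs : ∀ i, (fderiv ℝ v x w i) ^ 2
      ≤ (∑ j, jacobian v x i j * jacobian v x i j) * (w 0 ^ 2 + w 1 ^ 2 + w 2 ^ 2) := by
    intro i
    rw [hc]
    have := Finset.sum_mul_sq_le_sq_mul_sq Finset.univ (jacobian v x i) w
    rw [Fin.sum_univ_three (fun j => w j ^ 2)] at this
    simpa [pow_two] using this
  rw [ddot, Fin.sum_univ_three (fun i => ∑ j, jacobian v x i j * jacobian v x i j), add_mul, add_mul]
  exact add_le_add (add_le_add (hcs 0) (hcs 1)) (hcs 2)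

theorem enorm_fderiv_pow_eq_zero {E F : Type*} [NormedAddCommGroup E] [NormedSpace ℝ E]
    [NormedAddCommGroup F] [NormedSpace ℝ F] {f : E → F} {x : E} (hx : x ∉ tsupport f) {n : ℕ}
    (hn : n ≠ 0) : ‖fderiv ℝ f x‖ₑ ^ n = 0 := by
  have : fderiv ℝ f x = 0 :=
    image_eq_zero_of_notMem_tsupport fun h => hx (tsupport_fderiv_subset ℝ h)
  rw [← ofReal_norm, this, norm_zero, ENNReal.ofReal_zero, zero_pow hn]

/-- Sobolev's inequality for `W₀^{1,2}(Ω; ℝ³)`. -/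
theorem exists_sobolev_W012 :
    ∃ C : ℝ≥0, ∀ (Ω : Set E3) (v : E3 → E3) (A : E3 → Mat3), MeasurableSet Ω → IsW012 Ω v A →
      ∫⁻ x in Ω, ‖v x‖ₑ ^ 6 ≤ C * (∫⁻ x in Ω, ENNReal.ofReal (‖v x‖ ^ 2 + ddot (A x) (A x))) ^ 3 := by
  obtain ⟨C, hC⟩ := exists_sobolev E3
  -- The factor is `2³`: passing from the Jacobian of an approximation to the limit gradient costs a
  -- factor `2` in the squared norm, which Sobolev's inequality raises to the third power.
  refine ⟨C * 8, fun Ω v A hΩ hvA => ?_⟩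
  obtain ⟨hv, hA, happ⟩ := hvA
  set D := ∫⁻ x in Ω, ENNReal.ofReal (‖v x‖ ^ 2 + ddot (A x) (A x)) with hD
  choose ψ hψ hψε using fun n : ℕ => happ (1 / ((n : ℝ) + 1)) (by positivity)
  have hAm : AEMeasurable (fun x => ddot (A x) (A x)) (volume.restrict Ω) := by
    unfold ddot
    refine Finset.aemeasurable_fun_sum _ fun i _ => Finset.aemeasurable_fun_sum _ fun j _ => ?_
    exact ((hA i j).1.aemeasurable).mul (hA i j).1.aemeasurable
  -- convergence
  have hψc : ∀ n, Continuous (ψ n) := fun n => (hψ n).1.continuous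
  have hε : Filter.Tendsto (fun n : ℕ => ENNReal.ofReal (1 / ((n : ℝ) + 1))) Filter.atTop (nhds 0) := by
    have := ENNReal.tendsto_ofReal (tendsto_one_div_add_atTop_nhds_zero_nat (𝕜 := ℝ))
    simpa using this
  have hL2 : Filter.Tendsto (fun n => eLpNorm (ψ n - v) 2 (volume.restrict Ω)) Filter.atTop
      (nhds 0) := by
    have hb : ∀ n, eLpNorm (ψ n - v) 2 (volume.restrict Ω) ^ 2
        ≤ ENNReal.ofReal (1 / ((n : ℝ) + 1)) := by
      intro n
      have e := eLpNorm_natCast_pow (μ := volume.restrict Ω) (ψ n - v) (n := 2) (by norm_num)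
      rw [Nat.cast_ofNat] at e
      rw [e]
      refine le_trans (lintegral_mono fun x => ?_) (hψε n).le
      rw [← ofReal_norm, ← ENNReal.ofReal_pow (norm_nonneg _)]
      apply ENNReal.ofReal_le_ofReal
      rw [Pi.sub_apply, norm_sub_rev]
      linarith [ddot_self_nonneg (A x - jacobian (ψ n) x)]
    have h2 : Filter.Tendsto (fun n => eLpNorm (ψ n - v) 2 (volume.restrict Ω) ^ 2) Filter.atTop
        (nhds 0) := tendsto_of_tendsto_of_tendsto_of_le_of_le tendsto_const_nhds hε
          (fun _ => zero_le) hb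
    have h3 := (ENNReal.continuous_rpow_const (y := (1 / 2 : ℝ))).continuousAt.tendsto.comp h2
    rw [ENNReal.zero_rpow_of_pos (by norm_num)] at h3
    refine h3.congr fun n => ?_
    simp only [Function.comp]
    rw [← ENNReal.rpow_natCast, ← ENNReal.rpow_mul]
    norm_num
  -- Convergence in `L²` gives almost everywhere convergence along a subsequence, so the `L⁶` bound
  -- passes to the limit by Fatou's lemma.
  obtain ⟨ns, hns, hae⟩ := (tendstoInMeasure_of_tendsto_eLpNorm (by norm_num)
    (fun n => (hψc n).aestronglyMeasurable) hv.1 hL2).exists_seq_tendsto_ae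
  -- bounds
  have hgrad : ∀ n, ∫⁻ x, ‖fderiv ℝ (ψ n) x‖ₑ ^ 2
      ≤ 2 * D + 2 * ENNReal.ofReal (1 / ((n : ℝ) + 1)) := by
    intro n
    have hsupp : ∀ x, x ∉ Ω → ‖fderiv ℝ (ψ n) x‖ₑ ^ 2 = 0 := by
      intro x hx
      exact enorm_fderiv_pow_eq_zero (fun h => hx ((hψ n).2.2 h)) two_ne_zero
    rw [← setLIntegral_eq_of_support_subset (s := Ω) (fun x hx => by
      by_contra h; exact hx (hsupp x h)), hD,
      ← lintegral_const_mul' _ _ (by simp)]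
    refine le_trans ?_ (add_le_add_right (mul_le_mul_right (hψε n).le 2) _)
    rw [← lintegral_const_mul' _ _ (by simp), ← lintegral_add_left']
    · refine lintegral_mono fun x => ?_
      have two : ∀ y : ℝ, 2 * ENNReal.ofReal y = ENNReal.ofReal (2 * y) := fun y => by
        rw [ENNReal.ofReal_mul (by norm_num)]; simp
      rw [← ofReal_norm, ← ENNReal.ofReal_pow (norm_nonneg _), two, two]
      have h0 := ddot_self_nonneg (A x)
      have h0' := ddot_self_nonneg (A x - jacobian (ψ n) x)
      rw [← ENNReal.ofReal_add (by positivity) (by positivity)]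
      apply ENNReal.ofReal_le_ofReal
      refine (norm_fderiv_sq_le_ddot_jacobian _ _).trans ?_
      have h1 := ddot_add_self_le (A x) (-(A x - jacobian (ψ n) x))
      rw [ddot_neg_self] at h1
      have e : A x + -(A x - jacobian (ψ n) x) = jacobian (ψ n) x := by abel
      rw [e] at h1
      nlinarith [sq_nonneg ‖v x‖, sq_nonneg ‖v x - ψ n x‖]
    · exact (((hv.1.norm.aemeasurable.pow_const 2).add hAm).ennreal_ofReal).const_mul _
  have hn : ∀ n, ∫⁻ x in Ω, ‖ψ n x‖ₑ ^ 6
      ≤ C * (2 * D + 2 * ENNReal.ofReal (1 / ((n : ℝ) + 1))) ^ 3 := by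
    intro n
    have h1 : ContDiff ℝ 1 (ψ n) := contDiff_infty.1 (hψ n).1 1
    refine (setLIntegral_le_lintegral _ _).trans ((hC _ h1 (hψ n).2.1).trans ?_)
    gcongr
    exact hgrad n
  have hlim : Filter.Tendsto (fun n : ℕ => (C : ℝ≥0∞) * (2 * D + 2 * ENNReal.ofReal (1 / ((n : ℝ) + 1))) ^ 3)
      Filter.atTop (nhds (C * (2 * D + 2 * 0) ^ 3)) := by
    refine ENNReal.Tendsto.const_mul ?_ (Or.inr ENNReal.coe_ne_top)
    refine (ENNReal.continuous_pow 3).continuousAt.tendsto.comp ?_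
    exact tendsto_const_nhds.add (ENNReal.Tendsto.const_mul hε (Or.inr (by simp)))
  have hfinal : C * (2 * D + 2 * 0) ^ 3 = ((C * 8 : ℝ≥0) : ℝ≥0∞) * D ^ 3 := by
    rw [mul_zero, add_zero, mul_pow]
    push_cast
    rw [mul_assoc]; norm_num
  calc ∫⁻ x in Ω, ‖v x‖ₑ ^ 6
      = ∫⁻ x in Ω, Filter.liminf (fun k => ‖ψ (ns k) x‖ₑ ^ 6) Filter.atTop := by
        refine lintegral_congr_ae ?_
        filter_upwards [hae] with x hx
        refine (Filter.Tendsto.liminf_eq ?_).symm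
        exact (ENNReal.continuous_pow 6).continuousAt.tendsto.comp hx.enorm
    _ ≤ Filter.liminf (fun k => ∫⁻ x in Ω, ‖ψ (ns k) x‖ₑ ^ 6) Filter.atTop :=
        lintegral_liminf_le fun k => ((hψc _).enorm.measurable).pow_const 6
    _ ≤ Filter.liminf (fun k => (C : ℝ≥0∞) * (2 * D + 2 * ENNReal.ofReal (1 / ((ns k : ℝ) + 1))) ^ 3)
          Filter.atTop := Filter.liminf_le_liminf (Filter.Eventually.of_forall fun k => hn _)
    _ = C * (2 * D + 2 * 0) ^ 3 := (hlim.comp hns.tendsto_atTop).liminf_eq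
    _ = _ := hfinal

/-! ### Sobolev's inequality on the half-space by reflection -/

/-- The upper half-space. -/
def upperHalf : Set E3 := {x | 0 < x 2}

theorem measurableSet_upperHalf : MeasurableSet upperHalf :=
  (isOpen_lt continuous_const (by fun_prop : Continuous fun x : E3 => x 2)).measurableSet

/-- Reflection in the plane `x₃ = 0`. -/
noncomputable def flipThird : E3 ≃ₗᵢ[ℝ] E3 :=
  LinearIsometryEquiv.piLpCongrRight 2
    (fun i : Fin 3 => if i = 2 then LinearIsometryEquiv.neg ℝ else LinearIsometryEquiv.refl ℝ ℝ)

theorem flipThird_apply (x : E3) : flipThird x = !₂[x 0, x 1, -x 2] := by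
  ext i; fin_cases i <;> simp [flipThird]

/-- Smooth folding of `ℝ³` onto the upper half-space; `|x₃|` is replaced by `√(x₃² + δ²)`. -/
noncomputable def fold (δ : ℝ) (x : E3) : E3 := !₂[x 0, x 1, √(x 2 ^ 2 + δ ^ 2)]

theorem continuous_fold (δ : ℝ) : Continuous (fold δ) := by
  unfold fold; fun_prop

theorem norm_le_norm_fold (δ : ℝ) (x : E3) : ‖x‖ ≤ ‖fold δ x‖ := by
  refine abs_le_of_sq_le_sq' ?_ (norm_nonneg _) |>.2
  rw [norm_sq_eq_coords, norm_sq_eq_coords]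
  simp only [fold, Matrix.cons_val]
  rw [Real.sq_sqrt (by positivity)]
  nlinarith [sq_nonneg δ]

/-- The only nontrivial derivative is `x₃ / √(x₃² + δ²)`, of modulus at most `1`, so the bound is
uniform in `δ`. The smooth folding replaces reflection, which would not preserve `C¹`. -/
theorem hasFDerivAt_fold {δ : ℝ} (hδ : 0 < δ) (x : E3) :
    ∃ L : E3 →L[ℝ] E3, HasFDerivAt (fold δ) L x ∧ ‖L‖ ≤ 3 := by
  have hpos : 0 < x 2 ^ 2 + δ ^ 2 := by positivity
  set c : ℝ := x 2 / √(x 2 ^ 2 + δ ^ 2) with hc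
  have hsq : 0 < √(x 2 ^ 2 + δ ^ 2) := Real.sqrt_pos.2 hpos
  have hc1 : |c| ≤ 1 := by
    rw [hc, abs_div, abs_of_pos hsq, div_le_one hsq]
    exact Real.abs_le_sqrt (by nlinarith [sq_nonneg δ])
  have hp : ∀ i : Fin 3, HasFDerivAt (fun y : E3 => y i) (EuclideanSpace.proj i : E3 →L[ℝ] ℝ) x :=
    fun i => (EuclideanSpace.proj i : E3 →L[ℝ] ℝ).hasFDerivAt
  have h2 : HasFDerivAt (fun y : E3 => √(y 2 ^ 2 + δ ^ 2))
      (c • (EuclideanSpace.proj 2 : E3 →L[ℝ] ℝ)) x := by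
    have := (((hp 2).pow 2).add_const (δ ^ 2)).sqrt hpos.ne'
    refine this.congr_fderiv ?_
    ext v
    simp [hc]
    field_simp
  set L : E3 →L[ℝ] E3 := ContinuousLinearMap.id ℝ E3
    + (c - 1) • ((EuclideanSpace.proj 2 : E3 →L[ℝ] ℝ).smulRight (unitVec 2)) with hL
  have hLc : ∀ v, L v 0 = v 0 ∧ L v 1 = v 1 ∧ L v 2 = c * v 2 := by
    intro v
    refine ⟨?_, ?_, ?_⟩
    · simp [hL, unitVec]
    · simp [hL, unitVec]
    · simp [hL, unitVec]; ring
  refine ⟨L, ?_, ?_⟩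
  · rw [← hasFDerivWithinAt_univ, hasFDerivWithinAt_euclidean]
    intro i
    rw [hasFDerivWithinAt_univ]
    fin_cases i
    · refine (hp 0).congr_fderiv ?_
      ext1 v; exact (hLc v).1.symm
    · refine (hp 1).congr_fderiv ?_
      ext1 v; exact (hLc v).2.1.symm
    · refine h2.congr_fderiv ?_
      ext1 v; exact (hLc v).2.2.symm
  · refine L.opNorm_le_bound (by norm_num) fun v => ?_
    refine (norm_le_sum_abs (L v)).trans ?_
    obtain ⟨e0, e1, e2⟩ := hLc v
    rw [e0, e1, e2, abs_mul]
    have t0 := abs_coord_le_norm v 0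
    have t1 := abs_coord_le_norm v 1
    have t2 := abs_coord_le_norm v 2
    nlinarith [abs_nonneg (v 2), abs_nonneg c]

/-- Folding is the identity above the plane `x₃ = 0` and the measure-preserving reflection below it;
the plane itself is null. -/
theorem lintegral_fold_zero_le (H : E3 → ℝ≥0∞) :
    ∫⁻ x, H (fold 0 x) ≤ 2 * ∫⁻ x in upperHalf, H x := by
  have h0 : ∀ x ∈ upperHalf, H (fold 0 x) = H x := by
    intro x hx
    have hx' : 0 < x 2 := hx
    congr 1
    ext i; fin_cases i <;> simp [fold, Real.sqrt_sq_eq_abs, abs_of_pos hx']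
  have h1 : ∀ x ∈ upperHalfᶜ, H (fold 0 x) = H (flipThird x) := by
    intro x hx
    have hx' : x 2 ≤ 0 := not_lt.1 hx
    congr 1
    rw [flipThird_apply]
    ext i; fin_cases i <;> simp [fold, Real.sqrt_sq_eq_abs, abs_of_nonpos hx']
  rw [← lintegral_add_compl _ measurableSet_upperHalf,
    setLIntegral_congr_fun measurableSet_upperHalf h0,
    setLIntegral_congr_fun measurableSet_upperHalf.compl h1, two_mul]
  refine add_le_add le_rfl ?_
  have hmp := flipThird.measurePreserving
  have hpre : (flipThird ⁻¹' upperHalf : Set E3) =ᵐ[volume] upperHalfᶜ := by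
    filter_upwards [ae_coord_ne_zero] with x hx
    apply propext
    change (0 < flipThird x 2) ↔ ¬ (0 < x 2)
    rw [flipThird_apply]
    simp only [Matrix.cons_val, not_lt]
    exact ⟨fun h => by linarith, fun h => by
      have := lt_of_le_of_ne h (hx 2); linarith⟩
  refine (setLIntegral_congr (f := fun x => H (flipThird x)) hpre.symm).trans_le ?_
  exact (hmp.setLIntegral_comp_preimage_emb
    flipThird.toHomeomorph.measurableEmbedding H upperHalf).le

/-- Sobolev's inequality on the half-space. -/
theorem exists_sobolev_upperHalf :
    ∃ C : ℝ≥0, ∀ g : E3 → ℝ, ContDiff ℝ 1 g → HasCompactSupport g →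
      ∫⁻ x in upperHalf, ‖g x‖ₑ ^ 6 ≤ C * (∫⁻ x in upperHalf, ‖fderiv ℝ g x‖ₑ ^ 2) ^ 3 := by
  obtain ⟨C, hC⟩ := exists_sobolev ℝ
  -- `18 = 9 · 2`: the square of the bound `3` for the derivative of the folding, times the two
  -- half-spaces that are folded together.
  refine ⟨C * 18 ^ 3, fun g hg hs => ?_⟩
  set δ : ℕ → ℝ := fun n => 1 / ((n : ℝ) + 1) with hδ
  have hδ0 : ∀ n, 0 < δ n := fun n => by positivity
  have hδt : Filter.Tendsto δ Filter.atTop (nhds 0) := tendsto_one_div_add_atTop_nhds_zero_nat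
  have hfold : ∀ x, Filter.Tendsto (fun n => fold (δ n) x) Filter.atTop (nhds (fold 0 x)) := by
    intro x
    have : Continuous fun d : ℝ => fold d x := by unfold fold; fun_prop
    exact this.continuousAt.tendsto.comp hδt
  have hgd : Continuous (fderiv ℝ g) := hg.continuous_fderiv (by simp)
  obtain ⟨R, hR⟩ := hs.isBounded.exists_norm_le
  obtain ⟨M, hM⟩ := hgd.bounded_above_of_compact_support (hs.fderiv ℝ)
  -- the folded functions
  have hstep : ∀ n, ∫⁻ x, ‖g (fold (δ n) x)‖ₑ ^ 6
      ≤ C * (9 * ∫⁻ x, ‖fderiv ℝ g (fold (δ n) x)‖ₑ ^ 2) ^ 3 := by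
    intro n
    have hfc : ContDiff ℝ 1 (fold (δ n)) := by
      rw [contDiff_euclidean]
      have hp : ∀ i : Fin 3, ContDiff ℝ 1 (fun y : E3 => y i) := fun i =>
        (EuclideanSpace.proj i : E3 →L[ℝ] ℝ).contDiff
      intro i
      fin_cases i
      · exact hp 0
      · exact hp 1
      · refine (((hp 2).pow 2).add contDiff_const).sqrt fun x => ?_
        have := hδ0 n
        positivity
    have hsupp : HasCompactSupport (fun x => g (fold (δ n) x)) := by
      refine HasCompactSupport.of_support_subset_isCompact (isCompact_closedBall (0 : E3) R)
        fun x hx => ?_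
      rw [mem_closedBall_zero_iff]
      exact (norm_le_norm_fold (δ n) x).trans (hR _ (subset_tsupport g hx))
    refine (hC _ (hg.comp hfc) hsupp).trans ?_
    gcongr
    rw [← lintegral_const_mul' _ _ (by simp)]
    refine lintegral_mono fun x => ?_
    obtain ⟨L, hL, hL3⟩ := hasFDerivAt_fold (hδ0 n) x
    have hd := ((hg.differentiable (by simp)) (fold (δ n) x)).hasFDerivAt.comp x hL
    have e : fderiv ℝ (g ∘ fold (δ n)) x = (fderiv ℝ g (fold (δ n) x)).comp L := hd.fderiv
    rw [e, ← ofReal_norm, ← ofReal_norm, ← ENNReal.ofReal_pow (norm_nonneg _),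
      ← ENNReal.ofReal_pow (norm_nonneg _)]
    have nine : ∀ y : ℝ, 9 * ENNReal.ofReal y = ENNReal.ofReal (9 * y) := fun y => by
      rw [ENNReal.ofReal_mul (by norm_num)]; simp
    rw [nine]
    apply ENNReal.ofReal_le_ofReal
    have h1 := ContinuousLinearMap.opNorm_comp_le (fderiv ℝ g (fold (δ n) x)) L
    have h2 : ‖(fderiv ℝ g (fold (δ n) x)).comp L‖ ≤ ‖fderiv ℝ g (fold (δ n) x)‖ * 3 :=
      h1.trans (by gcongr)
    calc _ ≤ (‖fderiv ℝ g (fold (δ n) x)‖ * 3) ^ 2 := by gcongr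
      _ = _ := by ring
  have hconv : Filter.Tendsto (fun n => ∫⁻ x, ‖fderiv ℝ g (fold (δ n) x)‖ₑ ^ 2) Filter.atTop
      (nhds (∫⁻ x, ‖fderiv ℝ g (fold 0 x)‖ₑ ^ 2)) := by
    refine tendsto_lintegral_of_dominated_convergence
      ((Metric.closedBall (0 : E3) R).indicator fun _ => ENNReal.ofReal (M ^ 2)) ?_ ?_ ?_ ?_
    · exact fun n => ((hgd.comp (continuous_fold _)).enorm.measurable).pow_const 2
    · intro n
      refine Filter.Eventually.of_forall fun x => ?_
      by_cases hx : x ∈ Metric.closedBall (0 : E3) R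
      · simp only [indicator_of_mem hx]
        rw [← ofReal_norm, ← ENNReal.ofReal_pow (norm_nonneg _)]
        apply ENNReal.ofReal_le_ofReal
        gcongr
        exact hM _
      · simp only [indicator_of_notMem hx]
        refine (enorm_fderiv_pow_eq_zero (fun h => hx ?_) two_ne_zero).le
        rw [mem_closedBall_zero_iff]
        exact (norm_le_norm_fold (δ n) x).trans (hR _ h)
    · rw [lintegral_indicator Metric.isClosed_closedBall.measurableSet, lintegral_const]
      exact (ENNReal.mul_lt_top ENNReal.ofReal_lt_top (by
        rw [Measure.restrict_apply_univ]; exact measure_closedBall_lt_top)).ne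
    · refine Filter.Eventually.of_forall fun x => ?_
      exact (ENNReal.continuous_pow 2).continuousAt.tendsto.comp
        ((hgd.continuousAt.tendsto.comp (hfold x)).enorm)
  have hlim : Filter.Tendsto (fun n => (C : ℝ≥0∞) * (9 * ∫⁻ x, ‖fderiv ℝ g (fold (δ n) x)‖ₑ ^ 2) ^ 3)
      Filter.atTop (nhds (C * (9 * ∫⁻ x, ‖fderiv ℝ g (fold 0 x)‖ₑ ^ 2) ^ 3)) := by
    refine ENNReal.Tendsto.const_mul ?_ (Or.inr ENNReal.coe_ne_top)
    exact (ENNReal.continuous_pow 3).continuousAt.tendsto.comp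
      (ENNReal.Tendsto.const_mul hconv (Or.inr (by simp)))
  calc ∫⁻ x in upperHalf, ‖g x‖ₑ ^ 6
      = ∫⁻ x in upperHalf, Filter.liminf (fun n => ‖g (fold (δ n) x)‖ₑ ^ 6) Filter.atTop := by
        refine setLIntegral_congr_fun measurableSet_upperHalf fun x hx => ?_
        have hx' : 0 < x 2 := hx
        have e : fold 0 x = x := by ext i; fin_cases i <;> simp [fold, Real.sqrt_sq_eq_abs, abs_of_pos hx']
        refine (Filter.Tendsto.liminf_eq ?_).symm
        have h3 := hg.continuous.continuousAt.tendsto.comp (hfold x)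
        rw [e] at h3
        exact (ENNReal.continuous_pow 6).continuousAt.tendsto.comp h3.enorm
    _ ≤ Filter.liminf (fun n => ∫⁻ x in upperHalf, ‖g (fold (δ n) x)‖ₑ ^ 6) Filter.atTop :=
        lintegral_liminf_le fun n =>
          ((hg.continuous.comp (continuous_fold _)).enorm.measurable).pow_const 6
    _ ≤ Filter.liminf (fun n => (C : ℝ≥0∞) * (9 * ∫⁻ x, ‖fderiv ℝ g (fold (δ n) x)‖ₑ ^ 2) ^ 3)
          Filter.atTop := Filter.liminf_le_liminf (Filter.Eventually.of_forall fun n =>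
            (setLIntegral_le_lintegral _ _).trans (hstep n))
    _ = C * (9 * ∫⁻ x, ‖fderiv ℝ g (fold 0 x)‖ₑ ^ 2) ^ 3 := hlim.liminf_eq
    _ ≤ C * (9 * (2 * ∫⁻ x in upperHalf, ‖fderiv ℝ g x‖ₑ ^ 2)) ^ 3 := by
        gcongr
        exact lintegral_fold_zero_le fun x => ‖fderiv ℝ g x‖ₑ ^ 2
    _ = _ := by
        push_cast
        rw [← mul_assoc, mul_pow, mul_assoc]
        norm_num

/-! ### Mollification and Sobolev's inequality near the flat bottom -/

/-- Jensen's inequality for the square of the norm of an average. -/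
theorem enorm_integral_smul_sq_le {X F : Type*} [MeasurableSpace X] {μ : Measure X}
    [NormedAddCommGroup F] [NormedSpace ℝ F] {k : X → ℝ} {u : X → F}
    (hk : AEMeasurable k μ) (hu : AEMeasurable (fun x => ‖u x‖ₑ) μ) (hk0 : ∀ x, 0 ≤ k x)
    (hk1 : ∫⁻ x, ENNReal.ofReal (k x) ∂μ ≤ 1) :
    ‖∫ x, k x • u x ∂μ‖ₑ ^ 2 ≤ ∫⁻ x, ENNReal.ofReal (k x) * ‖u x‖ₑ ^ 2 ∂μ := by
  have hkm : AEMeasurable (fun x => ENNReal.ofReal (k x)) μ := hk.ennreal_ofReal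
  -- The kernel is split as `k^(1/2) k^(1/2)`, so that the Cauchy-Schwarz inequality leaves one
  -- factor of mass at most `1`.
  have h1 : ‖∫ x, k x • u x ∂μ‖ₑ ≤ ∫⁻ x, ENNReal.ofReal (k x) ^ (1 / 2 : ℝ)
      * (ENNReal.ofReal (k x) * ‖u x‖ₑ ^ 2) ^ (1 / 2 : ℝ) ∂μ := by
    refine (enorm_integral_le_lintegral_enorm _).trans_eq (lintegral_congr fun x => ?_)
    rw [ENNReal.mul_rpow_of_nonneg _ _ (by norm_num), ← mul_assoc,
      ← ENNReal.rpow_add_of_nonneg _ _ (by norm_num) (by norm_num), ← ENNReal.rpow_natCast,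
      ← ENNReal.rpow_mul, enorm_smul, Real.enorm_of_nonneg (hk0 x)]
    norm_num
  have h2 : ‖∫ x, k x • u x ∂μ‖ₑ
      ≤ (∫⁻ x, ENNReal.ofReal (k x) * ‖u x‖ₑ ^ 2 ∂μ) ^ (1 / 2 : ℝ) := by
    refine h1.trans ?_
    have h := ENNReal.lintegral_mul_le_Lp_mul_Lq μ Real.HolderConjugate.two_two
      (hkm.pow_const (1 / 2 : ℝ)) ((hkm.mul (hu.pow_const 2)).pow_const (1 / 2 : ℝ))
    refine h.trans ?_
    have e : ∀ a : ℝ≥0∞, (a ^ (1 / 2 : ℝ)) ^ (2 : ℝ) = a := fun a => by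
      rw [← ENNReal.rpow_mul]; norm_num
    simp only [e]
    refine (mul_le_mul' (ENNReal.rpow_le_one hk1 (by norm_num)) le_rfl).trans ?_
    rw [one_mul]
    exact le_rfl
  calc ‖∫ x, k x • u x ∂μ‖ₑ ^ 2
      ≤ ((∫⁻ x, ENNReal.ofReal (k x) * ‖u x‖ₑ ^ 2 ∂μ) ^ (1 / 2 : ℝ)) ^ 2 := by gcongr
    _ = _ := by
      rw [← ENNReal.rpow_natCast, ← ENNReal.rpow_mul]; norm_num

/-- Averaging with a kernel of mass one does not increase the integral. -/
theorem lintegral_lintegral_kernel {k : E3 → ℝ} (hk : Measurable k)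
    (hk1 : ∫⁻ x, ENNReal.ofReal (k x) = 1) {Ω : Set E3} {H : E3 → ℝ≥0∞}
    (hH : AEMeasurable H (volume.restrict Ω)) (a : E3) :
    ∫⁻ x, ∫⁻ z in Ω, ENNReal.ofReal (k (x + a - z)) * H z = ∫⁻ z in Ω, H z := by
  rw [lintegral_lintegral_swap]
  · refine lintegral_congr fun z => ?_
    rw [lintegral_mul_const _ (by fun_prop)]
    have : ∀ x, x + a - z = x + (a - z) := fun x => by abel
    simp only [this]
    rw [lintegral_add_right_eq_self (fun x => ENNReal.ofReal (k x)), hk1, one_mul]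
  · refine AEMeasurable.mul ?_ hH.comp_snd
    have : Measurable fun p : E3 × E3 => k (p.1 + a - p.2) := by fun_prop
    exact this.ennreal_ofReal.aemeasurable

theorem mollified_eq_convolution {Ω : Set E3} (hΩ : MeasurableSet Ω) (k f : E3 → ℝ) :
    (fun x => ∫ z in Ω, k (x - z) • f z)
      = convolution k (Ω.indicator f) (ContinuousLinearMap.lsmul ℝ ℝ) volume := by
  ext x
  rw [convolution_eq_swap, ← integral_indicator hΩ]
  refine integral_congr_ae (.of_forall fun z => ?_)
  by_cases hz : z ∈ Ω <;> simp [hz]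

/-- The gradient of a mollified function is the mollified weak gradient, away from the boundary. -/
theorem hasFDerivAt_mollified {Ω : Set E3} (hΩ : MeasurableSet Ω) {f : E3 → ℝ} {G : E3 → E3}
    (hf : IntegrableOn f Ω) (hG : IntegrableOn G Ω) (hw : HasWeakGrad Ω f G)
    {k : E3 → ℝ} (hk : ContDiff ℝ (⊤ : ℕ∞) k) (hks : HasCompactSupport k) {y : E3}
    (hy : ∀ z, y - z ∈ tsupport k → z ∈ Ω) :
    HasFDerivAt (fun x => ∫ z in Ω, k (x - z) • f z)
      (innerSL ℝ (∫ z in Ω, k (y - z) • G z)) y := by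
  have hfi : Integrable (Ω.indicator f) := (integrable_indicator_iff hΩ).2 hf
  have hd := hks.hasFDerivAt_convolution_left (ContinuousLinearMap.lsmul ℝ ℝ)
    (hk.of_le (by exact_mod_cast le_top)) hfi.locallyIntegrable (μ := volume) y
  rw [mollified_eq_convolution hΩ]
  refine hd.congr_fderiv ?_
  have hkb : ∃ C, ∀ x, ‖k x‖ ≤ C := hk.continuous.bounded_above_of_compact_support hks
  obtain ⟨C, hC⟩ := hkb
  have hGi : Integrable (fun z => k (y - z) • G z) (volume.restrict Ω) :=
    hG.bdd_smul C (by
      have := hk.continuous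
      exact (by fun_prop : Continuous fun z => k (y - z)).aestronglyMeasurable)
      (.of_forall fun z => hC _)
  have hj : ∀ j, (convolution (fderiv ℝ k) (Ω.indicator f)
        ((ContinuousLinearMap.lsmul ℝ ℝ).precompL E3) volume y) (unitVec j)
      = (∫ z in Ω, k (y - z) • G z) j := by
    intro j
    -- Since the reflected kernel centred at `y` is supported in `Ω`, it is itself an admissible
    -- test function, and the definition of the weak gradient moves the derivative from the kernel
    -- to `f`.
    have hψ : IsTestOn Ω fun z => k (y - z) := by
      refine ⟨hk.comp (contDiff_const.sub contDiff_id), ?_, ?_⟩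
      · exact hks.comp_homeomorph (Homeomorph.subLeft y)
      · intro z hz
        refine hy z ?_
        have := tsupport_comp_subset_preimage k (Homeomorph.subLeft y).continuous hz
        exact this
    have hwj := hw.2.2 _ hψ j
    have hfd : ∀ z, fderiv ℝ (fun z => k (y - z)) z (unitVec j)
        = - fderiv ℝ k (y - z) (unitVec j) := by
      intro z
      have h1 := (hk.differentiable (by simp)) (y - z)
      have h2 : HasFDerivAt (fun z => k (y - z))
          ((fderiv ℝ k (y - z)).comp (-ContinuousLinearMap.id ℝ E3)) z :=
        h1.hasFDerivAt.comp z ((hasFDerivAt_id z).const_sub y)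
      rw [h2.fderiv]; simp
    simp only [hfd] at hwj
    have hR : (∫ z in Ω, k (y - z) • G z) j = ∫ z in Ω, G z j * k (y - z) := by
      have := (EuclideanSpace.proj j : E3 →L[ℝ] ℝ).integral_comp_comm hGi
      simp only [EuclideanSpace.coe_proj] at this
      rw [← this]
      refine integral_congr_ae (.of_forall fun z => ?_)
      simp [mul_comm]
    rw [hR, ← neg_eq_iff_eq_neg.2 hwj, ← integral_neg]
    have hL : (convolution (fderiv ℝ k) (Ω.indicator f)
        ((ContinuousLinearMap.lsmul ℝ ℝ).precompL E3) volume y) (unitVec j)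
        = ∫ z in Ω, fderiv ℝ k (y - z) (unitVec j) * f z := by
      rw [convolution_eq_swap]
      have hc : Continuous (fderiv ℝ k) := hk.continuous_fderiv (by simp)
      obtain ⟨C', hC'⟩ := hc.bounded_above_of_compact_support (hks.fderiv ℝ)
      have hint : Integrable fun t => ((ContinuousLinearMap.lsmul ℝ ℝ).precompL E3
          (fderiv ℝ k (y - t))) (Ω.indicator f t) := by
        have : (fun t => ((ContinuousLinearMap.lsmul ℝ ℝ).precompL E3
          (fderiv ℝ k (y - t))) (Ω.indicator f t))
            = fun t => Ω.indicator f t • fderiv ℝ k (y - t) := by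
          ext t v
          simp [ContinuousLinearMap.precompL_apply, mul_comm]
        rw [this]
        exact hfi.smul_bdd C' (by
          exact (by fun_prop : Continuous fun z => fderiv ℝ k (y - z)).aestronglyMeasurable)
          (.of_forall fun z => hC' _)
      rw [ContinuousLinearMap.integral_apply hint, ← integral_indicator hΩ]
      refine integral_congr_ae (.of_forall fun z => ?_)
      by_cases hz : z ∈ Ω <;> simp [hz, ContinuousLinearMap.precompL_apply]
    rw [hL]
    refine integral_congr_ae (.of_forall fun z => ?_)
    simp only []
    ring
  ext v
  rw [eq_sum_unitVec v, map_sum, map_sum]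
  refine Finset.sum_congr rfl fun j _ => ?_
  rw [map_smul, map_smul, hj]
  simp [unitVec, innerSL_apply_apply, EuclideanSpace.inner_single_right]

/-- A smooth cut-off for a flat box. -/
theorem exists_boxCutoff {r₀ ε : ℝ} (hr₀ : 0 < r₀) (hε : 0 < ε) :
    ∃ χ : E3 → ℝ, ContDiff ℝ 1 χ ∧ HasCompactSupport χ ∧
      (∀ x, axisDist x ≤ r₀ → |x 2| ≤ ε / 2 → χ x = 1) ∧
      ∀ x ∈ tsupport χ, axisDist x ≤ 3 / 2 * r₀ ∧ |x 2| ≤ 3 / 4 * ε := by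
  have hc2 : Continuous fun x : E3 => |x 2| := by fun_prop
  obtain ⟨f, h0, h1, -⟩ := exists_contMDiffMap_zero_one_of_isClosed (n := 1)
    (modelWithCornersSelf ℝ E3)
    (s := {x | 3 / 2 * r₀ ≤ axisDist x} ∪ {x | 3 / 4 * ε ≤ |x 2|})
    (t := {x | axisDist x ≤ r₀} ∩ {x | |x 2| ≤ ε / 2})
    ((isClosed_le continuous_const continuous_axisDist).union (isClosed_le continuous_const hc2))
    ((isClosed_le continuous_axisDist continuous_const).inter (isClosed_le hc2 continuous_const))
    (by
      rw [Set.disjoint_left]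
      rintro x hx ⟨h1, h2⟩
      simp only [mem_ofPred_eq] at h1 h2
      rcases hx with hx | hx <;> simp only [mem_ofPred_eq] at hx <;> linarith)
  have hsub : tsupport f ⊆ {x | axisDist x ≤ 3 / 2 * r₀} ∩ {x | |x 2| ≤ 3 / 4 * ε} := by
    refine closure_minimal (fun x hx => ?_)
      ((isClosed_le continuous_axisDist continuous_const).inter (isClosed_le hc2 continuous_const))
    by_contra hcon
    refine hx (h0 ?_)
    by_contra hcon2
    simp only [mem_union, mem_ofPred_eq, not_or, not_le] at hcon2
    exact hcon ⟨hcon2.1.le, hcon2.2.le⟩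
  refine ⟨f, f.contMDiff.contDiff, ?_, fun x h h' => h1 ⟨h, h'⟩, fun x hx => hsub hx⟩
  refine HasCompactSupport.of_support_subset_isCompact
    (isCompact_closedBall (0 : E3) (3 / 2 * r₀ + 3 / 2 * r₀ + 3 / 4 * ε)) fun x hx => ?_
  rw [mem_closedBall_zero_iff]
  have h := hsub (subset_tsupport _ hx)
  have h3 := norm_le_sum_abs x
  have a0 := abs_coord_zero_le_axisDist x
  have a1 := abs_coord_one_le_axisDist x
  have h4 : axisDist x ≤ 3 / 2 * r₀ := h.1
  have h5 : |x 2| ≤ 3 / 4 * ε := h.2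
  linarith

theorem measurableSet_tipZone (r₀ z₁ : ℝ) : MeasurableSet (tipZone r₀ z₁) := by
  refine (isClosed_le continuous_axisDist continuous_const).measurableSet.inter ?_
  have hc : Continuous fun x : E3 => x 2 := by fun_prop
  exact (isOpen_lt continuous_const hc).measurableSet.inter
    (isOpen_lt hc continuous_const).measurableSet

/-- Mollified functions, shifted into the container and cut off. -/
theorem lintegral_mollified_pow_six_le {Ω : Set E3} {r₀ ε : ℝ} (hr₀ : 0 < r₀) (hε : 0 < ε)
    (hΩ : MeasurableSet Ω)
    (hflat : ∀ x : E3, |x 0| ≤ 2 * r₀ → |x 1| ≤ 2 * r₀ → |x 2| < ε → (x ∈ Ω ↔ 0 < x 2)) :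
    ∃ C : ℝ≥0, ∀ f : E3 → ℝ, ∀ G : E3 → E3, IntegrableOn f Ω → IntegrableOn G Ω →
      HasWeakGrad Ω f G → ∀ δ, 0 < δ → δ ≤ ε / 16 → ∀ φ : ContDiffBump (0 : E3),
      φ.rOut < δ → φ.rOut ≤ r₀ / 4 →
      ∫⁻ x in tipZone r₀ (ε / 2), ‖∫ z in Ω, φ.normed volume (x + δ • e3 - z) • f z‖ₑ ^ 6
        ≤ C * (∫⁻ z in Ω, (‖f z‖ₑ ^ 2 + ‖G z‖ₑ ^ 2)) ^ 3 := by
  obtain ⟨C, hC⟩ := exists_sobolev_upperHalf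
  obtain ⟨χ, hχ, hχs, hχ1, hχ0⟩ := exists_boxCutoff hr₀ hε
  obtain ⟨M₁, hM₁⟩ := hχ.continuous.bounded_above_of_compact_support hχs
  obtain ⟨M₂, hM₂⟩ := (hχ.continuous_fderiv (by simp)).bounded_above_of_compact_support
    (hχs.fderiv ℝ)
  obtain ⟨M, hM⟩ : ∃ M, M = 2 * (M₁ ^ 2 + M₂ ^ 2) := ⟨_, rfl⟩
  refine ⟨C * M.toNNReal ^ 3, fun f G hf hG hw δ hδ hδε φ hφ hφr => ?_⟩
  obtain ⟨k, hk⟩ : ∃ k, k = φ.normed (volume : Measure E3) := ⟨_, rfl⟩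
  have hks : HasCompactSupport k := hk ▸ φ.hasCompactSupport_normed
  have hkd : ContDiff ℝ (⊤ : ℕ∞) k := hk ▸ φ.contDiff_normed
  have hk0 : ∀ x, 0 ≤ k x := fun x => hk ▸ φ.nonneg_normed x
  have hki : Integrable k := hkd.continuous.integrable_of_hasCompactSupport hks
  have hk1 : ∫⁻ x, ENNReal.ofReal (k x) = 1 := by
    rw [← ofReal_integral_eq_lintegral_ofReal hki (.of_forall hk0), hk, φ.integral_normed,
      ENNReal.ofReal_one]
  rw [← hk]
  obtain ⟨F, hF⟩ : ∃ F : E3 → ℝ, F = fun x => ∫ z in Ω, k (x - z) • f z := ⟨_, rfl⟩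
  have hfi : Integrable (Ω.indicator f) := (integrable_indicator_iff hΩ).2 hf
  have hFd : ContDiff ℝ 1 F := by
    rw [hF, mollified_eq_convolution hΩ]
    exact hks.contDiff_convolution_left (n := 1) _ (hkd.of_le (by exact_mod_cast le_top))
      hfi.locallyIntegrable
  obtain ⟨g, hg⟩ : ∃ g : E3 → ℝ, g = fun x => χ x * F (x + δ • e3) := ⟨_, rfl⟩
  have hsd : ContDiff ℝ 1 fun x : E3 => F (x + δ • e3) :=
    hFd.comp (contDiff_id.add contDiff_const)
  have hgd : ContDiff ℝ 1 g := hg ▸ hχ.mul hsd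
  have hgs : HasCompactSupport g := hg ▸ hχs.mul_right
  have hrest : ∀ y : E3, ∫⁻ z in Ω, ENNReal.ofReal (k (y - z)) ≤ 1 := by
    intro y
    refine (setLIntegral_le_lintegral _ _).trans_eq ?_
    rw [← hk1]
    exact lintegral_sub_left_eq_self (fun z => ENNReal.ofReal (k z)) y
  have hkm : ∀ y : E3, AEMeasurable (fun z => k (y - z)) (volume.restrict Ω) := fun y => by
    have := hkd.continuous
    exact (by fun_prop : Continuous fun z => k (y - z)).aemeasurable
  have hder : ∀ x ∈ upperHalf, ‖fderiv ℝ g x‖ₑ ^ 2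
      ≤ ENNReal.ofReal M * ∫⁻ z in Ω, ENNReal.ofReal (k (x + δ • e3 - z))
        * (‖f z‖ₑ ^ 2 + ‖G z‖ₑ ^ 2) := by
    intro x hx
    have hx0 : 0 < x 2 := hx
    by_cases hxs : x ∈ tsupport χ
    · obtain ⟨hr, h2⟩ := hχ0 x hxs
      rw [abs_of_pos hx0] at h2
      -- Shifting up by `δ` more than the kernel radius keeps the kernel above the bottom, while the
      -- bounds by `r₀/4` and `ε/16` keep it inside the box where `Ω` is the half-space.
      have hy : ∀ z, x + δ • e3 - z ∈ tsupport k → z ∈ Ω := by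
        intro z hz
        rw [hk, φ.tsupport_normed_eq, mem_closedBall_zero_iff] at hz
        have hc : ∀ i, |(x + δ • e3 - z) i| ≤ φ.rOut := fun i => (abs_coord_le_norm _ i).trans hz
        have c0 : |x 0 - z 0| ≤ φ.rOut := by simpa [e3, unitVec] using hc 0
        have c1 : |x 1 - z 1| ≤ φ.rOut := by simpa [e3, unitVec] using hc 1
        have c2 : |x 2 + δ - z 2| ≤ φ.rOut := by simpa [e3, unitVec] using hc 2
        have a0 := abs_coord_zero_le_axisDist x
        have a1 := abs_coord_one_le_axisDist x
        rw [abs_le] at a0 a1 c0 c1 c2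
        refine (hflat z (abs_le.2 ⟨?_, ?_⟩) (abs_le.2 ⟨?_, ?_⟩) (abs_lt.2 ⟨?_, ?_⟩)).2 ?_ <;>
          linarith
      have hd := hasFDerivAt_mollified hΩ hf hG hw hkd hks hy
      rw [← hF] at hd
      have hd' : HasFDerivAt (fun x : E3 => F (x + δ • e3))
          (innerSL ℝ (∫ z in Ω, k (x + δ • e3 - z) • G z)) x := by
        have hc : HasFDerivAt (fun x : E3 => x + δ • e3) (ContinuousLinearMap.id ℝ E3) x :=
          (hasFDerivAt_id x).add_const _
        exact (HasFDerivAt.comp (f := fun x : E3 => x + δ • e3) x hd hc).congr_fderiv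
          (ContinuousLinearMap.comp_id _)
      have hχd := (hχ.differentiable (by simp) x).hasFDerivAt
      have hgx := hχd.fun_mul hd'
      rw [hg, hgx.fderiv]
      have hn : ‖χ x • innerSL ℝ (∫ z in Ω, k (x + δ • e3 - z) • G z)
          + F (x + δ • e3) • fderiv ℝ χ x‖
          ≤ M₁ * ‖∫ z in Ω, k (x + δ • e3 - z) • G z‖ + M₂ * ‖F (x + δ • e3)‖ := by
        refine (norm_add_le _ _).trans (add_le_add ?_ ?_)
        · rw [norm_smul, innerSL_apply_norm]
          gcongr
          exact hM₁ x
        · rw [norm_smul, mul_comm]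
          gcongr
          exact hM₂ x
      have hn2 : ‖χ x • innerSL ℝ (∫ z in Ω, k (x + δ • e3 - z) • G z)
          + F (x + δ • e3) • fderiv ℝ χ x‖ ^ 2
          ≤ M * (‖F (x + δ • e3)‖ ^ 2 + ‖∫ z in Ω, k (x + δ • e3 - z) • G z‖ ^ 2) := by
        refine (pow_le_pow_left₀ (norm_nonneg _) hn 2).trans ?_
        obtain ⟨p, hp⟩ : ∃ p, p = ‖∫ z in Ω, k (x + δ • e3 - z) • G z‖ := ⟨_, rfl⟩
        obtain ⟨q, hq⟩ : ∃ q, q = ‖F (x + δ • e3)‖ := ⟨_, rfl⟩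
        rw [← hp, ← hq, hM]
        nlinarith [sq_nonneg (M₁ * p - M₂ * q), sq_nonneg (M₁ * q), sq_nonneg (M₂ * p),
          sq_nonneg (M₂ * q), sq_nonneg (M₁ * p)]
      have hJf : ‖F (x + δ • e3)‖ₑ ^ 2
          ≤ ∫⁻ z in Ω, ENNReal.ofReal (k (x + δ • e3 - z)) * ‖f z‖ₑ ^ 2 := by
        rw [hF]
        exact enorm_integral_smul_sq_le (hkm _) hf.1.enorm (fun z => hk0 _) (hrest _)
      have hJG : ‖∫ z in Ω, k (x + δ • e3 - z) • G z‖ₑ ^ 2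
          ≤ ∫⁻ z in Ω, ENNReal.ofReal (k (x + δ • e3 - z)) * ‖G z‖ₑ ^ 2 :=
        enorm_integral_smul_sq_le (hkm _) hG.1.enorm (fun z => hk0 _) (hrest _)
      simp only [mul_add]
      have hsum : ∫⁻ z in Ω, (ENNReal.ofReal (k (x + δ • e3 - z)) * ‖f z‖ₑ ^ 2
          + ENNReal.ofReal (k (x + δ • e3 - z)) * ‖G z‖ₑ ^ 2)
          = (∫⁻ z in Ω, ENNReal.ofReal (k (x + δ • e3 - z)) * ‖f z‖ₑ ^ 2)
            + ∫⁻ z in Ω, ENNReal.ofReal (k (x + δ • e3 - z)) * ‖G z‖ₑ ^ 2 :=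
        lintegral_add_left' ((hkm _).ennreal_ofReal.mul (hf.1.enorm.pow_const 2)) _
      rw [hsum]
      calc _ ≤ ENNReal.ofReal M * (‖F (x + δ • e3)‖ₑ ^ 2
            + ‖∫ z in Ω, k (x + δ • e3 - z) • G z‖ₑ ^ 2) := by
            rw [← ofReal_norm, ← ofReal_norm (F _), ← ofReal_norm (∫ z in Ω, _),
              ← ENNReal.ofReal_pow (norm_nonneg _), ← ENNReal.ofReal_pow (norm_nonneg _),
              ← ENNReal.ofReal_pow (norm_nonneg _),
              ← ENNReal.ofReal_add (by positivity) (by positivity),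
              ← ENNReal.ofReal_mul (by rw [hM]; positivity)]
            exact ENNReal.ofReal_le_ofReal hn2
        _ ≤ _ := by gcongr
    · have : x ∉ tsupport g := fun h => hxs (by
        rw [hg] at h
        exact (tsupport_mul_subset_left (f := χ)) h)
      rw [enorm_fderiv_pow_eq_zero this two_ne_zero]
      exact zero_le
  calc ∫⁻ x in tipZone r₀ (ε / 2), ‖∫ z in Ω, k (x + δ • e3 - z) • f z‖ₑ ^ 6
      ≤ ∫⁻ x in upperHalf, ‖g x‖ₑ ^ 6 := by
        have hsub : tipZone r₀ (ε / 2) ⊆ upperHalf := fun x hx => hx.2.1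
        refine le_trans (lintegral_mono_ae ?_)
          (lintegral_mono_set (f := fun x => ‖g x‖ₑ ^ 6) hsub)
        filter_upwards [ae_restrict_mem (measurableSet_tipZone _ _)] with x hx
        rw [hg, hF]
        simp only []
        rw [hχ1 x hx.1 (by rw [abs_of_pos hx.2.1]; exact hx.2.2.le), one_mul]
    _ ≤ C * (∫⁻ x in upperHalf, ‖fderiv ℝ g x‖ₑ ^ 2) ^ 3 := hC g hgd hgs
    _ ≤ C * (∫⁻ x, ENNReal.ofReal M * ∫⁻ z in Ω, ENNReal.ofReal (k (x + δ • e3 - z))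
        * (‖f z‖ₑ ^ 2 + ‖G z‖ₑ ^ 2)) ^ 3 := by
        have h : ∫⁻ x in upperHalf, ‖fderiv ℝ g x‖ₑ ^ 2
            ≤ ∫⁻ x, ENNReal.ofReal M * ∫⁻ z in Ω, ENNReal.ofReal (k (x + δ • e3 - z))
              * (‖f z‖ₑ ^ 2 + ‖G z‖ₑ ^ 2) := by
          refine le_trans (lintegral_mono_ae ?_) (setLIntegral_le_lintegral upperHalf _)
          filter_upwards [ae_restrict_mem measurableSet_upperHalf] with x hx using hder x hx
        gcongr
    _ = _ := by
        have hT : ∫⁻ x, ∫⁻ z in Ω, ENNReal.ofReal (k (x + δ • e3 - z))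
            * (‖f z‖ₑ ^ 2 + ‖G z‖ₑ ^ 2) = ∫⁻ z in Ω, (‖f z‖ₑ ^ 2 + ‖G z‖ₑ ^ 2) :=
          lintegral_lintegral_kernel hkd.continuous.measurable hk1
            ((hf.1.enorm.pow_const 2).add (hG.1.enorm.pow_const 2)) _
        rw [lintegral_const_mul' _ _ ENNReal.ofReal_ne_top, hT, mul_pow, ← mul_assoc]
        simp [ENNReal.ofReal]

/-- Sobolev's inequality in a flat box at the bottom of the container. -/
theorem exists_sobolev_tipZone {Ω : Set E3} {r₀ ε : ℝ} (hr₀ : 0 < r₀) (hε : 0 < ε)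
    (hΩ : MeasurableSet Ω) (hb : Bornology.IsBounded Ω)
    (hflat : ∀ x : E3, |x 0| ≤ 2 * r₀ → |x 1| ≤ 2 * r₀ → |x 2| < ε → (x ∈ Ω ↔ 0 < x 2)) :
    ∃ C : ℝ≥0, ∀ f : E3 → ℝ, ∀ G : E3 → E3, AEMeasurable f (volume.restrict Ω) →
      AEMeasurable G (volume.restrict Ω) → HasWeakGrad Ω f G →
      ∫⁻ x in tipZone r₀ (ε / 2), ‖f x‖ₑ ^ 6
        ≤ C * (∫⁻ z in Ω, (‖f z‖ₑ ^ 2 + ‖G z‖ₑ ^ 2)) ^ 3 := by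
  obtain ⟨C, hC⟩ := lintegral_mollified_pow_six_le hr₀ hε hΩ hflat
  -- The constant must not be zero: with `C + 1` the right side is `∞` when the norm of `(f, G)` is
  -- infinite, and the claim is then trivial.
  refine ⟨C + 1, fun f G hfm hGm hw => ?_⟩
  by_cases hfin : ∫⁻ z in Ω, (‖f z‖ₑ ^ 2 + ‖G z‖ₑ ^ 2) = ∞
  · rw [hfin, ENNReal.top_pow three_ne_zero, ENNReal.mul_top (by simp)]
    exact le_top
  have hvol : volume Ω < ∞ := hb.measure_lt_top
  have : IsFiniteMeasure (volume.restrict Ω) := ⟨by rwa [Measure.restrict_apply_univ]⟩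
  have hone : ∀ a : ℝ≥0∞, a ≤ 1 + a ^ 2 := by
    intro a
    rcases le_total a 1 with h | h
    · exact h.trans le_self_add
    · refine le_trans ?_ le_add_self
      calc a = a * 1 := (mul_one a).symm
        _ ≤ a * a := by gcongr
        _ = a ^ 2 := (sq a).symm
  have hint : ∀ {F : Type} [NormedAddCommGroup F] (u : E3 → F),
      AEStronglyMeasurable u (volume.restrict Ω) →
      (∀ z, ‖u z‖ₑ ^ 2 ≤ ‖f z‖ₑ ^ 2 + ‖G z‖ₑ ^ 2) → IntegrableOn u Ω := by
    intro F _ u hu h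
    refine ⟨hu, (lintegral_mono fun z => (hone ‖u z‖ₑ).trans (add_le_add_right (h z) 1)).trans_lt ?_⟩
    rw [lintegral_add_left measurable_const]
    refine ENNReal.add_lt_top.2 ⟨?_, lt_top_iff_ne_top.2 hfin⟩
    simpa using hvol
  have hf : IntegrableOn f Ω := hint f hfm.aestronglyMeasurable fun z => le_self_add
  have hG : IntegrableOn G Ω := hint G hGm.aestronglyMeasurable fun z => le_add_self
  have hfi : Integrable (Ω.indicator f) := (integrable_indicator_iff hΩ).2 hf
  -- a sequence of mollifiers
  have hshift : ∀ δ, 0 < δ → δ ≤ ε / 16 →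
      ∫⁻ x in tipZone r₀ (ε / 2), ‖Ω.indicator f (x + δ • e3)‖ₑ ^ 6
        ≤ C * (∫⁻ z in Ω, (‖f z‖ₑ ^ 2 + ‖G z‖ₑ ^ 2)) ^ 3 := by
    intro δ hδ hδε
    obtain ⟨c, hc⟩ : ∃ c, c = min δ (r₀ / 4) := ⟨_, rfl⟩
    have hc0 : 0 < c := by rw [hc]; positivity
    let φ : ℕ → ContDiffBump (0 : E3) := fun n =>
      ⟨c / 4 * (1 / ((n : ℝ) + 1)), c / 2 * (1 / ((n : ℝ) + 1)), by positivity, by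
        gcongr; linarith⟩
    have hn1 : ∀ n : ℕ, (1 / ((n : ℝ) + 1)) ≤ 1 := fun n => by
      rw [div_le_one (by positivity)]; linarith [(n.cast_nonneg : (0 : ℝ) ≤ n)]
    have hro : ∀ n, (φ n).rOut ≤ c / 2 := fun n => by
      change c / 2 * (1 / ((n : ℝ) + 1)) ≤ c / 2
      exact mul_le_of_le_one_right (by positivity) (hn1 n)
    have hrt : Filter.Tendsto (fun n => (φ n).rOut) Filter.atTop (nhds 0) := by
      have := (tendsto_one_div_add_atTop_nhds_zero_nat (𝕜 := ℝ)).const_mul (c / 2)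
      rwa [mul_zero] at this
    have hae := ContDiffBump.ae_convolution_tendsto_right_of_locallyIntegrable (φ := φ) (K := 2)
      hrt (.of_forall fun n => by
        change c / 2 * (1 / ((n : ℝ) + 1)) ≤ 2 * (c / 4 * (1 / ((n : ℝ) + 1)))
        linarith) hfi.locallyIntegrable (μ := volume)
    have hae' := (measurePreserving_add_right volume (δ • e3)).quasiMeasurePreserving.ae hae
    have hb' : ∀ n, ∫⁻ x in tipZone r₀ (ε / 2),
        ‖∫ z in Ω, (φ n).normed volume (x + δ • e3 - z) • f z‖ₑ ^ 6
          ≤ C * (∫⁻ z in Ω, (‖f z‖ₑ ^ 2 + ‖G z‖ₑ ^ 2)) ^ 3 := fun n => by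
      have h1 := hro n
      have h2 : c ≤ δ := hc ▸ min_le_left _ _
      have h3 : c ≤ r₀ / 4 := hc ▸ min_le_right _ _
      exact hC f G hf hG hw δ hδ hδε (φ n) (by linarith) (by linarith)
    calc ∫⁻ x in tipZone r₀ (ε / 2), ‖Ω.indicator f (x + δ • e3)‖ₑ ^ 6
        = ∫⁻ x in tipZone r₀ (ε / 2), Filter.liminf (fun n =>
            ‖∫ z in Ω, (φ n).normed volume (x + δ • e3 - z) • f z‖ₑ ^ 6) Filter.atTop := by
          refine lintegral_congr_ae (ae_restrict_of_ae ?_)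
          filter_upwards [hae'] with x hx
          refine (Filter.Tendsto.liminf_eq ?_).symm
          have h := fun n => congrFun (mollified_eq_convolution hΩ ((φ n).normed volume) f)
            (x + δ • e3)
          simp only [h]
          exact (ENNReal.continuous_pow 6).continuousAt.tendsto.comp hx.enorm
      _ ≤ Filter.liminf (fun n => ∫⁻ x in tipZone r₀ (ε / 2),
            ‖∫ z in Ω, (φ n).normed volume (x + δ • e3 - z) • f z‖ₑ ^ 6) Filter.atTop := by
          refine lintegral_liminf_le fun n => ?_
          have hcont : Continuous fun x => ∫ z in Ω, (φ n).normed volume (x - z) • f z := by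
            rw [mollified_eq_convolution hΩ]
            exact (φ n).hasCompactSupport_normed.continuous_convolution_left _
              (φ n).continuous_normed hfi.locallyIntegrable
          exact ((hcont.comp (continuous_add_const (δ • e3))).enorm.measurable).pow_const 6
      _ ≤ C * (∫⁻ z in Ω, (‖f z‖ₑ ^ 2 + ‖G z‖ₑ ^ 2)) ^ 3 :=
          Filter.liminf_le_of_frequently_le' (.of_forall hb')
  -- remove the shift
  obtain ⟨S, hS⟩ : ∃ S : ℕ → Set E3, S = fun n : ℕ => {x | axisDist x ≤ r₀ ∧
      ε / 16 * (1 / ((n : ℝ) + 1)) < x 2 ∧ x 2 < ε / 2} := ⟨_, rfl⟩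
  have hδp : ∀ n : ℕ, 0 < ε / 16 * (1 / ((n : ℝ) + 1)) := fun n => by positivity
  have hUn : tipZone r₀ (ε / 2) = ⋃ n, S n := by
    ext x
    rw [hS]
    simp only [mem_iUnion, mem_ofPred_eq, tipZone]
    constructor
    · rintro ⟨h1, h2, h3⟩
      have ht := (tendsto_one_div_add_atTop_nhds_zero_nat (𝕜 := ℝ)).const_mul (ε / 16)
      rw [mul_zero] at ht
      obtain ⟨n, hn⟩ := (ht.eventually_lt_const h2).exists
      exact ⟨n, h1, hn, h3⟩
    · rintro ⟨n, h1, h2, h3⟩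
      exact ⟨h1, (hδp n).trans h2, h3⟩
  have hdir : Directed (· ⊆ ·) S := by
    refine (monotone_nat_of_le_succ fun n => ?_).directed_le
    rw [hS]
    rintro x ⟨h1, h2, h3⟩
    refine ⟨h1, lt_of_le_of_lt ?_ h2, h3⟩
    push_cast
    gcongr
    linarith
  rw [hUn, setLIntegral_iUnion_of_directed _ hdir]
  refine iSup_le fun n => ?_
  refine le_trans ?_ ((hshift _ (hδp n) ?_).trans ?_)
  · obtain ⟨δ, hδ⟩ : ∃ δ, δ = ε / 16 * (1 / ((n : ℝ) + 1)) := ⟨_, rfl⟩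
    have hδ0 : 0 < δ := hδ ▸ hδp n
    rw [← hδ]
    have hm : MeasurableSet (S n) := by
      rw [hS]
      refine (isClosed_le continuous_axisDist continuous_const).measurableSet.inter ?_
      have hc : Continuous fun x : E3 => x 2 := by fun_prop
      exact (isOpen_lt continuous_const hc).measurableSet.inter
        (isOpen_lt hc continuous_const).measurableSet
    rw [← lintegral_indicator hm, ← lintegral_indicator (measurableSet_tipZone _ _),
      ← lintegral_add_right_eq_self _ (δ • e3)]
    refine lintegral_mono fun x => ?_
    by_cases hx : x + δ • e3 ∈ S n
    · rw [indicator_of_mem hx]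
      rw [hS] at hx
      simp only [← hδ] at hx
      have hx' : axisDist (x + δ • e3) ≤ r₀ ∧ δ < (x + δ • e3) 2 ∧ (x + δ • e3) 2 < ε / 2 := hx
      have ha : axisDist (x + δ • e3) = axisDist x := by simp [axisDist, e3, unitVec]
      have h2 : (x + δ • e3) 2 = x 2 + δ := by simp [e3, unitVec]
      rw [ha, h2] at hx'
      have hxt : x ∈ tipZone r₀ (ε / 2) := ⟨hx'.1, by linarith [hx'.2.1], by linarith [hx'.2.2]⟩
      rw [indicator_of_mem hxt, indicator_of_mem]
      have a0 := (abs_coord_zero_le_axisDist (x + δ • e3)).trans (ha.le.trans hx'.1)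
      have a1 := (abs_coord_one_le_axisDist (x + δ • e3)).trans (ha.le.trans hx'.1)
      refine (hflat _ (by linarith) (by linarith) ?_).2 ?_
      · rw [h2, abs_lt]; constructor <;> linarith [hx'.2.1, hx'.2.2]
      · rw [h2]; linarith [hx'.2.1]
    · rw [indicator_of_notMem hx]
      exact zero_le
  · refine mul_le_of_le_one_right (by positivity) ?_
    rw [div_le_one (by positivity)]; linarith [(n.cast_nonneg : (0 : ℝ) ≤ n)]
  · gcongr
    exact le_self_add

/-! ### Weighted integrals at a fixed time -/

/-- Hölder's inequality for three functions. -/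
theorem lintegral_mul_mul_le {X : Type*} [MeasurableSpace X] {μ : Measure X} {a b c : X → ℝ≥0∞}
    (ha : AEMeasurable a μ) (hb : AEMeasurable b μ) (hc : AEMeasurable c μ) {p q r : ℝ}
    (hp : 0 < p) (hq : 0 < q) (hr : 0 < r) (h : 1 / p + 1 / q + 1 / r = 1) :
    ∫⁻ x, a x * b x * c x ∂μ
      ≤ (∫⁻ x, a x ^ p ∂μ) ^ (1 / p) * (∫⁻ x, b x ^ q ∂μ) ^ (1 / q)
        * (∫⁻ x, c x ^ r ∂μ) ^ (1 / r) := by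
  have H := ENNReal.lintegral_prod_norm_pow_le (μ := μ) (Finset.univ : Finset (Fin 3))
    (f := ![fun x => a x ^ p, fun x => b x ^ q, fun x => c x ^ r]) (p := ![1 / p, 1 / q, 1 / r])
    (by
      intro i _
      fin_cases i
      · exact ha.pow_const p
      · exact hb.pow_const q
      · exact hc.pow_const r)
    (by rw [Fin.sum_univ_three]; exact h)
    (by
      intro i _
      fin_cases i
      · exact (by positivity : 0 ≤ 1 / p)
      · exact (by positivity : 0 ≤ 1 / q)
      · exact (by positivity : 0 ≤ 1 / r))
  simp only [Fin.prod_univ_three, Matrix.cons_val] at H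
  refine le_trans (lintegral_mono fun x => ?_) H
  have e : ∀ (t : ℝ≥0∞) {s : ℝ}, 0 < s → (t ^ s) ^ (1 / s) = t := fun t s hs => by
    rw [← ENNReal.rpow_mul, mul_one_div_cancel hs.ne', ENNReal.rpow_one]
  rw [e _ hp, e _ hq, e _ hr]

theorem lintegral_mul_le {X : Type*} [MeasurableSpace X] {μ : Measure X} {a b : X → ℝ≥0∞}
    (ha : AEMeasurable a μ) (hb : AEMeasurable b μ) {p q : ℝ} (h : p.HolderConjugate q) :
    ∫⁻ x, a x * b x ∂μ ≤ (∫⁻ x, a x ^ p ∂μ) ^ (1 / p) * (∫⁻ x, b x ^ q ∂μ) ^ (1 / q) :=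
  ENNReal.lintegral_mul_le_Lp_mul_Lq μ h ha hb

theorem lintegral_ofReal_add_le {X : Type*} [MeasurableSpace X] {μ : Measure X} {f : X → ℝ}
    (hf : AEMeasurable f μ) (g : X → ℝ) :
    ∫⁻ x, ENNReal.ofReal (f x + g x) ∂μ
      ≤ ∫⁻ x, ENNReal.ofReal (f x) ∂μ + ∫⁻ x, ENNReal.ofReal (g x) ∂μ := by
  rw [← lintegral_add_left' hf.ennreal_ofReal]
  exact lintegral_mono fun x => ENNReal.ofReal_add_le

theorem lintegral_ofReal_const_mul {X : Type*} [MeasurableSpace X] {μ : Measure X} {c : ℝ}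
    (hc : 0 ≤ c) (f : X → ℝ) :
    ∫⁻ x, ENNReal.ofReal (c * f x) ∂μ = ENNReal.ofReal c * ∫⁻ x, ENNReal.ofReal (f x) ∂μ := by
  rw [← lintegral_const_mul' _ _ ENNReal.ofReal_ne_top]
  exact lintegral_congr fun x => ENNReal.ofReal_mul hc

/-- A power of a product weight is again a product weight, with exponent `s p`, so everything
reduces to `s p < 1`. -/
theorem exists_lintegral_weight_rpow_le {Ω : Set E3} (hb : Bornology.IsBounded Ω) {s p : ℝ}
    (hp : 1 ≤ p) (hs : s * p < 1) :
    ∃ C : ℝ≥0, ∫⁻ x in Ω, ENNReal.ofReal (1 + singWeight s x) ^ p ≤ C := by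
  have hfin : ∫⁻ x in Ω, ENNReal.ofReal (1 + singWeight s x) ^ p < ∞ := by
    calc ∫⁻ x in Ω, ENNReal.ofReal (1 + singWeight s x) ^ p
        ≤ ∫⁻ x in Ω, 2 ^ (p - 1) * (1 + ENNReal.ofReal (singWeight (s * p) x)) := by
          refine lintegral_mono fun x => ?_
          rw [ENNReal.ofReal_add zero_le_one (singWeight_nonneg _ _)]
          refine (ENNReal.rpow_add_le_mul_rpow_add_rpow _ _ hp).trans_eq ?_
          rw [ENNReal.ofReal_rpow_of_nonneg (singWeight_nonneg _ _) (by linarith), singWeight_rpow]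
          simp
      _ < ∞ := by
          rw [lintegral_const_mul' _ _ (ENNReal.rpow_ne_top_of_nonneg (by linarith) (by simp)),
            lintegral_add_left measurable_const]
          refine ENNReal.mul_lt_top (ENNReal.rpow_lt_top_of_nonneg (by linarith) (by simp))
            (ENNReal.add_lt_top.2 ⟨?_, lintegral_singWeight_lt_top hs hb⟩)
          simpa using hb.measure_lt_top
  exact ⟨_, (ENNReal.coe_toNNReal hfin.ne).ge⟩

/-- Weighted mass of the fluid. -/
theorem exists_lintegral_density_weight_le {Ω : Set E3} (hb : Bornology.IsBounded Ω) {γ s : ℝ}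
    (hγ : 1 < γ) (hs : s * (γ / (γ - 1)) < 1) :
    ∃ C : ℝ≥0, ∀ F ⊆ Ω, ∀ ρ : E3 → ℝ, AEMeasurable ρ (volume.restrict F) →
      (∀ᵐ x ∂volume.restrict F, 0 ≤ ρ x) →
      ∫⁻ x in F, ENNReal.ofReal (ρ x * (1 + singWeight s x))
        ≤ C * (∫⁻ x in F, ENNReal.ofReal (ρ x ^ γ)) ^ (1 / γ) := by
  have hconj : γ.HolderConjugate (γ / (γ - 1)) := Real.HolderConjugate.conjExponent hγ
  obtain ⟨C, hC⟩ := exists_lintegral_weight_rpow_le hb hconj.symm.lt.le hs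
  refine ⟨(C : ℝ≥0) ^ (1 / (γ / (γ - 1))), fun F hF ρ hρ hρ0 => ?_⟩
  have hw : Measurable fun x : E3 => ENNReal.ofReal (1 + singWeight s x) :=
    (measurable_const.add (measurable_singWeight s)).ennreal_ofReal
  calc ∫⁻ x in F, ENNReal.ofReal (ρ x * (1 + singWeight s x))
      = ∫⁻ x in F, ENNReal.ofReal (ρ x) * ENNReal.ofReal (1 + singWeight s x) := by
        refine lintegral_congr fun x => ?_
        rw [ENNReal.ofReal_mul' (add_nonneg zero_le_one (singWeight_nonneg _ _))]
    _ ≤ _ := lintegral_mul_le hρ.ennreal_ofReal hw.aemeasurable hconj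
    _ = (∫⁻ x in F, ENNReal.ofReal (ρ x ^ γ)) ^ (1 / γ)
        * (∫⁻ x in F, ENNReal.ofReal (1 + singWeight s x) ^ (γ / (γ - 1))) ^ (1 / (γ / (γ - 1))) := by
        congr 2
        refine lintegral_congr_ae ?_
        filter_upwards [hρ0] with x hx
        rw [ENNReal.ofReal_rpow_of_nonneg hx (by linarith)]
    _ ≤ _ := by
        have h0 : 0 ≤ 1 / (γ / (γ - 1)) := by
          have := hconj.symm.pos; positivity
        rw [mul_comm, ENNReal.coe_rpow_of_nonneg _ h0]
        gcongr
        exact (lintegral_mono_set hF).trans hC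

/-- Weighted kinetic energy of the fluid. -/
theorem exists_lintegral_kinetic_weight_le {Ω : Set E3} (hΩ : MeasurableSet Ω)
    (hb : Bornology.IsBounded Ω) {γ s : ℝ}
    (hγ : 3 < γ) (hs : s * (3 * γ / (2 * γ - 3)) < 1) :
    ∃ C : ℝ≥0, ∀ F ⊆ Ω, ∀ (ρ : E3 → ℝ) (u : E3 → E3) (A : E3 → Mat3),
      AEMeasurable ρ (volume.restrict F) → (∀ᵐ x ∂volume.restrict F, 0 ≤ ρ x) → IsW012 Ω u A →
      ∫⁻ x in F, ENNReal.ofReal (ρ x * ‖u x‖ ^ 2 * (1 + singWeight s x))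
        ≤ C * (∫⁻ x in F, ENNReal.ofReal (ρ x ^ γ)) ^ (1 / γ)
          * ∫⁻ x in Ω, ENNReal.ofReal (‖u x‖ ^ 2 + ddot (A x) (A x)) := by
  have h23 : 0 < 2 * γ - 3 := by linarith
  have hp : 1 ≤ 3 * γ / (2 * γ - 3) := by rw [le_div_iff₀ h23]; linarith
  obtain ⟨C, hC⟩ := exists_lintegral_weight_rpow_le hb hp hs
  obtain ⟨C', hC'⟩ := exists_sobolev_W012
  refine ⟨C' ^ (1 / 3 : ℝ) * (C : ℝ≥0) ^ (1 / (3 * γ / (2 * γ - 3))),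
    fun F hF ρ u A hρ hρ0 hu => ?_⟩
  have hw : Measurable fun x : E3 => ENNReal.ofReal (1 + singWeight s x) :=
    (measurable_const.add (measurable_singWeight s)).ennreal_ofReal
  have hum : AEMeasurable (fun x => ‖u x‖ₑ) (volume.restrict F) :=
    hu.1.1.enorm.mono_measure (Measure.restrict_mono hF le_rfl)
  have e3 : ∀ t : ℝ≥0∞, (t ^ 2) ^ (3 : ℝ) = t ^ 6 := fun t => by
    rw [← ENNReal.rpow_natCast, ← ENNReal.rpow_natCast, ← ENNReal.rpow_mul]; norm_num
  calc ∫⁻ x in F, ENNReal.ofReal (ρ x * ‖u x‖ ^ 2 * (1 + singWeight s x))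
      = ∫⁻ x in F, ENNReal.ofReal (ρ x) * ‖u x‖ₑ ^ 2 * ENNReal.ofReal (1 + singWeight s x) := by
        refine lintegral_congr fun x => ?_
        rw [ENNReal.ofReal_mul' (add_nonneg zero_le_one (singWeight_nonneg _ _)),
          ENNReal.ofReal_mul' (by positivity), ENNReal.ofReal_pow (norm_nonneg _), ofReal_norm]
    -- The density takes the exponent `γ` and `|u|²` takes `3` because `u ∈ L⁶`; the weight is left
    -- with `1 - 1/γ - 1/3 = (2γ-3)/(3γ)`.
    _ ≤ _ := lintegral_mul_mul_le (p := γ) (q := 3) (r := 3 * γ / (2 * γ - 3))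
        hρ.ennreal_ofReal (hum.pow_const 2) hw.aemeasurable (by linarith) (by norm_num)
        (by linarith) (by field_simp; ring)
    _ = (∫⁻ x in F, ENNReal.ofReal (ρ x ^ γ)) ^ (1 / γ) * (∫⁻ x in F, ‖u x‖ₑ ^ 6) ^ (1 / 3 : ℝ)
        * (∫⁻ x in F, ENNReal.ofReal (1 + singWeight s x) ^ (3 * γ / (2 * γ - 3)))
          ^ (1 / (3 * γ / (2 * γ - 3))) := by
        simp only [e3]
        congr 3
        refine lintegral_congr_ae ?_
        filter_upwards [hρ0] with x hx
        rw [ENNReal.ofReal_rpow_of_nonneg hx (by linarith)]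
    _ ≤ (∫⁻ x in F, ENNReal.ofReal (ρ x ^ γ)) ^ (1 / γ)
        * (C' * (∫⁻ x in Ω, ENNReal.ofReal (‖u x‖ ^ 2 + ddot (A x) (A x))) ^ 3) ^ (1 / 3 : ℝ)
        * C ^ (1 / (3 * γ / (2 * γ - 3))) := by
        gcongr
        · exact (lintegral_mono_set hF).trans (hC' Ω u A hΩ hu)
        · exact (lintegral_mono_set hF).trans hC
    _ = _ := by
        rw [ENNReal.mul_rpow_of_nonneg _ _ (by norm_num), ENNReal.coe_mul,
          ENNReal.coe_rpow_of_nonneg _ (by norm_num), ENNReal.coe_rpow_of_nonneg _ (by positivity),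
          ← ENNReal.rpow_natCast, ← ENNReal.rpow_mul]
        norm_num
        ring

/-- Weighted square of the temperature `θ = f^(2/β)` in the flat box. -/
theorem exists_lintegral_temperature_weight_le {Ω : Set E3} {r₀ ε : ℝ} (hr₀ : 0 < r₀) (hε : 0 < ε)
    (hΩ : MeasurableSet Ω) (hb : Bornology.IsBounded Ω)
    (hflat : ∀ x : E3, |x 0| ≤ 2 * r₀ → |x 1| ≤ 2 * r₀ → |x 2| < ε → (x ∈ Ω ↔ 0 < x 2))
    (htip : tipZone r₀ (ε / 2) ⊆ Ω) {β s : ℝ}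
    (hβ : 2 < β) (hs : s * (6 * β / (3 * β - 2)) < 1) :
    ∃ C : ℝ≥0, ∀ (θ : E3 → ℝ) (G : E3 → E3), AEMeasurable θ (volume.restrict Ω) →
      AEMeasurable G (volume.restrict Ω) → (∀ᵐ x ∂volume.restrict Ω, 0 < θ x) →
      HasWeakGrad Ω (fun x => θ x ^ (β / 2)) G →
      ∫⁻ x in tipZone r₀ (ε / 2), ENNReal.ofReal (θ x ^ 2 * singWeight s x ^ 2)
        ≤ C * (1 + ∫⁻ x in Ω, ENNReal.ofReal ((θ x ^ (β / 2)) ^ 2 + ‖G x‖ ^ 2)) := by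
  have h32 : 0 < 3 * β - 2 := by linarith
  have hs' : 2 * s * (3 * β / (3 * β - 2)) < 1 := by
    convert hs using 1; ring
  obtain ⟨C, hC⟩ := exists_sobolev_tipZone hr₀ hε hΩ hb hflat
  have hI : ∫⁻ x in Ω, ENNReal.ofReal (singWeight (2 * s * (3 * β / (3 * β - 2))) x) < ∞ :=
    lintegral_singWeight_lt_top hs' hb
  obtain ⟨I, hIdef⟩ : ∃ I : ℝ≥0, ∫⁻ x in Ω,
      ENNReal.ofReal (singWeight (2 * s * (3 * β / (3 * β - 2))) x) = I :=
    ⟨_, (ENNReal.coe_toNNReal hI.ne).symm⟩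
  -- The exponent `3β/2` is the one for which `(θ²)^(3β/2) = (θ^(β/2))⁶`, the power controlled by
  -- Sobolev's inequality.
  have hconj : (3 * β / 2).HolderConjugate (3 * β / (3 * β - 2)) := by
    rw [Real.holderConjugate_iff]
    refine ⟨by linarith, ?_⟩
    field_simp; ring
  have hq0 : 0 < 3 * β / (3 * β - 2) := hconj.symm.pos
  refine ⟨C ^ (1 / (3 * β / 2)) * (I : ℝ≥0) ^ (1 / (3 * β / (3 * β - 2))),
    fun θ G hθ hG hθ0 hw => ?_⟩
  have hr : volume.restrict (tipZone r₀ (ε / 2)) ≤ volume.restrict Ω :=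
    Measure.restrict_mono htip le_rfl
  have hwm : Measurable fun x : E3 => ENNReal.ofReal (singWeight s x ^ 2) :=
    ((measurable_singWeight s).pow_const 2).ennreal_ofReal
  have hSob := hC _ G (hθ.pow_const (β / 2)) hG hw
  have hY : ∫⁻ z in Ω, (‖θ z ^ (β / 2)‖ₑ ^ 2 + ‖G z‖ₑ ^ 2)
      = ∫⁻ x in Ω, ENNReal.ofReal ((θ x ^ (β / 2)) ^ 2 + ‖G x‖ ^ 2) := by
    refine lintegral_congr fun x => ?_
    rw [ENNReal.ofReal_add (by positivity) (by positivity), ENNReal.ofReal_pow (norm_nonneg _),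
      ofReal_norm, ← ofReal_norm, ← ENNReal.ofReal_pow (norm_nonneg _), Real.norm_eq_abs, sq_abs]
  rw [hY] at hSob
  obtain ⟨Y, hYdef⟩ : ∃ Y, Y = ∫⁻ x in Ω, ENNReal.ofReal ((θ x ^ (β / 2)) ^ 2 + ‖G x‖ ^ 2) :=
    ⟨_, rfl⟩
  rw [← hYdef] at hSob ⊢
  calc ∫⁻ x in tipZone r₀ (ε / 2), ENNReal.ofReal (θ x ^ 2 * singWeight s x ^ 2)
      = ∫⁻ x in tipZone r₀ (ε / 2), ENNReal.ofReal (θ x ^ 2) * ENNReal.ofReal (singWeight s x ^ 2) := by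
        refine lintegral_congr fun x => ?_
        rw [ENNReal.ofReal_mul (by positivity)]
    _ ≤ _ := lintegral_mul_le ((hθ.mono_measure hr).pow_const 2).ennreal_ofReal
        hwm.aemeasurable hconj
    _ = (∫⁻ x in tipZone r₀ (ε / 2), ‖θ x ^ (β / 2)‖ₑ ^ 6) ^ (1 / (3 * β / 2))
        * (∫⁻ x in tipZone r₀ (ε / 2),
            ENNReal.ofReal (singWeight (2 * s * (3 * β / (3 * β - 2))) x))
          ^ (1 / (3 * β / (3 * β - 2))) := by
        congr 2
        · refine lintegral_congr_ae ?_
          filter_upwards [ae_mono hr hθ0] with x hx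
          rw [ENNReal.ofReal_rpow_of_nonneg (by positivity) (by linarith),
            Real.enorm_of_nonneg (by positivity), ← ENNReal.ofReal_pow (by positivity),
            ← Real.rpow_natCast, ← Real.rpow_natCast, ← Real.rpow_mul hx.le, ← Real.rpow_mul hx.le]
          congr 2
          push_cast
          ring
        · refine lintegral_congr fun x => ?_
          rw [ENNReal.ofReal_rpow_of_nonneg (by positivity) hq0.le, ← Real.rpow_natCast,
            singWeight_rpow, singWeight_rpow]
          congr 2
          push_cast
          ring
    _ ≤ (C * Y ^ 3) ^ (1 / (3 * β / 2)) * I ^ (1 / (3 * β / (3 * β - 2))) := by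
        gcongr
        rw [← hIdef]
        exact lintegral_mono_set htip
    _ ≤ _ := by
        -- The resulting power of `Y` is `2/β ≤ 1`. A bound linear in `Y` is needed because only the
        -- time integral of `Y` is controlled.
        have hYp : (Y ^ 3) ^ (1 / (3 * β / 2)) ≤ 1 + Y := by
          rw [← ENNReal.rpow_natCast, ← ENNReal.rpow_mul]
          have he : ((3 : ℕ) : ℝ) * (1 / (3 * β / 2)) = 2 / β := by
            push_cast; field_simp
          rw [he]
          have hb1 : 2 / β ≤ 1 := by rw [div_le_one (by linarith)]; linarith
          rcases le_total Y 1 with h | h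
          · exact (ENNReal.rpow_le_one h (by positivity)).trans le_self_add
          · exact ((ENNReal.rpow_le_rpow_of_exponent_le h hb1).trans_eq (ENNReal.rpow_one _)).trans
              le_add_self
        rw [ENNReal.mul_rpow_of_nonneg _ _ (by positivity), ENNReal.coe_mul,
          ENNReal.coe_rpow_of_nonneg _ (by positivity), ENNReal.coe_rpow_of_nonneg _ (by positivity)]
        calc _ ≤ (C : ℝ≥0∞) ^ (1 / (3 * β / 2)) * (1 + Y) * I ^ (1 / (3 * β / (3 * β - 2))) := by
              gcongr
          _ = _ := by ring

/-! ### Estimates for the momentum integrand -/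

theorem abs_entry_le_sqrt_ddot (A : Mat3) (i j : Fin 3) : |A i j| ≤ √(ddot A A) := by
  refine Real.abs_le_sqrt ?_
  unfold ddot
  rw [sq]
  refine le_trans ?_ (Finset.single_le_sum (f := fun i => ∑ j, A i j * A i j)
    (fun i _ => Finset.sum_nonneg fun j _ => mul_self_nonneg _) (Finset.mem_univ i))
  exact Finset.single_le_sum (f := fun j => A i j * A i j)
    (fun j _ => mul_self_nonneg _) (Finset.mem_univ j)

theorem abs_ddot_le {A J : Mat3} {a b : ℝ} (hA : ∀ i j, |A i j| ≤ a) (hJ : ∀ i j, |J i j| ≤ b) :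
    |ddot A J| ≤ 9 * (a * b) := by
  have ha : 0 ≤ a := (abs_nonneg _).trans (hA 0 0)
  unfold ddot
  calc |∑ i, ∑ j, A i j * J i j| ≤ ∑ i : Fin 3, ∑ j : Fin 3, a * b := by
        refine (Finset.abs_sum_le_sum_abs _ _).trans (Finset.sum_le_sum fun i _ => ?_)
        refine (Finset.abs_sum_le_sum_abs _ _).trans (Finset.sum_le_sum fun j _ => ?_)
        rw [abs_mul]
        exact mul_le_mul (hA i j) (hJ i j) (abs_nonneg _) ha
    _ = 9 * (a * b) := by simp; ring

/-- Linear growth of the stress in the temperature and the velocity gradient. -/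
theorem FluidModel.Admissible.exists_abs_stress_le {M : FluidModel} (hM : M.Admissible) :
    ∃ C, 0 < C ∧ ∀ θ > 0, ∀ A i j, |M.stress θ A i j| ≤ C * ((1 + θ) * √(ddot A A)) := by
  obtain ⟨L, hL⟩ := hM.μ_lipschitz
  obtain ⟨c, hc⟩ := hM.η_upper
  obtain ⟨Cμ, hCμ⟩ : ∃ Cμ : ℝ, Cμ = |M.μ 1| + L := ⟨_, rfl⟩
  have hCμ0 : 0 ≤ Cμ := by rw [hCμ]; positivity
  have hc0 : 0 ≤ c := by
    have h1 := hM.η_nonneg 1 one_pos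
    have h2 := hc 1 one_pos
    nlinarith
  refine ⟨4 * Cμ + 3 * c + 1, by positivity, fun θ hθ A i j => ?_⟩
  have hμ : |M.μ θ| ≤ Cμ * (1 + θ) := by
    have h1 := hL.dist_le_mul θ hθ 1 (mem_Ioi.2 one_pos)
    rw [Real.dist_eq, Real.dist_eq] at h1
    have h2 : |θ - 1| ≤ 1 + θ := abs_le.2 ⟨by linarith, by linarith⟩
    have h3 : |M.μ θ| ≤ |M.μ 1| + |M.μ θ - M.μ 1| := by
      have := abs_add_le (M.μ 1) (M.μ θ - M.μ 1)
      simpa using this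
    have h4 : (L : ℝ) * |θ - 1| ≤ L * (1 + θ) := by gcongr
    have h5 : |M.μ 1| ≤ |M.μ 1| * (1 + θ) := le_mul_of_one_le_right (abs_nonneg _) (by linarith)
    rw [hCμ]; linarith
  have hη : |M.η θ| ≤ c * (1 + θ) := by
    rw [abs_of_nonneg (hM.η_nonneg θ hθ)]; exact hc θ hθ
  obtain ⟨a, ha⟩ : ∃ a, a = √(ddot A A) := ⟨_, rfl⟩
  have ha0 : 0 ≤ a := ha ▸ Real.sqrt_nonneg _
  have hA : ∀ i j, |A i j| ≤ a := fun i j => ha ▸ abs_entry_le_sqrt_ddot A i j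
  have htr : |A.trace| ≤ 3 * a := by
    rw [Matrix.trace_fin_three]
    have := abs_add_three (A 0 0) (A 1 1) (A 2 2)
    linarith [hA 0 0, hA 1 1, hA 2 2]
  have hone : |(1 : Mat3) i j| ≤ 1 := by
    rw [Matrix.one_apply]; split_ifs <;> simp
  have hdev : |(1 / 2 : ℝ) * (A i j + A j i) - A.trace / 3 * (1 : Mat3) i j| ≤ 2 * a := by
    have e1 : |(1 / 2 : ℝ) * (A i j + A j i)| ≤ a := by
      rw [abs_mul, abs_of_pos (by norm_num : (0 : ℝ) < 1 / 2)]
      linarith [abs_add_le (A i j) (A j i), hA i j, hA j i]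
    have e2 : |A.trace / 3 * (1 : Mat3) i j| ≤ a := by
      rw [abs_mul, abs_div, abs_of_pos (by norm_num : (0 : ℝ) < 3)]
      calc |A.trace| / 3 * |(1 : Mat3) i j| ≤ (3 * a) / 3 * 1 := by gcongr
        _ = a := by ring
    have := abs_sub ((1 / 2 : ℝ) * (A i j + A j i)) (A.trace / 3 * (1 : Mat3) i j)
    linarith
  rw [← ha]
  have hS : M.stress θ A i j = 2 * M.μ θ * ((1 / 2 : ℝ) * (A i j + A j i)
      - A.trace / 3 * (1 : Mat3) i j) + M.η θ * A.trace * (1 : Mat3) i j := by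
    simp only [FluidModel.stress, Matrix.add_apply, Matrix.sub_apply, Matrix.smul_apply,
      Matrix.transpose_apply, smul_eq_mul]
  rw [hS]
  calc _ ≤ |2 * M.μ θ * ((1 / 2 : ℝ) * (A i j + A j i) - A.trace / 3 * (1 : Mat3) i j)|
        + |M.η θ * A.trace * (1 : Mat3) i j| := abs_add_le _ _
    _ = 2 * |M.μ θ| * |(1 / 2 : ℝ) * (A i j + A j i) - A.trace / 3 * (1 : Mat3) i j|
        + |M.η θ| * |A.trace| * |(1 : Mat3) i j| := by
        rw [abs_mul, abs_mul, abs_mul, abs_mul, abs_two]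
    _ ≤ 2 * (Cμ * (1 + θ)) * (2 * a) + c * (1 + θ) * (3 * a) * 1 := by gcongr
    _ ≤ (4 * Cμ + 3 * c + 1) * ((1 + θ) * a) := by
        have : 0 ≤ (1 + θ) * a := by positivity
        nlinarith

/-- The integrand of the momentum equation. -/
noncomputable def momentumDensity (M : FluidModel) (g ρ θ : ℝ) (u : E3) (A : Mat3)
    (P : E3) (J : Mat3) (Φ : E3) : ℝ :=
  ρ * inner ℝ u P + ρ * ddot (fun i j => u i * u j) J + M.pressure ρ θ * J.trace
    - ddot (M.stress θ A) J + ρ * inner ℝ (-g • e3) Φ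

theorem norm_e3 : ‖e3‖ = 1 := by simp [e3, unitVec]

set_option maxHeartbeats 800000 in
/-- Pointwise bound for the momentum integrand. Here `w`, `n` bound the test function and its
derivatives, and `z` is the square of the singular part of `n`. -/
theorem exists_abs_momentumDensity_le {M : FluidModel} (hM : M.Admissible) (hβ : 2 < M.β) {g C : ℝ}
    (hg : 0 < g) (hC : 0 < C) :
    ∃ C₁, 0 < C₁ ∧ ∀ (ρ θ : ℝ) (u : E3) (A : Mat3) (P : E3) (J : Mat3) (Φ : E3)
      (lam v σ Q w n N Z : ℝ), 0 ≤ ρ → 0 < θ → 0 ≤ lam → 0 ≤ v → 0 < σ → v ^ 2 ≤ σ ^ 2 * Q →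
      0 ≤ w → 0 ≤ n → n ≤ N → n ^ 2 ≤ 2 * (1 + Z) → 0 ≤ Z →
      ‖P‖ ≤ C * (lam * w + v * n) → ‖Φ‖ ≤ C * w → (∀ i j, |J i j| ≤ C * n) → J.trace = 0 →
      |momentumDensity M g ρ θ u A P J Φ| ≤ C₁ * (lam * (ρ * ‖u‖ ^ 2)
        + ((lam + 1) * (ρ * (1 + w ^ 2)) + (σ * Q * (ρ * N) + ((σ + 1) * (ρ * ‖u‖ ^ 2 * N)
        + ((‖u‖ ^ 2 + ddot A A) + ((2 + Z) + ((θ ^ (M.β / 2)) ^ 2 + θ ^ 2 * Z))))))) := by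
  obtain ⟨Cs, hCs, hS⟩ := hM.exists_abs_stress_le
  refine ⟨C * (2 + 9 + 36 * Cs + g), by positivity, ?_⟩
  intro ρ θ u A P J Φ lam v σ Q w n N Z hρ hθ hlam hv hσ hvQ hw hn hnN hnZ hZ hP hΦ hJ htr
  obtain ⟨U, hU⟩ : ∃ U, U = ‖u‖ := ⟨_, rfl⟩
  have hU0 : 0 ≤ U := hU ▸ norm_nonneg _
  have hQ : 0 ≤ Q := by
    have : 0 ≤ σ ^ 2 * Q := (sq_nonneg v).trans hvQ
    exact nonneg_of_mul_nonneg_right this (by positivity)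
  have hdd : 0 ≤ ddot A A := ddot_self_nonneg A
  obtain ⟨a, ha⟩ : ∃ a, a = √(ddot A A) := ⟨_, rfl⟩
  have ha0 : 0 ≤ a := ha ▸ Real.sqrt_nonneg _
  have ha2 : a ^ 2 = ddot A A := by rw [ha, Real.sq_sqrt hdd]
  have t1 : |ρ * inner ℝ u P| ≤ C * (lam * (ρ * (U * w)) + ρ * (v * U) * N) := by
    rw [abs_mul, abs_of_nonneg hρ]
    have := abs_real_inner_le_norm u P
    calc ρ * |inner ℝ u P| ≤ ρ * (U * (C * (lam * w + v * n))) := by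
          rw [hU]; gcongr; exact this.trans (by gcongr)
      _ ≤ ρ * (U * (C * (lam * w + v * N))) := by gcongr
      _ = _ := by ring
  have t2 : |ρ * ddot (fun i j => u i * u j) J| ≤ C * 9 * (ρ * U ^ 2 * N) := by
    rw [abs_mul, abs_of_nonneg hρ]
    have h := abs_ddot_le (A := fun i j => u i * u j) (a := U ^ 2) (J := J) (b := C * n)
      (fun i j => by
        rw [abs_mul, sq, hU]
        exact mul_le_mul (abs_coord_le_norm _ _) (abs_coord_le_norm _ _) (abs_nonneg _)
          (norm_nonneg _)) hJ
    calc _ ≤ ρ * (9 * (U ^ 2 * (C * n))) := by gcongr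
      _ ≤ ρ * (9 * (U ^ 2 * (C * N))) := by gcongr
      _ = _ := by ring
  have t4 : |ddot (M.stress θ A) J| ≤ C * (9 * Cs) * ((1 + θ) * a * n) := by
    have h := abs_ddot_le (fun i j => hS θ hθ A i j) hJ
    rw [← ha] at h
    refine h.trans_eq ?_
    ring
  have t5 : |ρ * inner ℝ (-g • e3) Φ| ≤ C * g * (ρ * w) := by
    rw [abs_mul, abs_of_nonneg hρ]
    have h := abs_real_inner_le_norm (-g • e3) Φ
    rw [norm_smul, norm_e3, Real.norm_eq_abs, abs_neg, abs_of_pos hg, mul_one] at h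
    calc _ ≤ ρ * (g * (C * w)) := by gcongr; exact h.trans (by gcongr)
      _ = _ := by ring
  have k1 : U * w ≤ U ^ 2 + (1 + w ^ 2) := by nlinarith [sq_nonneg (U - w)]
  -- Young's inequality with parameter `σ`: as the speed satisfies `v ≤ σ √Q`, both resulting terms
  -- retain the factor `σ`, small for a heavy solid.
  have k2 : v * U ≤ σ * Q + σ * U ^ 2 := by
    have h1 : (v / σ) ^ 2 ≤ Q := by
      rw [div_pow, div_le_iff₀ (by positivity)]; linarith
    have h2 : v / σ * U ≤ Q + U ^ 2 := by nlinarith [sq_nonneg (v / σ - U), sq_nonneg U]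
    calc v * U = σ * (v / σ * U) := by field_simp
      _ ≤ σ * (Q + U ^ 2) := by gcongr
      _ = _ := by ring
  have k3 : w ≤ 1 + w ^ 2 := by nlinarith [sq_nonneg (w - 1)]
  -- Where the test field is regular, `θ²` is controlled by `θ^β` because `β > 2`.
  have kf : θ ^ 2 ≤ 1 + (θ ^ (M.β / 2)) ^ 2 := by
    rw [← Real.rpow_natCast (θ ^ _), ← Real.rpow_mul hθ.le, ← Real.rpow_natCast]
    push_cast
    rcases le_total θ 1 with h | h
    · have h1 : θ ^ (2 : ℝ) ≤ 1 := Real.rpow_le_one hθ.le h (by norm_num)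
      have h2 : 0 ≤ θ ^ (M.β / 2 * 2) := by positivity
      linarith
    · have h1 : θ ^ (2 : ℝ) ≤ θ ^ (M.β / 2 * 2) :=
        Real.rpow_le_rpow_of_exponent_le h (by linarith)
      linarith
  have k4 : (1 + θ) * a * n ≤ 4 * ((U ^ 2 + ddot A A)
      + ((2 + Z) + ((θ ^ (M.β / 2)) ^ 2 + θ ^ 2 * Z))) := by
    -- The stress is split into the square of the velocity gradient, integrable in space-time, and
    -- `(1+θ)²` times the squared weight.
    have h1 : (1 + θ) * a * n ≤ a ^ 2 + (1 + θ) ^ 2 * n ^ 2 := by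
      have e : 2 * a * ((1 + θ) * n) ≤ a ^ 2 + ((1 + θ) * n) ^ 2 := two_mul_le_add_sq _ _
      have e' : 0 ≤ a * ((1 + θ) * n) := by positivity
      have e2 : ((1 + θ) * n) ^ 2 = (1 + θ) ^ 2 * n ^ 2 := mul_pow _ _ _
      linarith
    have h2 : (1 + θ) ^ 2 ≤ 2 * (1 + θ ^ 2) := by nlinarith [sq_nonneg (1 - θ)]
    have h3 : (1 + θ) ^ 2 * n ^ 2 ≤ 2 * (1 + θ ^ 2) * (2 * (1 + Z)) := by gcongr
    rw [ha2] at h1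
    have h4 : 2 * (1 + θ ^ 2) * (2 * (1 + Z)) = 4 + 4 * θ ^ 2 + 4 * Z + 4 * (θ ^ 2 * Z) := by ring
    linarith [sq_nonneg U]
  have hN : 0 ≤ N := hn.trans hnN
  have hE : 0 ≤ (U ^ 2 + ddot A A) + ((2 + Z) + ((θ ^ (M.β / 2)) ^ 2 + θ ^ 2 * Z)) := by positivity
  obtain ⟨Ex, hEx⟩ : ∃ Ex, Ex = (U ^ 2 + ddot A A)
    + ((2 + Z) + ((θ ^ (M.β / 2)) ^ 2 + θ ^ 2 * Z)) := ⟨_, rfl⟩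
  rw [← hU, ← hEx]
  rw [← hEx] at k4 hE
  have hm : |momentumDensity M g ρ θ u A P J Φ| ≤ |ρ * inner ℝ u P|
      + |ρ * ddot (fun i j => u i * u j) J| + |ddot (M.stress θ A) J|
      + |ρ * inner ℝ (-g • e3) Φ| := by
    -- The pressure drops out here because the test field is divergence free.
    unfold momentumDensity
    rw [htr, mul_zero, add_zero]
    refine (abs_add_le _ _).trans (add_le_add ?_ le_rfl)
    refine (abs_sub _ _).trans (add_le_add ?_ le_rfl)
    exact abs_add_le _ _
  have s1 : lam * (ρ * (U * w)) + ρ * (v * U) * N ≤ lam * (ρ * U ^ 2) + lam * (ρ * (1 + w ^ 2))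
      + (σ * Q * (ρ * N) + σ * (ρ * U ^ 2 * N)) := by
    have h1 : lam * (ρ * (U * w)) ≤ lam * (ρ * (U ^ 2 + (1 + w ^ 2))) := by gcongr
    have h2 : ρ * (v * U) * N ≤ ρ * (σ * Q + σ * U ^ 2) * N := by gcongr
    have e : lam * (ρ * (U ^ 2 + (1 + w ^ 2))) + ρ * (σ * Q + σ * U ^ 2) * N
        = lam * (ρ * U ^ 2) + lam * (ρ * (1 + w ^ 2))
          + (σ * Q * (ρ * N) + σ * (ρ * U ^ 2 * N)) := by ring
    linarith
  have s5 : ρ * w ≤ ρ * (1 + w ^ 2) := by gcongr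
  have q1 : 0 ≤ lam * (ρ * U ^ 2) := by positivity
  have q2 : 0 ≤ lam * (ρ * (1 + w ^ 2)) := by positivity
  have q3 : 0 ≤ ρ * (1 + w ^ 2) := by positivity
  have q4 : 0 ≤ σ * Q * (ρ * N) := by positivity
  have q5 : 0 ≤ σ * (ρ * U ^ 2 * N) := by positivity
  have q6 : 0 ≤ ρ * U ^ 2 * N := by positivity
  obtain ⟨T, hT⟩ : ∃ T, T = lam * (ρ * U ^ 2) + ((lam + 1) * (ρ * (1 + w ^ 2))
    + (σ * Q * (ρ * N) + ((σ + 1) * (ρ * U ^ 2 * N) + Ex))) := ⟨_, rfl⟩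
  have hTa : lam * (ρ * (U * w)) + ρ * (v * U) * N ≤ T := by rw [hT]; linarith
  have hTb : ρ * U ^ 2 * N ≤ T := by rw [hT]; linarith
  have hTc : Ex ≤ T := by rw [hT]; linarith
  have hTd : ρ * w ≤ T := by rw [hT]; linarith
  have hT0 : 0 ≤ T := hE.trans hTc
  rw [← hT]
  calc _ ≤ C * T + C * 9 * T + C * (9 * Cs) * (4 * T) + C * g * T := by
        refine hm.trans (add_le_add (add_le_add (add_le_add ?_ ?_) ?_) ?_)
        · exact t1.trans (by gcongr)
        · exact t2.trans (by gcongr)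
        · exact t4.trans (mul_le_mul_of_nonneg_left (k4.trans (by linarith)) (by positivity))
        · exact t5.trans (by gcongr)
    _ ≤ C * (2 + 9 + 36 * Cs + g) * T := by
        have e : C * T + C * 9 * T + C * (9 * Cs) * (4 * T) + C * g * T
            = C * (10 + 36 * Cs + g) * T := by ring
        rw [e]
        gcongr
        norm_num

theorem one_add_indicator_sq_le {X : Type*} (S : Set X) {s : X → ℝ} (x : X) :
    (1 + S.indicator s x) ^ 2 ≤ 2 * (1 + S.indicator (fun y => s y ^ 2) x) := by
  by_cases hx : x ∈ S
  · simp only [indicator_of_mem hx]; nlinarith [sq_nonneg (1 - s x)]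
  · simp only [indicator_of_notMem hx]; norm_num

theorem ofReal_add_five {a b c d e : ℝ} (ha : 0 ≤ a) (hb : 0 ≤ b) (hc : 0 ≤ c) (hd : 0 ≤ d)
    (he : 0 ≤ e) : ENNReal.ofReal (a + b + c + d + e) = ENNReal.ofReal a + ENNReal.ofReal b
      + ENNReal.ofReal c + ENNReal.ofReal d + ENNReal.ofReal e := by
  rw [ENNReal.ofReal_add (by positivity) he, ENNReal.ofReal_add (by positivity) hd,
    ENNReal.ofReal_add (by positivity) hc, ENNReal.ofReal_add ha hb]

/-- Integral of the fluid part of the momentum integrand at a fixed time. -/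
theorem exists_lintegral_momentumDensity_le {M : FluidModel} (hM : M.Admissible) {Ω : Set E3}
    {g r₀ ε C τ : ℝ} (hγ : 3 < M.γ) (hβ : 2 < M.β) (hg : 0 < g) (hC : 0 < C) (hr₀ : 0 < r₀)
    (hε : 0 < ε) (hΩ : MeasurableSet Ω) (hb : Bornology.IsBounded Ω)
    (hflat : ∀ x : E3, |x 0| ≤ 2 * r₀ → |x 1| ≤ 2 * r₀ → |x 2| < ε → (x ∈ Ω ↔ 0 < x 2))
    (htip : tipZone r₀ (ε / 2) ⊆ Ω) (hτ : 0 < τ) (hτγ : τ * (3 * M.γ / (2 * M.γ - 3)) < 1)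
    (hτβ : τ * (6 * M.β / (3 * M.β - 2)) < 1) :
    ∃ C₂, 0 < C₂ ∧ ∀ F ⊆ Ω, MeasurableSet F → ∀ (ρ θ : E3 → ℝ) (u : E3 → E3) (A : E3 → Mat3)
      (G P : E3 → E3) (J : E3 → Mat3) (Φ : E3 → E3) (lam v σ Q : ℝ),
      AEMeasurable ρ (volume.restrict Ω) → AEMeasurable θ (volume.restrict Ω) →
      AEMeasurable G (volume.restrict Ω) → (∀ᵐ x ∂volume.restrict Ω, 0 ≤ ρ x) →
      (∀ᵐ x ∂volume.restrict Ω, 0 < θ x) → IsW012 Ω u A →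
      HasWeakGrad Ω (fun x => θ x ^ (M.β / 2)) G →
      0 ≤ lam → 0 ≤ v → 0 < σ → 0 < Q → v ^ 2 ≤ σ ^ 2 * Q →
      ∫⁻ x in F, ENNReal.ofReal (ρ x ^ M.γ) ≤ ENNReal.ofReal Q →
      ∫⁻ x in Ω, ENNReal.ofReal (ρ x * ‖u x‖ ^ 2) ≤ ENNReal.ofReal Q →
      (∀ᵐ x ∂volume.restrict F,
        ‖P x‖ ≤ C * (lam * singWeight (1 / 6) x
          + v * (1 + (tipZone r₀ (ε / 2)).indicator (singWeight τ) x)) ∧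
        ‖Φ x‖ ≤ C * singWeight (1 / 6) x ∧
        (∀ i j, |J x i j| ≤ C * (1 + (tipZone r₀ (ε / 2)).indicator (singWeight τ) x)) ∧
        (J x).trace = 0) →
      ∫⁻ x in F, ‖momentumDensity M g (ρ x) (θ x) (u x) (A x) (P x) (J x) (Φ x)‖ₑ
        ≤ ENNReal.ofReal (C₂ * (lam * (Q + Q ^ (1 / M.γ)) + σ * Q * Q ^ (1 / M.γ) + 1
            + Q ^ (1 / M.γ)))
          + ENNReal.ofReal (C₂ * ((σ + 1) * Q ^ (1 / M.γ) + 1))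
            * (∫⁻ x in Ω, ENNReal.ofReal (‖u x‖ ^ 2 + ddot (A x) (A x)))
          + ENNReal.ofReal C₂
            * ∫⁻ x in Ω, ENNReal.ofReal ((θ x ^ (M.β / 2)) ^ 2 + ‖G x‖ ^ 2) := by
  have hγ1 : 1 < M.γ := by linarith
  -- For `γ > 3` the conjugate exponent is at most `3/2`, so the squared weight of exponent `1/6`,
  -- which has exponent `1/3`, is integrable against the density.
  have hcj : M.γ / (M.γ - 1) ≤ 3 / 2 := by
    rw [div_le_iff₀ (by linarith)]; linarith
  have hcj2 : M.γ / (M.γ - 1) ≤ 3 * M.γ / (2 * M.γ - 3) := by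
    rw [div_le_div_iff₀ (by linarith) (by linarith)]; nlinarith
  have h2τ : 2 * τ < 1 := by
    refine lt_of_le_of_lt ?_ hτβ
    rw [mul_comm]
    gcongr
    rw [le_div_iff₀ (by linarith)]; linarith
  obtain ⟨C₁, hC₁, hpt⟩ := exists_abs_momentumDensity_le hM hβ hg hC
  obtain ⟨c2, h2⟩ := exists_lintegral_density_weight_le hb hγ1 (s := 1 / 3) (by linarith)
  obtain ⟨c3, h3⟩ := exists_lintegral_density_weight_le hb hγ1 (s := τ)
    (lt_of_le_of_lt (by gcongr) hτγ)
  obtain ⟨c4, h4⟩ := exists_lintegral_kinetic_weight_le hΩ hb hγ hτγ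
  obtain ⟨c8, h8⟩ := exists_lintegral_temperature_weight_le hr₀ hε hΩ hb hflat htip hβ hτβ
  have h6 : ∃ c6 : ℝ≥0, ∫⁻ x in Ω, ENNReal.ofReal (2 + singWeight τ x ^ 2) ≤ c6 := by
    have hfin : ∫⁻ x in Ω, ENNReal.ofReal (2 + singWeight τ x ^ 2) < ∞ := by
      refine (lintegral_ofReal_add_le measurable_const.aemeasurable _).trans_lt ?_
      refine ENNReal.add_lt_top.2 ⟨?_, ?_⟩
      · rw [lintegral_const, Measure.restrict_apply_univ]
        exact ENNReal.mul_lt_top ENNReal.ofReal_lt_top hb.measure_lt_top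
      · have : ∀ x, singWeight τ x ^ 2 = singWeight (2 * τ) x := fun x => by
          rw [← Real.rpow_natCast, singWeight_rpow, mul_comm]; norm_num
        simp only [this]
        exact lintegral_singWeight_lt_top h2τ hb
    exact ⟨_, (ENNReal.coe_toNNReal hfin.ne).ge⟩
  obtain ⟨c6, h6⟩ := h6
  refine ⟨C₁ * (1 + c2 + c3 + c4 + c6 + c8), by positivity, ?_⟩
  intro F hF hFm ρ θ u A G P J Φ lam v σ Q hρ hθ hG hρ0 hθ0 hu hw hlam hv hσ hQ hvQ hργ hkin htest
  have hle : volume.restrict F ≤ volume.restrict Ω := Measure.restrict_mono hF le_rfl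
  obtain ⟨R, hR⟩ : ∃ R, R = Q ^ (1 / M.γ) := ⟨_, rfl⟩
  have hR0 : 0 ≤ R := by rw [hR]; positivity
  have hRr : (∫⁻ x in F, ENNReal.ofReal (ρ x ^ M.γ)) ^ (1 / M.γ) ≤ ENNReal.ofReal R := by
    rw [hR, ← ENNReal.ofReal_rpow_of_nonneg hQ.le (by positivity)]
    gcongr
  obtain ⟨X, hX⟩ : ∃ X, X = ∫⁻ x in Ω, ENNReal.ofReal (‖u x‖ ^ 2 + ddot (A x) (A x)) := ⟨_, rfl⟩
  obtain ⟨Y, hY⟩ : ∃ Y, Y = ∫⁻ x in Ω, ENNReal.ofReal ((θ x ^ (M.β / 2)) ^ 2 + ‖G x‖ ^ 2) :=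
    ⟨_, rfl⟩
  -- The indicator is kept for the temperature, whose `L⁶` bound holds only in the tip zone. In the
  -- terms with the density it is dropped, since the bounds for `ρ` and `u` hold on the whole fluid
  -- domain.
  obtain ⟨Z, hZ⟩ : ∃ Z : E3 → ℝ, Z = (tipZone r₀ (ε / 2)).indicator fun y => singWeight τ y ^ 2 :=
    ⟨_, rfl⟩
  have hZ0 : ∀ x, 0 ≤ Z x := fun x => hZ ▸ indicator_nonneg (fun y _ => sq_nonneg _) x
  have hZle : ∀ x, Z x ≤ singWeight τ x ^ 2 := fun x =>
    hZ ▸ indicator_le_self' (fun y _ => sq_nonneg _) x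
  have hZm : Measurable Z := hZ ▸ ((measurable_singWeight τ).pow_const 2).indicator
    (measurableSet_tipZone _ _)
  have hρF := hρ.mono_measure hle
  have hρ0F := ae_mono hle hρ0
  have hθF := hθ.mono_measure hle
  have hθ0F := ae_mono hle hθ0
  have huF : AEMeasurable (fun x => ‖u x‖) (volume.restrict F) :=
    (hu.1.1.norm.aemeasurable).mono_measure hle
  have hAF : AEMeasurable (fun x => ddot (A x) (A x)) (volume.restrict F) := by
    unfold ddot
    refine Finset.aemeasurable_fun_sum _ fun i _ => Finset.aemeasurable_fun_sum _ fun j _ => ?_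
    have := ((hu.2.1 i j).1.aemeasurable).mono_measure hle
    exact this.mul this
  have hNm : Measurable fun x : E3 => 1 + singWeight τ x :=
    measurable_const.add (measurable_singWeight τ)
  have hwm : Measurable fun x : E3 => 1 + singWeight (1 / 6) x ^ 2 :=
    measurable_const.add ((measurable_singWeight _).pow_const 2)
  have m1 : AEMeasurable (fun x => ρ x * ‖u x‖ ^ 2) (volume.restrict F) :=
    hρF.mul (huF.pow_const 2)
  have m2 : AEMeasurable (fun x => ρ x * (1 + singWeight (1 / 6) x ^ 2)) (volume.restrict F) :=
    hρF.mul hwm.aemeasurable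
  have m3 : AEMeasurable (fun x => ρ x * (1 + singWeight τ x)) (volume.restrict F) :=
    hρF.mul hNm.aemeasurable
  have m4 : AEMeasurable (fun x => ρ x * ‖u x‖ ^ 2 * (1 + singWeight τ x)) (volume.restrict F) :=
    m1.mul hNm.aemeasurable
  have m5 : AEMeasurable (fun x => ‖u x‖ ^ 2 + ddot (A x) (A x)) (volume.restrict F) :=
    (huF.pow_const 2).add hAF
  have m6 : AEMeasurable (fun x => 2 + Z x) (volume.restrict F) :=
    (measurable_const.add hZm).aemeasurable
  have m7 : AEMeasurable (fun x => (θ x ^ (M.β / 2)) ^ 2) (volume.restrict F) :=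
    (hθF.pow_const _).pow_const 2
  have b1 : ∫⁻ x in F, ENNReal.ofReal (ρ x * ‖u x‖ ^ 2) ≤ ENNReal.ofReal Q :=
    (lintegral_mono_set hF).trans hkin
  have b2 : ∫⁻ x in F, ENNReal.ofReal (ρ x * (1 + singWeight (1 / 6) x ^ 2))
      ≤ c2 * ENNReal.ofReal R := by
    have : ∀ x, singWeight (1 / 6) x ^ 2 = singWeight (1 / 3) x := fun x => by
      rw [← Real.rpow_natCast, singWeight_rpow]; norm_num
    simp only [this]
    exact (h2 F hF ρ hρF hρ0F).trans (by gcongr)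
  have b3 : ∫⁻ x in F, ENNReal.ofReal (ρ x * (1 + singWeight τ x)) ≤ c3 * ENNReal.ofReal R :=
    (h3 F hF ρ hρF hρ0F).trans (by gcongr)
  have b4 : ∫⁻ x in F, ENNReal.ofReal (ρ x * ‖u x‖ ^ 2 * (1 + singWeight τ x))
      ≤ c4 * ENNReal.ofReal R * X := by
    rw [hX]
    exact (h4 F hF ρ u A hρF hρ0F hu).trans (by gcongr)
  have b5 : ∫⁻ x in F, ENNReal.ofReal (‖u x‖ ^ 2 + ddot (A x) (A x)) ≤ X :=
    hX ▸ lintegral_mono_set hF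
  have b6 : ∫⁻ x in F, ENNReal.ofReal (2 + Z x) ≤ c6 := by
    refine (lintegral_mono_set hF).trans ((lintegral_mono fun x => ?_).trans h6)
    exact ENNReal.ofReal_le_ofReal (add_le_add le_rfl (hZle x))
  have b7 : ∫⁻ x in F, ENNReal.ofReal ((θ x ^ (M.β / 2)) ^ 2) ≤ Y := by
    rw [hY]
    refine (lintegral_mono_set hF).trans (lintegral_mono fun x => ?_)
    exact ENNReal.ofReal_le_ofReal (le_add_of_nonneg_right (sq_nonneg _))
  have b8 : ∫⁻ x in F, ENNReal.ofReal (θ x ^ 2 * Z x) ≤ c8 * (1 + Y) := by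
    rw [hY]
    refine le_trans ?_ (h8 θ G hθ hG hθ0 hw)
    rw [← lintegral_indicator (measurableSet_tipZone _ _)]
    refine (setLIntegral_le_lintegral _ _).trans (lintegral_mono fun x => ?_)
    rw [hZ]
    by_cases hx : x ∈ tipZone r₀ (ε / 2)
    · simp only [indicator_of_mem hx]; exact le_rfl
    · simp only [indicator_of_notMem hx]; simp
  have hmain : ∫⁻ x in F, ‖momentumDensity M g (ρ x) (θ x) (u x) (A x) (P x) (J x) (Φ x)‖ₑ
      ≤ ∫⁻ x in F, ENNReal.ofReal (C₁ * (lam * (ρ x * ‖u x‖ ^ 2)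
        + ((lam + 1) * (ρ x * (1 + singWeight (1 / 6) x ^ 2))
        + (σ * Q * (ρ x * (1 + singWeight τ x))
        + ((σ + 1) * (ρ x * ‖u x‖ ^ 2 * (1 + singWeight τ x))
        + ((‖u x‖ ^ 2 + ddot (A x) (A x)) + ((2 + Z x)
        + ((θ x ^ (M.β / 2)) ^ 2 + θ x ^ 2 * Z x)))))))) := by
    refine lintegral_mono_ae ?_
    filter_upwards [hρ0F, hθ0F, htest] with x hx1 hx2 ⟨hx3, hx4, hx5, hx6⟩
    rw [← ofReal_norm, Real.norm_eq_abs]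
    refine ENNReal.ofReal_le_ofReal (hpt (ρ x) (θ x) (u x) (A x) (P x) (J x) (Φ x) lam v σ Q
      (singWeight (1 / 6) x) (1 + (tipZone r₀ (ε / 2)).indicator (singWeight τ) x)
      (1 + singWeight τ x) (Z x) hx1 hx2 hlam hv hσ hvQ (singWeight_nonneg _ _) ?_ ?_ ?_ (hZ0 x)
      hx3 hx4 hx5 hx6)
    · exact add_nonneg zero_le_one (indicator_nonneg (fun y _ => singWeight_nonneg _ _) x)
    · exact add_le_add le_rfl (indicator_le_self' (fun y _ => singWeight_nonneg _ _) x)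
    · rw [hZ]; exact one_add_indicator_sq_le _ x
  have hsum : ∫⁻ x in F, ENNReal.ofReal (C₁ * (lam * (ρ x * ‖u x‖ ^ 2)
        + ((lam + 1) * (ρ x * (1 + singWeight (1 / 6) x ^ 2))
        + (σ * Q * (ρ x * (1 + singWeight τ x))
        + ((σ + 1) * (ρ x * ‖u x‖ ^ 2 * (1 + singWeight τ x))
        + ((‖u x‖ ^ 2 + ddot (A x) (A x)) + ((2 + Z x)
        + ((θ x ^ (M.β / 2)) ^ 2 + θ x ^ 2 * Z x))))))))
      ≤ ENNReal.ofReal C₁ * (ENNReal.ofReal lam * ENNReal.ofReal Q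
        + (ENNReal.ofReal (lam + 1) * (c2 * ENNReal.ofReal R)
        + (ENNReal.ofReal (σ * Q) * (c3 * ENNReal.ofReal R)
        + (ENNReal.ofReal (σ + 1) * (c4 * ENNReal.ofReal R * X)
        + (X + (c6 + (Y + c8 * (1 + Y)))))))) := by
    rw [lintegral_ofReal_const_mul hC₁.le]
    gcongr
    refine (lintegral_ofReal_add_le (m1.const_mul _) _).trans (add_le_add ?_ ?_)
    · rw [lintegral_ofReal_const_mul hlam]; gcongr
    refine (lintegral_ofReal_add_le (m2.const_mul _) _).trans (add_le_add ?_ ?_)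
    · rw [lintegral_ofReal_const_mul (by positivity)]; gcongr
    refine (lintegral_ofReal_add_le (m3.const_mul _) _).trans (add_le_add ?_ ?_)
    · rw [lintegral_ofReal_const_mul (by positivity)]; gcongr
    refine (lintegral_ofReal_add_le (m4.const_mul _) _).trans (add_le_add ?_ ?_)
    · rw [lintegral_ofReal_const_mul (by positivity)]; gcongr
    refine (lintegral_ofReal_add_le m5 _).trans (add_le_add b5 ?_)
    refine (lintegral_ofReal_add_le m6 _).trans (add_le_add b6 ?_)
    exact (lintegral_ofReal_add_le m7 _).trans (add_le_add b7 b8)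
  refine (hmain.trans hsum).trans ?_
  rw [← hR, ← hX, ← hY]
  have hk : ∀ c : ℝ≥0, (c : ℝ≥0∞) = ENNReal.ofReal c := fun c => by simp
  have e1 : ENNReal.ofReal C₁ * (ENNReal.ofReal lam * ENNReal.ofReal Q
        + (ENNReal.ofReal (lam + 1) * (c2 * ENNReal.ofReal R)
        + (ENNReal.ofReal (σ * Q) * (c3 * ENNReal.ofReal R)
        + (ENNReal.ofReal (σ + 1) * (c4 * ENNReal.ofReal R * X)
        + (X + (c6 + (Y + c8 * (1 + Y))))))))
      = ENNReal.ofReal (C₁ * (lam * Q + (lam + 1) * (c2 * R) + σ * Q * (c3 * R) + c6 + c8))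
        + ENNReal.ofReal (C₁ * ((σ + 1) * (c4 * R) + 1)) * X
        + ENNReal.ofReal (C₁ * (1 + c8)) * Y := by
    have f2 : ENNReal.ofReal ((lam + 1) * (c2 * R))
        = ENNReal.ofReal (lam + 1) * (c2 * ENNReal.ofReal R) := by
      rw [ENNReal.ofReal_mul (by positivity), ENNReal.ofReal_mul (by positivity), ← hk]
    have f3 : ENNReal.ofReal (σ * Q * (c3 * R))
        = ENNReal.ofReal (σ * Q) * (c3 * ENNReal.ofReal R) := by
      rw [ENNReal.ofReal_mul (p := σ * Q) (by positivity),
        ENNReal.ofReal_mul (p := (c3 : ℝ)) (by positivity), ← hk]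
    have f4 : ENNReal.ofReal ((σ + 1) * (c4 * R))
        = ENNReal.ofReal (σ + 1) * (c4 * ENNReal.ofReal R) := by
      rw [ENNReal.ofReal_mul (by positivity), ENNReal.ofReal_mul (by positivity), ← hk]
    rw [ENNReal.ofReal_mul hC₁.le, ENNReal.ofReal_mul hC₁.le, ENNReal.ofReal_mul hC₁.le,
      ofReal_add_five (by positivity) (by positivity) (by positivity)
        (by positivity) (by positivity), f2, f3, ENNReal.ofReal_mul hlam,
      ENNReal.ofReal_add (p := (σ + 1) * (c4 * R)) (by positivity) zero_le_one, f4,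
      ENNReal.ofReal_add zero_le_one (by positivity), ENNReal.ofReal_one, ← hk, ← hk]
    ring
  rw [e1]
  have p2 : (0 : ℝ) ≤ c2 := c2.2
  have p3 : (0 : ℝ) ≤ c3 := c3.2
  have p4 : (0 : ℝ) ≤ c4 := c4.2
  have p6 : (0 : ℝ) ≤ c6 := c6.2
  have p8 : (0 : ℝ) ≤ c8 := c8.2
  gcongr ENNReal.ofReal ?_ + ENNReal.ofReal ?_ * X + ENNReal.ofReal ?_ * Y
  · rw [mul_assoc C₁]
    gcongr
    rw [← sub_nonneg]; ring_nf; positivity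
  · rw [mul_assoc C₁]
    gcongr
    rw [← sub_nonneg]; ring_nf; positivity
  · gcongr
    rw [← sub_nonneg]; ring_nf; positivity

/-! ### Smoothing and cut-offs in time -/

/-- Smooth approximation of a Lipschitz function of time with the same Lipschitz constant. -/
theorem exists_contDiff_near_lipschitz {f : ℝ → ℝ} {L : ℝ≥0} (hf : LipschitzWith L f) {ε : ℝ}
    (hε : 0 < ε) :
    ∃ g : ℝ → ℝ, ContDiff ℝ (⊤ : ℕ∞) g ∧ (∀ t, |g t - f t| ≤ ε) ∧ ∀ t, |deriv g t| ≤ L := by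
  -- The `+ 1` keeps the radius meaningful when `L = 0`.
  obtain ⟨r, hr⟩ : ∃ r, r = ε / (L + 1) := ⟨_, rfl⟩
  have hr0 : 0 < r := by rw [hr]; positivity
  let φ : ContDiffBump (0 : ℝ) := ⟨r / 2, r, by positivity, by linarith⟩
  have hloc : LocallyIntegrable f := hf.continuous.locallyIntegrable
  refine ⟨convolution (φ.normed volume) f (ContinuousLinearMap.lsmul ℝ ℝ) volume, ?_, ?_, ?_⟩
  · exact φ.hasCompactSupport_normed.contDiff_convolution_left _ φ.contDiff_normed hloc
  · intro t
    have h := φ.dist_normed_convolution_le (μ := volume) (g := f) (x₀ := t) (ε := ε)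
      hf.continuous.aestronglyMeasurable (fun x hx => by
        have h1 : dist x t ≤ r := (Metric.mem_ball.1 hx).le
        calc dist (f x) (f t) ≤ L * dist x t := hf.dist_le_mul x t
          _ ≤ L * r := by gcongr
          _ ≤ (L + 1) * r := by gcongr; linarith
          _ = ε := by rw [hr]; field_simp)
    rwa [Real.dist_eq] at h
  · intro t
    rw [← Real.norm_eq_abs]
    refine norm_deriv_le_of_lipschitz (LipschitzWith.of_dist_le_mul fun x y => ?_)
    have hint : ∀ x, Integrable fun s => φ.normed volume s • f (x - s) := fun x =>
      (Continuous.smul φ.continuous_normed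
        (hf.continuous.comp (continuous_const.sub continuous_id))).integrable_of_hasCompactSupport
        φ.hasCompactSupport_normed.smul_right
    have hφi : Integrable (φ.normed (volume : Measure ℝ)) := φ.integrable_normed
    rw [Real.dist_eq]
    simp only [convolution, ContinuousLinearMap.lsmul_apply]
    rw [← integral_sub (hint x) (hint y)]
    calc |∫ s, (φ.normed volume s • f (x - s) - φ.normed volume s • f (y - s))|
        ≤ ∫ s, φ.normed volume s * (L * dist x y) := by
          rw [← Real.norm_eq_abs]
          refine norm_integral_le_of_norm_le (hφi.mul_const _) (.of_forall fun s => ?_)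
          rw [← smul_sub, norm_smul, Real.norm_of_nonneg (φ.nonneg_normed s)]
          gcongr
          · exact φ.nonneg_normed s
          · rw [← dist_eq_norm]
            refine (hf.dist_le_mul _ _).trans_eq ?_
            rw [dist_sub_right]
      _ = L * dist x y := by rw [integral_mul_const, φ.integral_normed, one_mul]

/-- Smooth cut-offs in time. -/
theorem exists_timeCutoff : ∃ Cb cb : ℝ, 0 < Cb ∧ 0 < cb ∧ ∀ T > 0, ∃ ζ : ℝ → ℝ,
    ContDiff ℝ (⊤ : ℕ∞) ζ ∧ (∀ t, 0 ≤ ζ t) ∧ (∀ t, ζ t ≤ 1) ∧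
    (∀ t, ζ t ≠ 0 → t ∈ Icc (T / 4) (3 * T / 4)) ∧ (∀ t, |deriv ζ t| ≤ Cb / T) ∧
    ∫ t in Ioo 0 T, ζ t = cb * T := by
  -- One bump on the unit interval is rescaled by `T`, so its derivative scales like `1/T` and its
  -- integral like `T`. Its support `[1/4, 3/4]` stays away from both endpoints.
  let b : ContDiffBump (1 / 2 : ℝ) := ⟨1 / 8, 1 / 4, by norm_num, by norm_num⟩
  have hbd : ContDiff ℝ 1 (b : ℝ → ℝ) := b.contDiff
  obtain ⟨C, hC⟩ := (hbd.continuous_deriv le_rfl).bounded_above_of_compact_support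
    b.hasCompactSupport.deriv
  refine ⟨max C 1, ∫ t, b t, by positivity, b.integral_pos, fun T hT =>
    ⟨fun t => b (t / T), b.contDiff.comp (contDiff_id.div_const T), fun t => b.nonneg,
      fun t => b.le_one, ?_, ?_, ?_⟩⟩
  · intro t ht
    have h : t / T ∈ Function.support b := ht
    rw [b.support_eq, Metric.mem_ball, Real.dist_eq, abs_lt] at h
    have hr : b.rOut = 1 / 4 := rfl
    rw [hr] at h
    have e : t = t / T * T := by field_simp
    constructor <;> nlinarith
  · intro t
    have h1 : HasDerivAt (fun t : ℝ => b (t / T)) (deriv b (t / T) * (1 / T)) t :=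
      HasDerivAt.comp (h₂ := (b : ℝ → ℝ)) (h := fun t : ℝ => t / T) t
        ((hbd.differentiable (by simp)) (t / T)).hasDerivAt ((hasDerivAt_id t).div_const T)
    rw [h1.deriv, abs_mul, abs_of_pos (by positivity : 0 < 1 / T), mul_one_div]
    gcongr
    exact (hC _).trans (le_max_left _ _)
  · rw [setIntegral_eq_integral_of_forall_compl_eq_zero, Measure.integral_comp_div b T,
      abs_of_pos hT, smul_eq_mul, mul_comm]
    intro t ht
    by_contra h
    have hs : t / T ∈ Function.support b := h
    rw [b.support_eq, Metric.mem_ball, Real.dist_eq, abs_lt] at hs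
    have hr : b.rOut = 1 / 4 := rfl
    rw [hr] at hs
    have e : t = t / T * T := by field_simp
    exact ht ⟨by nlinarith, by nlinarith⟩

/-! ### Mass, energy and the final comparison of constants -/

namespace Geometry

variable {Ω B : Set E3} {α r₀ : ℝ}

theorem volume_body_pos (hgeo : Geometry Ω B α r₀) : 0 < (volume B).toReal :=
  ENNReal.toReal_pos ((isOpen_interior.measure_pos _ hgeo.body_connected.nonempty).trans_le
    (measure_mono interior_subset)).ne' hgeo.body_compact.measure_lt_top.ne

theorem mass_eq (D : InitialData) : D.mass B = D.ρS * (volume B).toReal := by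
  rw [InitialData.mass, volume_bodyAt]

theorem mass_pos (hgeo : Geometry Ω B α r₀) {D : InitialData} (hD : 0 < D.ρS) :
    0 < D.mass B := by
  rw [mass_eq]
  exact mul_pos hD hgeo.volume_body_pos

end Geometry

theorem FluidModel.Admissible.energyDensity_nonneg {M : FluidModel} (hM : M.Admissible)
    (hγ : 1 < M.γ) {ρ θ : ℝ} (hρ : 0 ≤ ρ) (hθ : 0 ≤ θ) : 0 ≤ M.energyDensity ρ θ := by
  have := hM.pInf_pos
  have := hM.cv_pos
  have := hM.a_pos
  have : 0 < M.γ - 1 := by linarith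
  unfold FluidModel.energyDensity
  positivity

theorem InitialData.Admissible.energy_nonneg {M : FluidModel} (hM : M.Admissible) (hγ : 1 < M.γ)
    {Ω B : Set E3} {D : InitialData} (hD : D.Admissible M Ω B) : 0 ≤ D.energy M Ω B := by
  have hρS := hD.solid_density_pos
  have h1 : 0 ≤ ∫ x in Ω \ bodyAt B D.h₀,
      (‖D.m₀ x‖ ^ 2 / (2 * D.ρ₀ x) + M.energyDensity (D.ρ₀ x) (D.θ₀ x)) := by
    refine integral_nonneg_of_ae ?_
    filter_upwards [ae_restrict_of_ae_restrict_of_subset sdiff_subset hD.density_nonneg,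
      ae_restrict_of_ae_restrict_of_subset sdiff_subset hD.temperature_pos] with x hx hx'
    exact add_nonneg (by positivity) (hM.energyDensity_nonneg hγ hx hx'.le)
  have h2 : 0 ≤ D.mass B := mul_nonneg hρS.le ENNReal.toReal_nonneg
  have h3 : 0 ≤ D.inertia B (D.ω₀ • e3) := by
    refine integral_nonneg fun x => mul_nonneg hρS.le ?_
    rw [sub_nonneg, ← mul_pow]
    exact sq_le_sq' (neg_le_of_abs_le (abs_real_inner_le_norm _ _)) (real_inner_le_norm _ _)
  unfold InitialData.energy
  positivity

/-- The energy terms of the final estimate in terms of `1 + E ^ (1 + 1 / γ)`. -/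
theorem exists_energy_powers_le {γ K : ℝ} (hγ : 1 < γ) (hK : 0 < K) :
    ∃ C, 0 < C ∧ ∀ E, 0 ≤ E → ∀ Q, Q = K * (E + 1) →
      1 ≤ C * (1 + E ^ (1 / 2 + 1 / γ + 1 / 2)) ∧ √Q ≤ C * (1 + E ^ (1 / 2 + 1 / γ + 1 / 2)) ∧
      Q ≤ C * (1 + E ^ (1 / 2 + 1 / γ + 1 / 2)) ∧
      Q ^ (1 / γ) ≤ C * (1 + E ^ (1 / 2 + 1 / γ + 1 / 2)) ∧
      Q * Q ^ (1 / γ) ≤ C * (1 + E ^ (1 / 2 + 1 / γ + 1 / 2)) := by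
  obtain ⟨s, hs⟩ : ∃ s, s = 1 / 2 + 1 / γ + 1 / 2 := ⟨_, rfl⟩
  have hs1 : 1 ≤ s := by
    have : 0 ≤ 1 / γ := by positivity
    rw [hs]; linarith
  have hg1 : 1 / γ ≤ 1 := by rw [div_le_one (by linarith)]; linarith
  obtain ⟨c, hc⟩ : ∃ c, c = (2 * (1 + K)) ^ s := ⟨_, rfl⟩
  have hc0 : 0 < c := by rw [hc]; positivity
  refine ⟨c, hc0, fun E hE Q hQ => ?_⟩
  rw [← hs]
  -- `P` dominates `Q` and is at least `1`, so all powers of `P` with exponent up to `s = 1 + 1/γ`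
  -- are dominated by `P^s`; the exponent `s` itself is attained by `Q Q^(1/γ)`.
  obtain ⟨P, hP⟩ : ∃ P, P = (1 + K) * (E + 1) := ⟨_, rfl⟩
  have hQ0 : 0 ≤ Q := by rw [hQ]; positivity
  have hP1 : 1 ≤ P := by rw [hP]; nlinarith
  have hQP : Q ≤ P := by rw [hQ, hP]; gcongr; linarith
  have key : P ^ s ≤ c * (1 + E ^ s) := by
    rcases le_total E 1 with h | h
    · calc P ^ s ≤ (2 * (1 + K)) ^ s := by
            refine Real.rpow_le_rpow (by linarith) ?_ (by linarith)
            rw [hP]; nlinarith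
        _ = c * 1 := by rw [hc, mul_one]
        _ ≤ c * (1 + E ^ s) := by
            gcongr
            have : 0 ≤ E ^ s := by positivity
            linarith
    · calc P ^ s ≤ (2 * (1 + K) * E) ^ s := by
            refine Real.rpow_le_rpow (by linarith) ?_ (by linarith)
            rw [hP]; nlinarith
        _ = c * E ^ s := by rw [hc, Real.mul_rpow (by positivity) hE]
        _ ≤ c * (1 + E ^ s) := by gcongr; linarith
  have hmono : ∀ t, t ≤ s → P ^ t ≤ c * (1 + E ^ s) := fun t ht =>
    (Real.rpow_le_rpow_of_exponent_le hP1 ht).trans key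
  have hQγ : Q ^ (1 / γ) ≤ P ^ (1 / γ) := Real.rpow_le_rpow hQ0 hQP (by positivity)
  refine ⟨?_, ?_, ?_, ?_, ?_⟩
  · simpa using hmono 0 (by linarith)
  · rw [Real.sqrt_eq_rpow]
    exact (Real.rpow_le_rpow hQ0 hQP (by norm_num)).trans (hmono _ (by linarith))
  · have := hmono 1 hs1
    rw [Real.rpow_one] at this
    exact hQP.trans this
  · exact hQγ.trans (hmono _ (hg1.trans hs1))
  · refine (mul_le_mul hQP hQγ (by positivity) (by linarith)).trans ?_
    have : P * P ^ (1 / γ) = P ^ s := by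
      rw [hs, show (1 / 2 + 1 / γ + 1 / 2 : ℝ) = 1 + 1 / γ by ring,
        Real.rpow_add (by linarith), Real.rpow_one]
    rw [this]
    exact key

/-- The final comparison: a long collision-free time contradicts the smallness condition. -/
theorem exists_smallness_constant {γ K g Cb cb C₂ : ℝ} (hγ : 1 < γ) (hK : 0 < K) (hg : 0 < g)
    (hCb : 0 < Cb) (hcb : 0 < cb) (hC₂ : 0 < C₂) :
    ∃ C₀, 0 < C₀ ∧ ∀ m E Q A T' σ, 0 < m → 0 ≤ E → Q = K * (E + 1) →
      A = C₀ * max (m ^ (-(1 / 2) : ℝ)) (m ^ (-(3 / 2) : ℝ)) * (1 + E ^ (1 / 2 + 1 / γ + 1 / 2)) →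
      A < 1 → T' = A / (1 - A) → σ = m ^ (-(1 / 2) : ℝ) →
      m * g * (cb * T') ≤ m * (Cb * (σ * √Q))
        + (C₂ * (Cb / T' * (Q + Q ^ (1 / γ)) + σ * Q * Q ^ (1 / γ) + 1 + Q ^ (1 / γ)) * T'
          + C₂ * ((σ + 1) * Q ^ (1 / γ) + 1) * Q + C₂ * Q) → False := by
  obtain ⟨C, hC, hE⟩ := exists_energy_powers_le hγ hK
  obtain ⟨C₃, hC₃⟩ : ∃ C₃, C₃ = C * (Cb + C₂ * (2 * Cb + 5)) := ⟨_, rfl⟩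
  have hC₃0 : 0 < C₃ := by rw [hC₃]; positivity
  -- The factor `3` counts the terms `σ`, `σ²`, `σ³`; the `+ 1` produces the strict inequality that
  -- yields the contradiction.
  refine ⟨3 * C₃ / (g * cb) + 1, by positivity, ?_⟩
  intro m E Q A T' σ hm hE0 hQ hA hA1 hT' hσ hineq
  obtain ⟨e0, e1, e2, e3, e4⟩ := hE E hE0 Q hQ
  obtain ⟨H, hH⟩ : ∃ H, H = 1 + E ^ (1 / 2 + 1 / γ + 1 / 2) := ⟨_, rfl⟩
  rw [← hH] at e0 e1 e2 e3 e4 hA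
  have hH0 : 0 < H := by rw [hH]; positivity
  obtain ⟨R, hR⟩ : ∃ R, R = Q ^ (1 / γ) := ⟨_, rfl⟩
  have hQ0 : 0 ≤ Q := by rw [hQ]; positivity
  have hR0 : 0 ≤ R := by rw [hR]; positivity
  rw [← hR] at e3 e4 hineq
  obtain ⟨M, hM⟩ : ∃ M, M = max (m ^ (-(1 / 2) : ℝ)) (m ^ (-(3 / 2) : ℝ)) := ⟨_, rfl⟩
  have hσ0 : 0 < σ := by rw [hσ]; positivity
  have hM1 : σ ≤ M := by rw [hσ, hM]; exact le_max_left _ _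
  have hσ2 : σ ^ 2 * m = 1 := by
    rw [hσ, ← Real.rpow_natCast, ← Real.rpow_mul hm.le]
    nth_rw 2 [← Real.rpow_one m]
    rw [← Real.rpow_add hm]
    norm_num
  have hσ3 : σ ^ 3 = m ^ (-(3 / 2) : ℝ) := by
    rw [hσ, ← Real.rpow_natCast, ← Real.rpow_mul hm.le]; norm_num
  have hM3 : σ ^ 3 ≤ M := by rw [hσ3, hM]; exact le_max_right _ _
  -- The intermediate power `σ² = 1/m` is bounded by `σ` or by `σ³`, according to the size of `σ`;
  -- this explains the two powers in the maximum.
  have hM2 : σ ^ 2 ≤ M := by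
    rcases le_total σ 1 with h | h
    · exact (by nlinarith : σ ^ 2 ≤ σ).trans hM1
    · exact (by nlinarith [mul_nonneg (sq_nonneg σ) (sub_nonneg.2 h)] : σ ^ 2 ≤ σ ^ 3).trans hM3
  have hM0 : 0 < M := hσ0.trans_le hM1
  rw [← hM] at hA
  have hA0 : 0 < A := by rw [hA]; positivity
  have hT0 : 0 < T' := by rw [hT']; exact div_pos hA0 (by linarith)
  -- This identity is the reason for the time `A/(1-A)`: it cancels the factor `1 + T'` of the error
  -- terms.
  have hAT : T' = A * (1 + T') := by
    rw [hT']
    have : 1 - A ≠ 0 := by linarith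
    field_simp
    ring
  obtain ⟨h, hh⟩ : ∃ h, h = C * H := ⟨_, rfl⟩
  rw [← hh] at e0 e1 e2 e3 e4
  have hh0 : 0 < h := by rw [hh]; positivity
  have b1 : m * (Cb * (σ * √Q)) ≤ m * (Cb * (σ * h)) := by gcongr
  have b2 : C₂ * (Cb / T' * (Q + R) + σ * Q * R + 1 + R) * T'
      = C₂ * (Cb * (Q + R) + (σ * (Q * R) + 1 + R) * T') := by
    field_simp
    ring
  have b3 : C₂ * (Cb * (Q + R) + (σ * (Q * R) + 1 + R) * T')
      ≤ C₂ * (Cb * (h + h) + (σ * h + h + h) * T') := by gcongr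
  have b4 : C₂ * ((σ + 1) * R + 1) * Q + C₂ * Q = C₂ * ((σ + 1) * (Q * R) + (Q + Q)) := by ring
  have b5 : C₂ * ((σ + 1) * (Q * R) + (Q + Q)) ≤ C₂ * ((σ + 1) * h + (h + h)) := by gcongr
  have tot : m * g * (cb * T') ≤ (m * σ + 1 + σ) * (1 + T') * (h * (Cb + C₂ * (2 * Cb + 5))) := by
    have : m * g * (cb * T') ≤ m * (Cb * (σ * h)) + (C₂ * (Cb * (h + h) + (σ * h + h + h) * T')
        + C₂ * ((σ + 1) * h + (h + h))) := by
      rw [b2] at hineq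
      linarith
    refine this.trans ?_
    rw [← sub_nonneg]
    ring_nf
    positivity
  have tot2 : m * g * (cb * T') ≤ (m * σ + 1 + σ) * (1 + T') * (C₃ * H) := by
    rw [hC₃]
    refine tot.trans_eq ?_
    rw [hh]; ring
  -- Using `σ² m = 1`, the mass is extracted from all three error terms and cancels against the
  -- weight.
  have hmσ : (m * σ + 1 + σ) = m * (σ + σ ^ 2 + σ ^ 3) := by
    have : m * (σ + σ ^ 2 + σ ^ 3) = m * σ + (σ ^ 2 * m) + σ * (σ ^ 2 * m) := by ring
    rw [this, hσ2]; ring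
  have tot3 : m * (1 + T') * (g * cb * A) ≤ m * (1 + T') * (3 * M * (C₃ * H)) := by
    calc m * (1 + T') * (g * cb * A) = m * g * (cb * (A * (1 + T'))) := by ring
      _ = m * g * (cb * T') := by rw [← hAT]
      _ ≤ _ := tot2
      _ = m * (1 + T') * ((σ + σ ^ 2 + σ ^ 3) * (C₃ * H)) := by rw [hmσ]; ring
      _ ≤ _ := by gcongr; linarith
  have tot4 : g * cb * A ≤ 3 * M * (C₃ * H) := le_of_mul_le_mul_left tot3 (by positivity)
  rw [hA] at tot4
  have : g * cb * ((3 * C₃ / (g * cb) + 1) * M * H) = 3 * M * (C₃ * H) + g * cb * (M * H) := by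
    field_simp
  have hp : 0 < g * cb * (M * H) := by positivity
  linarith

/-! ### The test function that follows the solid -/

theorem jacX_apply {φ : ℝ × E3 → E3} {z : ℝ × E3} (hφ : DifferentiableAt ℝ φ z) (i j : Fin 3) :
    jacX φ z i j = fderiv ℝ φ z (spaceDir j) i := by
  have h1 : HasFDerivAt (fun y : E3 => (z.1, y)) (ContinuousLinearMap.inr ℝ ℝ E3) z.2 :=
    hasFDerivAt_prodMk_right z.1 z.2
  have h2 : HasFDerivAt (fun y : E3 => φ (z.1, y))
      ((fderiv ℝ φ z).comp (ContinuousLinearMap.inr ℝ ℝ E3)) z.2 :=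
    HasFDerivAt.comp (g := φ) (f := fun y : E3 => (z.1, y)) z.2 hφ.hasFDerivAt h1
  simp only [jacX, jacobian, h2.fderiv]
  simp [spaceDir]

theorem dt_apply {φ : ℝ × E3 → E3} {z : ℝ × E3} (hφ : DifferentiableAt ℝ φ z) :
    dt φ z = fderiv ℝ φ z (1, 0) := by
  have h1 : HasDerivAt (fun s : ℝ => (s, z.2)) ((1 : ℝ), (0 : E3)) z.1 :=
    (hasDerivAt_id z.1).prodMk (hasDerivAt_const _ _)
  exact (HasFDerivAt.comp_hasDerivAt (l := φ) (f := fun s : ℝ => (s, z.2)) z.1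
    hφ.hasFDerivAt h1).deriv

theorem jacX_eq_zero_of_eventuallyEq {φ : ℝ × E3 → E3} {c : ℝ → E3} {z : ℝ × E3}
    (h : ∀ᶠ y in nhds z, φ y = c y.1) : jacX φ z = 0 := by
  have h1 : (fun y => φ (z.1, y)) =ᶠ[nhds z.2] fun _ => c z.1 := by
    have hc : Filter.Tendsto (fun y : E3 => (z.1, y)) (nhds z.2) (nhds z) :=
      (Continuous.prodMk_right z.1).continuousAt
    exact hc.eventually h
  ext i j
  simp [jacX, jacobian, h1.fderiv_eq]

theorem dt_of_eventuallyEq {φ : ℝ × E3 → E3} {ζ : ℝ → ℝ} {z : ℝ × E3}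
    (hζ : DifferentiableAt ℝ ζ z.1)
    (h : ∀ᶠ y in nhds z, φ y = ζ y.1 • e3) : dt φ z = deriv ζ z.1 • e3 := by
  have h1 : (fun s => φ (s, z.2)) =ᶠ[nhds z.1] fun s => ζ s • e3 := by
    have hc : Filter.Tendsto (fun s : ℝ => (s, z.2)) (nhds z.1) (nhds z) :=
      (Continuous.prodMk_left z.2).continuousAt
    exact hc.eventually h
  rw [dt, h1.deriv_eq]
  exact (hζ.hasDerivAt.smul_const e3).deriv

/-- Test functions for the momentum equation adapted to a moving body. -/
theorem exists_movingTest {Ω B : Set E3} {α r₀ d₀ R z₁ : ℝ} (hgeo : Geometry Ω B α r₀)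
    (hα : 0 < α) (hα1 : α ≤ 1 / 3) (hr₀ : 0 < r₀) (hd₀ : 0 < d₀) (hz₁ : 0 < z₁) :
    ∃ C Cb cb, 0 < C ∧ 0 < Cb ∧ 0 < cb ∧ ∀ (T T' : ℝ) (h : ℝ → ℝ) (L : ℝ≥0) (δ : ℝ),
      0 < T' → T' < T → LipschitzOnWith L h (Icc 0 T') → 0 < δ →
      (∀ t ∈ Icc 0 T', δ ≤ h t ∧ h t + 1 ≤ R ∧ bodyAt B (h t) ⊆ Ω ∧
        ∀ x ∈ bodyAt B (h t), ∀ y ∈ frontier Ω \ flatPatch r₀, d₀ ≤ dist x y) →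
      ∃ (φ : ℝ × E3 → E3) (ζ : ℝ → ℝ), IsSpaceTimeTest T Ω φ ∧
        ContDiff ℝ (⊤ : ℕ∞) ζ ∧ (∀ t, 0 ≤ ζ t) ∧ (∀ t, ζ t ≤ 1) ∧ (∀ t, |deriv ζ t| ≤ Cb / T') ∧
        ∫ t in Ioo 0 T', ζ t = cb * T' ∧
        (∀ t ∈ Icc 0 T', ∀ x ∈ bodyAt B (h t), ∀ᶠ z in nhds (t, x), φ z = ζ z.1 • e3) ∧
        (∀ t x, t ∉ Ioo 0 T' → ∀ᶠ z in nhds (t, x), φ z = 0) ∧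
        (∀ z, (jacX φ z).trace = 0) ∧
        ∀ t x, ‖x‖ ≤ R → (∀ i, x i ≠ 0) →
          ‖dt φ (t, x)‖ ≤ C * (Cb / T' * singWeight (1 / 6) x + L * (1 + (tipZone r₀ z₁).indicator
            (singWeight ((1 + 2 * α) / (3 + α))) x)) ∧
          ‖φ (t, x)‖ ≤ C * singWeight (1 / 6) x ∧
          ∀ i j, |jacX φ (t, x) i j| ≤ C * (1 + (tipZone r₀ z₁).indicator
            (singWeight ((1 + 2 * α) / (3 + α))) x) := by
  obtain ⟨C, hC, hW⟩ := exists_testField (R := R) hgeo hα hα1 hr₀ hd₀ hz₁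
  obtain ⟨Cb, cb, hCb, hcb, hζ⟩ := exists_timeCutoff
  refine ⟨C, Cb, cb, hC, hCb, hcb, ?_⟩
  intro T T' h L δ hT' hTT hL hδ hh
  obtain ⟨η, hη, W, hWs, hWd, hWb, hWo, hWn⟩ := hW δ hδ
  obtain ⟨ζ, hζs, hζ0, hζ1, hζsupp, hζd, hζi⟩ := hζ T' hT'
  -- Clamping time to `[0, T']` extends the height to a globally Lipschitz function without
  -- enlarging its constant.
  obtain ⟨c, hc⟩ : ∃ c : ℝ → ℝ, c = fun t => max 0 (min T' t) := ⟨_, rfl⟩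
  have hcm : ∀ t, c t ∈ Icc 0 T' := fun t => by
    rw [hc]; exact ⟨le_max_left _ _, max_le hT'.le (min_le_left _ _)⟩
  have hcid : ∀ t ∈ Icc 0 T', c t = t := fun t ht => by
    rw [hc]; simp [ht.1, ht.2]
  have hcl : LipschitzWith 1 c := by
    rw [hc]; exact (LipschitzWith.id.const_min T').const_max 0
  have hhc : LipschitzWith L (fun t => h (c t)) := by
    refine LipschitzWith.of_dist_le_mul fun s t => ?_
    refine (hL.dist_le_mul _ (hcm s) _ (hcm t)).trans ?_
    gcongr
    simpa using hcl.dist_le_mul s t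
  -- The three tolerances: `η` keeps the field adapted to the true position of the solid, `δ/2`
  -- keeps the approximate height positive, and `1` keeps it below `R`.
  obtain ⟨k, hks, hkn, hkd⟩ := exists_contDiff_near_lipschitz hhc
    (ε := min (min η (δ / 2)) 1) (by positivity)
  have hk0 : ∀ t, 0 < k t := fun t => by
    have h1 := (hh _ (hcm t)).1
    have h2 := abs_le.1 ((hkn t).trans ((min_le_left _ _).trans (min_le_right _ _)))
    linarith [h2.1]
  have hkR : ∀ t, k t ≤ R := fun t => by
    have h1 := (hh _ (hcm t)).2.1
    have h2 := abs_le.1 ((hkn t).trans (min_le_right _ _))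
    linarith [h2.2]
  have hkη : ∀ t ∈ Icc 0 T', |k t - h t| ≤ η := fun t ht => by
    have := (hkn t).trans ((min_le_left _ _).trans (min_le_left _ _))
    rwa [hcid t ht] at this
  have hζz : ∀ t, t ∉ Ioo 0 T' → ∀ᶠ s in nhds t, ζ s = 0 := by
    intro t ht
    have hcl : IsClosed (Icc (T' / 4) (3 * T' / 4)) := isClosed_Icc
    have : t ∈ (Icc (T' / 4) (3 * T' / 4))ᶜ := fun h' => ht ⟨by linarith [h'.1], by linarith [h'.2]⟩
    filter_upwards [hcl.isOpen_compl.mem_nhds this] with s hs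
    by_contra hne
    exact hs (hζsupp s hne)
  obtain ⟨φ, hφ⟩ : ∃ φ : ℝ × E3 → E3, φ = fun z => ζ z.1 • W (k z.1, z.2) := ⟨_, rfl⟩
  have hzero : ∀ t x, t ∉ Ioo 0 T' → ∀ᶠ z in nhds (t, x), φ z = 0 := by
    intro t x ht
    filter_upwards [continuous_fst.continuousAt.eventually (hζz t ht)] with z hz
    rw [hφ]; simp [hz]
  have hkc : Continuous k := hks.continuous
  have hpair : ∀ t x, Filter.Tendsto (fun z : ℝ × E3 => (k z.1, z.2)) (nhds (t, x))
      (nhds (k t, x)) := fun t x =>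
    (by fun_prop : Continuous fun z : ℝ × E3 => (k z.1, z.2)).continuousAt
  have hkz : ContDiff ℝ (⊤ : ℕ∞) fun z : ℝ × E3 => (k z.1, z.2) :=
    (hks.comp contDiff_fst).prodMk contDiff_snd
  have hφs : ContDiff ℝ (⊤ : ℕ∞) φ := by
    rw [contDiff_iff_contDiffAt]
    intro z
    rw [hφ]
    refine (hζs.comp contDiff_fst).contDiffAt.smul ?_
    exact ContDiffAt.comp (g := W) z (hWs (k z.1, z.2) (hk0 _)) hkz.contDiffAt
  have hφd : ∀ z, DifferentiableAt ℝ φ z := fun z => (hφs.differentiable (by simp)) z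
  -- The field vanishes near every point outside `Ω`, and `ζ` vanishes near every time outside `(0,
  -- T')`. This local vanishing is what puts the closed support inside the open cylinder.
  have hout : ∀ z, z ∉ Iio T ×ˢ Ω → ∀ᶠ y in nhds z, φ y = 0 := by
    rintro ⟨t, x⟩ hz
    by_cases ht : t ∈ Ioo 0 T'
    · have hx : x ∉ Ω := fun hx => hz ⟨ht.2.trans hTT, hx⟩
      have ht' := Ioo_subset_Icc_self ht
      obtain ⟨a1, a2, a3, a4⟩ := hh t ht'
      filter_upwards [(hpair t x).eventually (hWo (k t) (h t) x a1 (hkη t ht') a3 a4 hx)] with y hy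
      rw [hφ]; simp [hy]
    · exact hzero t x ht
  have hts : tsupport φ ⊆ Iio T ×ˢ Ω := by
    intro z hz
    by_contra hcon
    exact (notMem_tsupport_iff_eventuallyEq.2 (hout z hcon)) hz
  have hts2 : tsupport φ ⊆ Icc 0 T' ×ˢ closure Ω := by
    intro z hz
    refine ⟨?_, subset_closure (hts hz).2⟩
    by_contra hcon
    exact (notMem_tsupport_iff_eventuallyEq.2
      (hzero z.1 z.2 fun h' => hcon (Ioo_subset_Icc_self h'))) hz
  have hcomp : HasCompactSupport φ :=
    HasCompactSupport.intro' (isCompact_Icc.prod hgeo.container_bounded.isCompact_closure)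
      (isClosed_Icc.prod isClosed_closure) fun z hz => image_eq_zero_of_notMem_tsupport
        fun h' => hz (hts2 h')
  have hfd : ∀ t x, HasFDerivAt W (fderiv ℝ W (k t, x)) (k t, x) := fun t x =>
    ((hWs (k t, x) (hk0 t)).differentiableAt (by simp)).hasFDerivAt
  have hjac : ∀ t x i j, jacX φ (t, x) i j = ζ t * fderiv ℝ W (k t, x) (spaceDir j) i := by
    intro t x i j
    have h1 : HasFDerivAt (fun y : E3 => (k t, y)) (ContinuousLinearMap.inr ℝ ℝ E3) x :=
      hasFDerivAt_prodMk_right (k t) x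
    have h2 : HasFDerivAt (fun y : E3 => ζ t • W (k t, y))
        (ζ t • (fderiv ℝ W (k t, x)).comp (ContinuousLinearMap.inr ℝ ℝ E3)) x :=
      (HasFDerivAt.comp (g := W) (f := fun y : E3 => (k t, y)) x (hfd t x) h1).const_smul (ζ t)
    rw [hφ]
    simp only [jacX, jacobian, h2.fderiv]
    simp [spaceDir]
  have hdt : ∀ t x, dt φ (t, x) = ζ t • (deriv k t • fderiv ℝ W (k t, x) (1, 0))
      + deriv ζ t • W (k t, x) := by
    intro t x
    have hkt : HasDerivAt k (deriv k t) t := ((hks.differentiable (by simp)) t).hasDerivAt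
    have hζt : HasDerivAt ζ (deriv ζ t) t := ((hζs.differentiable (by simp)) t).hasDerivAt
    have h1 : HasDerivAt (fun s : ℝ => (k s, x)) (deriv k t, (0 : E3)) t :=
      hkt.prodMk (hasDerivAt_const _ _)
    have h2 : HasDerivAt (fun s => W (k s, x)) (fderiv ℝ W (k t, x) (deriv k t, 0)) t :=
      HasFDerivAt.comp_hasDerivAt (l := W) (f := fun s : ℝ => (k s, x)) t (hfd t x) h1
    have h3 := (hζt.fun_smul h2).deriv
    have e : ((deriv k t, 0) : ℝ × E3) = deriv k t • (1, 0) := by simp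
    rw [hφ]
    simp only [dt]
    rw [h3, e, map_smul]
  refine ⟨φ, ζ, ⟨hφs, hcomp, hts⟩, hζs, hζ0, hζ1, hζd, hζi, ?_, hzero, ?_, ?_⟩
  · intro t ht x hx
    filter_upwards [(hpair t x).eventually (hWb (k t) (h t) x (hh t ht).1 (hkη t ht) hx)] with z hz
    rw [hφ]; simp [hz]
  · rintro ⟨t, x⟩
    rw [Matrix.trace]
    simp only [Matrix.diag_apply, hjac]
    rw [← Finset.mul_sum, hWd (k t, x) (hk0 t), mul_zero]
  · intro t x hxR hx0
    obtain ⟨w1, w2⟩ := hWn (k t) x (hk0 t) (hkR t) hxR hx0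
    have hζa : |ζ t| ≤ 1 := by rw [abs_of_nonneg (hζ0 t)]; exact hζ1 t
    have hn0 : 0 ≤ 1 + (tipZone r₀ z₁).indicator (singWeight ((1 + 2 * α) / (3 + α))) x :=
      add_nonneg zero_le_one (indicator_nonneg (fun y _ => singWeight_nonneg _ _) x)
    have hw0 : 0 ≤ singWeight (1 / 6) x := singWeight_nonneg _ _
    have hone : ‖((1 : ℝ), (0 : E3))‖ = 1 := by simp [Prod.norm_def]
    refine ⟨?_, ?_, ?_⟩
    · rw [hdt]
      have p1 : ‖ζ t • (deriv k t • fderiv ℝ W (k t, x) (1, 0))‖ ≤ L * (C * (1 + (tipZone r₀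
          z₁).indicator (singWeight ((1 + 2 * α) / (3 + α))) x)) := by
        rw [norm_smul, norm_smul, Real.norm_eq_abs, Real.norm_eq_abs]
        have q := (fderiv ℝ W (k t, x)).le_opNorm (1, 0)
        rw [hone, mul_one] at q
        calc _ ≤ 1 * (L * (C * (1 + (tipZone r₀
          z₁).indicator (singWeight ((1 + 2 * α) / (3 + α))) x))) := by
              gcongr
              · exact hkd t
              · exact q.trans w2
          _ = _ := one_mul _
      have p2 : ‖deriv ζ t • W (k t, x)‖ ≤ Cb / T' * (C * singWeight (1 / 6) x) := by
        rw [norm_smul, Real.norm_eq_abs]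
        gcongr
        exact hζd t
      refine (norm_add_le _ _).trans ((add_le_add p1 p2).trans_eq ?_)
      ring
    · rw [hφ]
      simp only [norm_smul, Real.norm_eq_abs]
      exact (mul_le_of_le_one_left (norm_nonneg _) hζa).trans w1
    · intro i j
      rw [hjac, abs_mul]
      refine (mul_le_of_le_one_left (abs_nonneg _) hζa).trans ?_
      refine (abs_coord_le_norm _ i).trans ?_
      refine ((fderiv ℝ W (k t, x)).le_opNorm _).trans ?_
      rw [norm_spaceDir, mul_one]
      exact w2

/-! ### Motion of the solid before a collision -/

theorem rigidVelocity_apply_two (G : E3) (V ω : ℝ) (x : E3) : rigidVelocity G V ω x 2 = V := by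
  simp [rigidVelocity, cross, e3, unitVec]

theorem abs_le_norm_rigidVelocity (G : E3) (V ω : ℝ) (x : E3) : |V| ≤ ‖rigidVelocity G V ω x‖ := by
  have h := abs_coord_le_norm (rigidVelocity G V ω x) 2
  rwa [rigidVelocity_apply_two] at h

theorem inner_e3 (v : E3) : inner ℝ v e3 = v 2 := by
  simp [e3, unitVec, EuclideanSpace.inner_single_right]

namespace IsWeakSolution

variable {M : FluidModel} {Ω B : Set E3} {α r₀ g T : ℝ} {D : InitialData} {w : Motion}

theorem continuousOn_height (hw : IsWeakSolution M Ω B g D T w) {T' : ℝ} (hT' : 0 ≤ T')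
    (hTT : T' < T) : ContinuousOn w.h (Icc 0 T') := by
  have h1 := intervalIntegral.continuousOn_primitive_interval' hw.velocity_integrable
    (left_mem_uIcc)
  have h2 : ContinuousOn (fun t => D.h₀ + ∫ s in (0 : ℝ)..t, w.V s) (Icc 0 T') := by
    refine continuousOn_const.add (h1.mono ?_)
    rw [uIcc_of_le (by linarith)]
    exact Icc_subset_Icc_right hTT.le
  exact h2.congr fun t ht => hw.height_eq t ⟨ht.1, ht.2.trans_lt hTT⟩

theorem height_zero (hw : IsWeakSolution M Ω B g D T w) (hT : 0 < T) : w.h 0 = D.h₀ := by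
  rw [hw.height_eq 0 ⟨le_rfl, hT⟩]; simp

/-- A body that has not met the container's boundary has positive height. -/
theorem height_pos (hw : IsWeakSolution M Ω B g D T w) (hgeo : Geometry Ω B α r₀) (hα : 0 < α)
    (hr₀ : 0 < r₀) (hD : D.Admissible M Ω B) {T' : ℝ} (hT' : 0 ≤ T') (hTT : T' < T)
    (hno : ∀ t, 0 < t → t ≤ T' → w.solid B t ∩ frontier Ω = ∅) :
    ∀ t ∈ Icc 0 T', 0 < w.h t := by
  intro t ht
  by_contra hneg
  have h0 := hw.height_zero (hT'.trans_lt hTT)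
  have hpos : 0 < w.h 0 := h0 ▸ hD.height_pos
  have hc := (hw.continuousOn_height hT' hTT).mono (Icc_subset_Icc_right ht.2)
  -- A nonpositive height would be preceded by a zero of the height at a positive time, when the tip
  -- sits at the origin, a point of `∂Ω`.
  obtain ⟨s, hs, hs0⟩ := intermediate_value_Icc' ht.1 hc ⟨not_lt.1 hneg, hpos.le⟩
  have hs1 : 0 < s := lt_of_le_of_ne hs.1 fun h => by rw [← h] at hs0; linarith
  have hmem : (0 : E3) ∈ w.solid B s := by
    have := hgeo.tip_mem_bodyAt hα hr₀ 0
    rw [Motion.solid, hs0]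
    simpa using this
  have hfr : (0 : E3) ∈ frontier Ω :=
    hgeo.mem_frontier_of_mem_flatPatch (by simp [flatPatch, hr₀.le])
  have := hno s hs1 (hs.2.trans ht.2)
  exact (this ▸ ⟨hmem, hfr⟩ : (0 : E3) ∈ (∅ : Set E3))

theorem solid_subset (hw : IsWeakSolution M Ω B g D T w) (hgeo : Geometry Ω B α r₀)
    (hD : D.Admissible M Ω B) {T' : ℝ} (hT' : 0 ≤ T') (hTT : T' < T)
    (hno : ∀ t, 0 < t → t ≤ T' → w.solid B t ∩ frontier Ω = ∅) :
    ∀ t ∈ Icc 0 T', bodyAt B (w.h t) ⊆ Ω := by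
  intro t ht x hx
  rcases eq_or_lt_of_le ht.1 with h | h
  · rw [← h, hw.height_zero (hT'.trans_lt hTT)] at hx
    exact hD.body_inside hx
  · have h1 := hw.body_in_container t ⟨ht.1, ht.2.trans_lt hTT⟩ hx
    by_contra hcon
    have hΩ : IsOpen Ω := hgeo.container_regular.1
    have h2 : x ∈ frontier Ω := by
      rw [hΩ.frontier_eq]; exact ⟨h1, hcon⟩
    have := hno t h ht.2
    exact (this ▸ ⟨hx, h2⟩ : x ∈ (∅ : Set E3))

/-- Rotation about the vertical axis is horizontal, so the vertical component of the velocity is `V`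
throughout the solid. Hence `m V²` is at most the part of `∫ ρ|u|²` carried by the solid, which lies
in `Ω` as long as there is no collision. -/
theorem ae_velocity_le (hw : IsWeakSolution M Ω B g D T w) (hgeo : Geometry Ω B α r₀)
    (hD : D.Admissible M Ω B) {K : ℝ} (hK : UniformBounds M Ω B D T K w) {T' : ℝ} (hT' : 0 ≤ T')
    (hTT : T' < T) (hQ : 0 ≤ K * (D.energy M Ω B + 1))
    (hno : ∀ t, 0 < t → t ≤ T' → w.solid B t ∩ frontier Ω = ∅) :
    ∀ᵐ t ∂volume.restrict (Ioo 0 T'),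
      |w.V t| ≤ D.mass B ^ (-(1 / 2) : ℝ) * √(K * (D.energy M Ω B + 1)) := by
  have hm := hgeo.mass_pos hD.solid_density_pos
  have hle : volume.restrict (Ioo 0 T') ≤ volume.restrict (Ioo 0 T) :=
    Measure.restrict_mono (Ioo_subset_Ioo_right hTT.le) le_rfl
  filter_upwards [ae_mono hle hK.kinetic, ae_mono hle hw.ρ_solid, ae_mono hle hw.u_solid,
    ae_restrict_mem measurableSet_Ioo] with t h1 h2 h3 h4
  have hsub := hw.solid_subset hgeo hD hT' hTT hno t (Ioo_subset_Icc_self h4)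
  have h5 : ENNReal.ofReal (D.ρS * w.V t ^ 2) * volume B ≤ ENNReal.ofReal
      (K * (D.energy M Ω B + 1)) := by
    refine le_trans ?_ h1
    refine le_trans ?_ (lintegral_mono_set hsub)
    rw [← volume_bodyAt B (w.h t), ← setLIntegral_const]
    refine lintegral_mono_ae ?_
    filter_upwards [h2, h3] with x hx hx'
    rw [hx, hx']
    apply ENNReal.ofReal_le_ofReal
    have := abs_le_norm_rigidVelocity (centerOfMass (w.solid B t)) (w.V t) (w.ω t) x
    have h6 : w.V t ^ 2 ≤ ‖rigidVelocity (centerOfMass (w.solid B t)) (w.V t) (w.ω t) x‖ ^ 2 := by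
      rw [← sq_abs]; gcongr
    exact mul_le_mul_of_nonneg_left h6 hD.solid_density_pos.le
  have h6 : D.mass B * w.V t ^ 2 ≤ K * (D.energy M Ω B + 1) := by
    have hB : volume B = ENNReal.ofReal (volume B).toReal :=
      (ENNReal.ofReal_toReal hgeo.body_compact.measure_lt_top.ne).symm
    rw [hB, ← ENNReal.ofReal_mul (mul_nonneg hD.solid_density_pos.le (sq_nonneg _))] at h5
    have := (ENNReal.ofReal_le_ofReal_iff hQ).1 h5
    rw [Geometry.mass_eq]
    linarith
  obtain ⟨m, hmdef⟩ : ∃ m, m = D.mass B := ⟨_, rfl⟩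
  rw [← hmdef] at h6 hm ⊢
  have hσ : m ^ (-(1 / 2) : ℝ) = (√m)⁻¹ := by
    rw [Real.sqrt_eq_rpow, Real.rpow_neg hm.le]
  have hs : 0 < √m := Real.sqrt_pos.2 hm
  rw [hσ, inv_mul_eq_div, le_div_iff₀ hs]
  refine Real.le_sqrt_of_sq_le ?_
  rw [mul_pow, sq_abs, Real.sq_sqrt hm.le]
  linarith

theorem lipschitzOnWith_height (hw : IsWeakSolution M Ω B g D T w) {T' : ℝ} (hTT : T' < T)
    {L : ℝ≥0} (hV : ∀ᵐ t ∂volume.restrict (Ioo 0 T'), |w.V t| ≤ L) :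
    LipschitzOnWith L w.h (Icc 0 T') := by
  have hT0 : ∀ t ∈ Icc 0 T', t ∈ Ico 0 T := fun t ht => ⟨ht.1, ht.2.trans_lt hTT⟩
  have hi : ∀ t ∈ Icc 0 T', IntervalIntegrable w.V volume 0 t := fun t ht =>
    hw.velocity_integrable.mono_set (by
      rw [uIcc_of_le ht.1, uIcc_of_le ((hT0 t ht).1.trans (hT0 t ht).2.le)]
      exact Icc_subset_Icc_right (hT0 t ht).2.le)
  refine LipschitzOnWith.of_dist_le_mul fun s hs t ht => ?_
  rw [Real.dist_eq, hw.height_eq s (hT0 s hs), hw.height_eq t (hT0 t ht), add_sub_add_left_eq_sub,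
    intervalIntegral.integral_interval_sub_left (hi s hs) (hi t ht), Real.dist_eq,
    ← Real.norm_eq_abs]
  refine intervalIntegral.norm_integral_le_of_norm_le_const_ae ?_
  have h1 := (ae_restrict_iff' measurableSet_Ioo).1 hV
  have h2 : ∀ᵐ x : ℝ, x ≠ T' := by
    simp [ae_iff]
  filter_upwards [h1, h2] with x hx hx' hxm
  rw [Real.norm_eq_abs]
  refine hx ⟨?_, ?_⟩
  · exact (le_min ht.1 hs.1).trans_lt hxm.1
  · exact lt_of_le_of_ne (hxm.2.trans (max_le ht.2 hs.2)) hx'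

end IsWeakSolution

/-- Heights of bodies inside a bounded container are bounded. -/
theorem Geometry.exists_height_le {Ω B : Set E3} {α r₀ : ℝ} (hgeo : Geometry Ω B α r₀)
    (hα : 0 < α) (hr₀ : 0 < r₀) :
    ∃ R, (∀ x ∈ Ω, ‖x‖ ≤ R) ∧ ∀ h, bodyAt B h ⊆ Ω → h + 1 ≤ R := by
  obtain ⟨R, hR⟩ := hgeo.container_bounded.exists_norm_le
  refine ⟨R + 1, fun x hx => (hR x hx).trans (by linarith), fun h hh => ?_⟩
  have h1 := hR _ (hh (hgeo.tip_mem_bodyAt hα hr₀ h))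
  rw [norm_smul, norm_e3, mul_one] at h1
  linarith [le_abs_self h, Real.norm_eq_abs h]

/-! ### The momentum balance -/

/-- If a function of `(t, x)` with zero integral equals `k t` on a set of volume `v` for each `t`,
and the integral of its modulus outside this set is at most `b t`, then `v ∫ k` is at most `∫ b`. -/
theorem abs_mul_integral_le_of_sections {μ : Measure ℝ} [SFinite μ] {Ω : Set E3}
    {I : ℝ × E3 → ℝ} (hI : AEMeasurable I (μ.prod (volume.restrict Ω)))
    {S : ℝ → Set E3} {v : ℝ≥0∞} (hv : v < ∞) {k : ℝ → ℝ} (hk : Integrable k μ)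
    {b : ℝ → ℝ≥0∞} {β : ℝ} (hβ : 0 ≤ β)
    (hS : ∀ᵐ t ∂μ, MeasurableSet (S t) ∧ S t ⊆ Ω ∧ volume (S t) = v ∧
      ∀ᵐ x ∂volume.restrict (S t), I (t, x) = k t)
    (hb : ∀ᵐ t ∂μ, ∫⁻ x in Ω \ S t, ‖I (t, x)‖ₑ ≤ b t) (hbβ : ∫⁻ t, b t ∂μ ≤ ENNReal.ofReal β)
    (h0 : ∫ z, I z ∂(μ.prod (volume.restrict Ω)) = 0) :
    |v.toReal * ∫ t, k t ∂μ| ≤ β := by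
  -- Integrability must be proved from the bounds on the sections: the integral of a non-integrable
  -- function is `0` by convention, so `h0` alone would carry no information.
  have hint : Integrable I (μ.prod (volume.restrict Ω)) := by
    refine ⟨hI.aestronglyMeasurable, ?_⟩
    rw [HasFiniteIntegral, lintegral_prod _ hI.enorm]
    calc ∫⁻ t, (∫⁻ x in Ω, ‖I (t, x)‖ₑ) ∂μ ≤ ∫⁻ t, (‖k t‖ₑ * v + b t) ∂μ := by
          refine lintegral_mono_ae ?_
          filter_upwards [hS, hb] with t ⟨h1, h2, h3, h4⟩ h5
          have e := lintegral_inter_add_sdiff (μ := volume) (fun x => ‖I (t, x)‖ₑ) Ω h1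
          rw [inter_eq_self_of_subset_right h2] at e
          rw [← e]
          refine add_le_add ?_ h5
          rw [← h3, ← setLIntegral_const]
          refine lintegral_mono_ae ?_
          filter_upwards [h4] with x hx
          rw [hx]
      _ = (∫⁻ t, ‖k t‖ₑ ∂μ) * v + ∫⁻ t, b t ∂μ := by
          rw [lintegral_add_left' (hk.1.enorm.mul_const _), lintegral_mul_const' _ _ hv.ne]
      _ < ∞ := ENNReal.add_lt_top.2 ⟨ENNReal.mul_lt_top hk.2 hv,
          hbβ.trans_lt ENNReal.ofReal_lt_top⟩
  have hJ : ∀ᵐ t ∂μ, ‖(∫ x in Ω, I (t, x)) - v.toReal * k t‖ₑ ≤ b t := by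
    filter_upwards [hS, hb, hint.prod_right_ae] with t ⟨h1, h2, h3, h4⟩ h5 h6
    have e := integral_inter_add_sdiff (μ := volume) (f := fun x => I (t, x)) h1 h6
    rw [inter_eq_self_of_subset_right h2] at e
    have e2 : ∫ x in S t, I (t, x) = v.toReal * k t := by
      rw [integral_congr_ae h4, setIntegral_const, smul_eq_mul, Measure.real, h3]
    rw [← e, e2, add_sub_cancel_left]
    exact (enorm_integral_le_lintegral_enorm _).trans h5
  have h1 : ∫ t, ((∫ x in Ω, I (t, x)) - v.toReal * k t) ∂μ = -(v.toReal * ∫ t, k t ∂μ) := by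
    rw [integral_sub hint.integral_prod_left (hk.const_mul _), ← integral_prod _ hint, h0,
      integral_const_mul, zero_sub]
  have h2 : ‖-(v.toReal * ∫ t, k t ∂μ)‖ₑ ≤ ENNReal.ofReal β := by
    rw [← h1]
    exact (enorm_integral_le_lintegral_enorm _).trans ((lintegral_mono_ae hJ).trans hbβ)
  rw [← ofReal_norm, norm_neg, Real.norm_eq_abs] at h2
  exact (ENNReal.ofReal_le_ofReal_iff hβ).1 h2

/-- The coefficients are controlled only for positive temperatures; extending them by zero gives a
measurable function without changing the composition almost everywhere. -/
theorem aemeasurable_comp_of_continuousOn_Ioi {X : Type*} [MeasurableSpace X] {μ : Measure X}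
    {f : ℝ → ℝ} (hf : ContinuousOn f (Ioi 0)) {θ : X → ℝ} (hθ : AEMeasurable θ μ)
    (hθ0 : ∀ᵐ x ∂μ, 0 < θ x) : AEMeasurable (fun x => f (θ x)) μ := by
  classical
  have hm : Measurable ((Ioi (0 : ℝ)).piecewise f 0) :=
    hf.measurable_piecewise continuousOn_const measurableSet_Ioi
  refine (hm.comp_aemeasurable hθ).congr ?_
  filter_upwards [hθ0] with x hx
  exact piecewise_eq_of_mem _ _ _ (mem_Ioi.2 hx)

theorem ddot_zero_right (A : Mat3) : ddot A 0 = 0 := by simp [ddot]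

theorem aemeasurable_ddot {X : Type*} [MeasurableSpace X] {μ : Measure X} {A J : X → Mat3}
    (hA : ∀ i j, AEMeasurable (fun x => A x i j) μ) (hJ : ∀ i j, AEMeasurable (fun x => J x i j) μ) :
    AEMeasurable (fun x => ddot (A x) (J x)) μ := by
  unfold ddot
  exact Finset.aemeasurable_fun_sum _ fun i _ => Finset.aemeasurable_fun_sum _ fun j _ =>
    (hA i j).mul (hJ i j)

theorem aemeasurable_momentumDensity {X : Type*} [MeasurableSpace X] {ν : Measure X}
    {M : FluidModel} (hM : M.Admissible) {g : ℝ} {ρ θ : X → ℝ} {u P Φ : X → E3} {A J : X → Mat3}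
    (hρ : AEMeasurable ρ ν) (hθ : AEMeasurable θ ν) (hθ0 : ∀ᵐ x ∂ν, 0 < θ x)
    (hu : AEMeasurable u ν) (hA : ∀ i j, AEMeasurable (fun x => A x i j) ν)
    (hP : AEMeasurable P ν) (hΦ : AEMeasurable Φ ν)
    (hJ : ∀ i j, AEMeasurable (fun x => J x i j) ν) (hJ0 : ∀ x, (J x).trace = 0) :
    AEMeasurable (fun x => momentumDensity M g (ρ x) (θ x) (u x) (A x) (P x) (J x) (Φ x)) ν := by
  obtain ⟨L, hL⟩ := hM.μ_lipschitz
  have hμ := aemeasurable_comp_of_continuousOn_Ioi hL.continuousOn hθ hθ0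
  have hη := aemeasurable_comp_of_continuousOn_Ioi hM.η_cont hθ hθ0
  have hui : ∀ i, AEMeasurable (fun x => u x i) ν := fun i =>
    (by fun_prop : Measurable fun y : E3 => y i).comp_aemeasurable hu
  have htr : AEMeasurable (fun x => (A x).trace) ν := by
    simp only [Matrix.trace, Matrix.diag_apply]
    exact Finset.aemeasurable_fun_sum _ fun i _ => hA i i
  have hS : ∀ i j, AEMeasurable (fun x => M.stress (θ x) (A x) i j) ν := by
    intro i j
    simp only [FluidModel.stress, Matrix.add_apply, Matrix.sub_apply, Matrix.smul_apply,
      Matrix.transpose_apply, smul_eq_mul]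
    have h1 := hA i j
    have h2 := hA j i
    fun_prop
  unfold momentumDensity
  simp only [hJ0, mul_zero, add_zero]
  refine AEMeasurable.add (AEMeasurable.sub (AEMeasurable.add ?_ ?_) ?_) ?_
  · exact hρ.mul (hu.inner hP)
  · exact hρ.mul (aemeasurable_ddot (fun i j => (hui i).mul (hui j)) hJ)
  · exact aemeasurable_ddot hS hJ
  · exact hρ.mul (aemeasurable_const.inner hΦ)

theorem volume_restrict_cylinder (T : ℝ) (Ω : Set E3) :
    (volume : Measure (ℝ × E3)).restrict (cylinder T Ω)
      = (volume.restrict (Ioo 0 T)).prod (volume.restrict Ω) := by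
  rw [Measure.prod_restrict]; rfl

theorem aemeasurable_section {F : Type*} [MeasurableSpace F] {μ : Measure ℝ} {ν : Measure E3}
    [SFinite ν] {f : ℝ × E3 → F} (hf : AEMeasurable f (μ.prod ν)) :
    ∀ᵐ t ∂μ, AEMeasurable (fun x => f (t, x)) ν := by
  filter_upwards [Measure.ae_ae_of_ae_prod hf.ae_eq_mk] with t ht
  exact ⟨fun x => hf.mk f (t, x), hf.measurable_mk.comp measurable_prodMk_left, ht⟩

theorem momentumDensity_zero (M : FluidModel) (g ρ θ : ℝ) (u : E3) (A : Mat3) :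
    momentumDensity M g ρ θ u A 0 0 0 = 0 := by
  have h : ddot (fun i j => u i * u j) 0 = 0 := ddot_zero_right _
  simp [momentumDensity, h, ddot_zero_right]

/-- For a locally constant vertical field the convection, pressure and stress terms vanish. What
remains sees only the vertical velocity, so on the solid it depends on time alone. -/
theorem momentumDensity_rigid (M : FluidModel) (g ρ θ : ℝ) (u : E3) (A : Mat3) (a b : ℝ) :
    momentumDensity M g ρ θ u A (a • e3) 0 (b • e3) = ρ * (a * u 2 - g * b) := by
  have h : inner ℝ e3 e3 = (1 : ℝ) := by rw [inner_e3]; simp [e3, unitVec]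
  have h' : ddot (fun i j => u i * u j) 0 = 0 := ddot_zero_right _
  simp only [momentumDensity, ddot_zero_right, h', Matrix.trace_zero, inner_smul_right,
    inner_smul_left, inner_e3]
  simp [e3, unitVec]
  ring

/-- The momentum balance tested with the moving test field, as long as there is no collision. -/
theorem exists_momentum_balance_le {M : FluidModel} (hM : M.Admissible) (hγ : 3 < M.γ)
    (hβ : 2 < M.β) {α g r₀ d₀ K : ℝ} (hα₀ : 0 < α)
    (hα : α < min (3 * (M.γ - 3) / (4 * M.γ + 3)) (3 * (M.β - 2) / (9 * M.β + 2)))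
    (hg : 0 < g) (hr₀ : 0 < r₀) (hd₀ : 0 < d₀) (hK : 0 < K) {Ω B : Set E3}
    (hgeo : Geometry Ω B α r₀) :
    ∃ Cb cb C₂ : ℝ, 0 < Cb ∧ 0 < cb ∧ 0 < C₂ ∧
      ∀ (D : InitialData) (T : ℝ) (w : Motion), D.Admissible M Ω B →
        IsWeakSolution M Ω B g D T w → CollisionOnlyAtTip Ω B r₀ d₀ T w →
        UniformBounds M Ω B D T K w → ∀ T' m Q σ, 0 < T' → T' < T → m = D.mass B →
        Q = K * (D.energy M Ω B + 1) → σ = m ^ (-(1 / 2) : ℝ) →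
        (∀ t, 0 < t → t ≤ T' → w.solid B t ∩ frontier Ω = ∅) →
        m * g * (cb * T') ≤ m * (Cb * (σ * √Q))
          + (C₂ * (Cb / T' * (Q + Q ^ (1 / M.γ)) + σ * Q * Q ^ (1 / M.γ) + 1 + Q ^ (1 / M.γ)) * T'
            + C₂ * ((σ + 1) * Q ^ (1 / M.γ) + 1) * Q + C₂ * Q) := by
  obtain ⟨hαγ, hαβ⟩ := lt_min_iff.1 hα
  rw [lt_div_iff₀ (by linarith)] at hαγ hαβ
  have hα1 : α ≤ 1 / 3 := by nlinarith
  have hΩo : IsOpen Ω := hgeo.container_regular.1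
  have hΩm : MeasurableSet Ω := hΩo.measurableSet
  have hb := hgeo.container_bounded
  obtain ⟨ε, hε, hflat⟩ := hgeo.flat_bottom
  obtain ⟨R, hR, hRh⟩ := hgeo.exists_height_le hα₀ hr₀
  have htip : tipZone r₀ (ε / 2) ⊆ Ω := by
    rintro x ⟨h1, h2, h3⟩
    have a0 := abs_coord_zero_le_axisDist x
    have a1 := abs_coord_one_le_axisDist x
    refine (hflat x (by linarith) (by linarith) ?_).2 h2
    rw [abs_of_pos h2]; linarith
  obtain ⟨C, Cb, cb, hC, hCb, hcb, htest⟩ := exists_movingTest (R := R) hgeo hα₀ hα1 hr₀ hd₀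
    (half_pos hε)
  -- After clearing denominators, the two integrability conditions on `τ` are the two upper bounds
  -- on `α`.
  obtain ⟨C₂, hC₂, hfluid⟩ := exists_lintegral_momentumDensity_le hM
    (τ := (1 + 2 * α) / (3 + α)) hγ hβ hg hC hr₀ hε hΩm hb hflat htip (by positivity)
    (by
      rw [div_mul_div_comm, div_lt_one (by nlinarith)]; nlinarith)
    (by
      rw [div_mul_div_comm, div_lt_one (by nlinarith)]; nlinarith)
  refine ⟨Cb, cb, C₂, hCb, hcb, hC₂, ?_⟩
  intro D T w hD hw hcol hUB T' m Q σ hT' hTT hm hQ hσ hno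
  have hE := hD.energy_nonneg hM (by linarith)
  have hm0 : 0 < m := hm ▸ hgeo.mass_pos hD.solid_density_pos
  have hQ0 : 0 < Q := by rw [hQ]; positivity
  have hσ0 : 0 < σ := by rw [hσ]; positivity
  have hpos := hw.height_pos hgeo hα₀ hr₀ hD hT'.le hTT hno
  have hsub := hw.solid_subset hgeo hD hT'.le hTT hno
  have hVle := hw.ae_velocity_le hgeo hD hUB hT'.le hTT (hQ ▸ hQ0.le) hno
  rw [← hm, ← hQ, ← hσ] at hVle
  obtain ⟨L, hL⟩ : ∃ L : ℝ≥0, (L : ℝ) = σ * √Q := ⟨⟨σ * √Q, by positivity⟩, rfl⟩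
  rw [← hL] at hVle ⊢
  have hLip := hw.lipschitzOnWith_height hTT hVle
  -- By compactness the height has a positive minimum on `[0, T']`. It enters only the
  -- regularization of the field; the constants `C`, `Cb`, `cb` and `C₂` were fixed before.
  obtain ⟨t₀, ht₀, hmin⟩ := isCompact_Icc.exists_isMinOn (nonempty_Icc.2 hT'.le)
    (hw.continuousOn_height hT'.le hTT)
  obtain ⟨φ, ζ, hφ, hζs, hζ0, hζ1, hζd, hζi, hrigid, hzero, htr, hbd⟩ :=
    htest T T' w.h L (w.h t₀) hT' hTT hLip (hpos t₀ ht₀) (fun t ht =>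
      ⟨hmin ht, hRh _ (hsub t ht), hsub t ht, hcol.far_from_rest t ⟨ht.1, ht.2.trans_lt hTT⟩⟩)
  have hφd : ∀ z, DifferentiableAt ℝ φ z := fun z => (hφ.1.differentiable (by simp)) z
  have hζd' : ∀ t, DifferentiableAt ℝ ζ t := fun t => (hζs.differentiable (by simp)) t
  obtain ⟨I, hI⟩ : ∃ I : ℝ × E3 → ℝ, I = fun z => momentumDensity M g (w.ρ z) (w.θ z) (w.u z)
    (w.gradu z) (dt φ z) (jacX φ z) (φ z) := ⟨_, rfl⟩
  have hjz : ∀ z, (∀ᶠ y in nhds z, φ y = 0) → jacX φ z = 0 := fun z hz =>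
    jacX_eq_zero_of_eventuallyEq (c := fun _ => 0) hz
  -- the momentum equation
  have hmom : ∫ z in cylinder T Ω, I z = 0 := by
    have h := hw.momentum φ hφ ⟨interior {z | jacX φ z + (jacX φ z).transpose = 0},
      isOpen_interior, ?_, fun z hz => by
        have h' := interior_subset hz
        exact h'⟩
    · rw [hI]
      refine h.trans ?_
      -- The initial momentum does not contribute, since the time cut-off vanishes near `t = 0`.
      have h0 : ∀ x, φ (0, x) = 0 := fun x => (hzero 0 x (by simp)).self_of_nhds
      simp [h0]
    · rintro ⟨t, x⟩ ⟨ht, hx⟩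
      rw [mem_interior_iff_mem_nhds]
      by_cases h' : t ∈ Icc 0 T'
      · filter_upwards [(hrigid t h' x hx).eventually_nhds] with y hy
        have : jacX φ y = 0 := jacX_eq_zero_of_eventuallyEq (c := fun s => ζ s • e3) hy
        simp [this]
      · filter_upwards [(hzero t x fun h => h' (Ioo_subset_Icc_self h)).eventually_nhds] with y hy
        simp [hjz y hy]
  have hmom' : ∫ z in cylinder T' Ω, I z = 0 := by
    rw [← hmom]
    refine (setIntegral_eq_of_subset_of_forall_sdiff_eq_zero (measurableSet_Ioo.prod hΩm)
      (prod_mono (Ioo_subset_Ioo_right hTT.le) le_rfl) ?_).symm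
    rintro ⟨t, x⟩ ⟨⟨h1, h2⟩, h3⟩
    have ht : t ∉ Ioo 0 T' := fun h => h3 ⟨h, h2⟩
    have hz := hzero t x ht
    have hdt : dt φ (t, x) = 0 := by
      have := dt_of_eventuallyEq (ζ := fun _ => 0) (z := (t, x)) (φ := φ)
        (differentiableAt_const _) (by simpa using hz)
      simpa using this
    rw [hI]
    simp only [hjz _ hz, hdt, hz.self_of_nhds]
    exact momentumDensity_zero _ _ _ _ _ _
  rw [volume_restrict_cylinder] at hmom'
  -- measurability
  have hcyl : volume.restrict (cylinder T' Ω) ≤ volume.restrict (cylinder T Ω) :=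
    Measure.restrict_mono (prod_mono (Ioo_subset_Ioo_right hTT.le) le_rfl) le_rfl
  have hIoo : volume.restrict (Ioo 0 T') ≤ volume.restrict (Ioo 0 T) :=
    Measure.restrict_mono (Ioo_subset_Ioo_right hTT.le) le_rfl
  have hprod := volume_restrict_cylinder T' Ω
  have hρm := hw.ρ_meas.mono_measure hcyl
  have hum := hw.u_meas.mono_measure hcyl
  have hAm := fun i j => (hw.gradu_meas i j).mono_measure hcyl
  obtain ⟨_, hθW⟩ := hw.θ_W12
  have hθm := hθW.1.mono_measure hcyl
  have hθ0 := ae_mono hcyl hw.θ_pos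
  have hρ0 := ae_mono hcyl hw.ρ_nonneg
  obtain ⟨G, hGf, hGm, hGw, hGb⟩ := hUB.temperature
  have hGm' := hGm.mono_measure hcyl
  have hGf' := hGf.mono_measure hcyl
  have hfdc : Continuous (fderiv ℝ φ) := hφ.1.continuous_fderiv (by simp)
  have hIm : AEMeasurable I (volume.restrict (cylinder T' Ω)) := by
    rw [hI]
    refine aemeasurable_momentumDensity hM hρm hθm hθ0 hum hAm ?_
      hφ.1.continuous.aemeasurable ?_ htr
    · have : dt φ = fun z => fderiv ℝ φ z (1, 0) := funext fun z => dt_apply (hφd z)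
      rw [this]
      exact (by fun_prop : Continuous fun z => fderiv ℝ φ z (1, 0)).aemeasurable
    · intro i j
      simp only [jacX_apply (hφd _)]
      exact (by fun_prop : Continuous fun z => fderiv ℝ φ z (spaceDir j) i).aemeasurable
  rw [hprod] at hρm hum hAm hθm hθ0 hρ0 hGm' hGf' hIm
  -- sections
  obtain ⟨X, hX⟩ : ∃ X : ℝ → ℝ≥0∞, X = fun t => ∫⁻ x in Ω,
    ENNReal.ofReal (‖w.u (t, x)‖ ^ 2 + ddot (w.gradu (t, x)) (w.gradu (t, x))) := ⟨_, rfl⟩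
  obtain ⟨Y, hY⟩ : ∃ Y : ℝ → ℝ≥0∞, Y = fun t => ∫⁻ x in Ω,
    ENNReal.ofReal ((w.θ (t, x) ^ (M.β / 2)) ^ 2 + ‖G (t, x)‖ ^ 2) := ⟨_, rfl⟩
  have hXm : AEMeasurable (fun z => ENNReal.ofReal (‖w.u z‖ ^ 2 + ddot (w.gradu z) (w.gradu z)))
      ((volume.restrict (Ioo 0 T')).prod (volume.restrict Ω)) :=
    ((hum.norm.pow_const 2).add (aemeasurable_ddot hAm hAm)).ennreal_ofReal
  have hYm : AEMeasurable (fun z => ENNReal.ofReal ((w.θ z ^ (M.β / 2)) ^ 2 + ‖G z‖ ^ 2))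
      ((volume.restrict (Ioo 0 T')).prod (volume.restrict Ω)) :=
    ((hGf'.pow_const 2).add (hGm'.norm.pow_const 2)).ennreal_ofReal
  have hXQ : ∫⁻ t in Ioo 0 T', X t ≤ ENNReal.ofReal Q := by
    rw [hX, ← lintegral_prod _ hXm, ← hprod, hQ]
    exact (lintegral_mono' hcyl le_rfl).trans hUB.velocity
  have hYQ : ∫⁻ t in Ioo 0 T', Y t ≤ ENNReal.ofReal Q := by
    rw [hY, ← lintegral_prod _ hYm, ← hprod, hQ]
    exact (lintegral_mono' hcyl le_rfl).trans hGb
  obtain ⟨a, ha⟩ : ∃ a, a = C₂ * (Cb / T' * (Q + Q ^ (1 / M.γ)) + σ * Q * Q ^ (1 / M.γ) + 1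
    + Q ^ (1 / M.γ)) := ⟨_, rfl⟩
  obtain ⟨b, hbdef⟩ : ∃ b, b = C₂ * ((σ + 1) * Q ^ (1 / M.γ) + 1) := ⟨_, rfl⟩
  have ha0 : 0 ≤ a := by rw [ha]; positivity
  have hb0 : 0 ≤ b := by rw [hbdef]; positivity
  rw [← ha, ← hbdef]
  have hSm : ∀ t, MeasurableSet (bodyAt B (w.h t)) := fun t => by
    rw [bodyAt_eq_preimage]
    exact (measurable_id.sub_const _) hgeo.body_compact.isClosed.measurableSet
  have hest : ∀ᵐ t ∂volume.restrict (Ioo 0 T'),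
      ∫⁻ x in Ω \ bodyAt B (w.h t), ‖I (t, x)‖ₑ
        ≤ ENNReal.ofReal a + ENNReal.ofReal b * X t + ENNReal.ofReal C₂ * Y t := by
    filter_upwards [aemeasurable_section hρm, aemeasurable_section hθm, aemeasurable_section hGm',
      Measure.ae_ae_of_ae_prod hρ0, Measure.ae_ae_of_ae_prod hθ0, ae_mono hIoo hw.u_W012,
      ae_mono hIoo hGw, ae_mono hIoo hUB.density, ae_mono hIoo hUB.kinetic]
      with t s1 s2 s3 s4 s5 s6 s7 s8 s9
    rw [ha, hbdef, hX, hY, hI]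
    refine hfluid (Ω \ bodyAt B (w.h t)) sdiff_subset (hΩm.diff (hSm t)) (fun x => w.ρ (t, x))
      (fun x => w.θ (t, x)) (fun x => w.u (t, x)) (fun x => w.gradu (t, x)) (fun x => G (t, x))
      (fun x => dt φ (t, x)) (fun x => jacX φ (t, x)) (fun x => φ (t, x)) (Cb / T') L σ Q
      s1 s2 s3 s4 s5 s6 s7 (by positivity) L.2 hσ0 hQ0 ?_ (hQ ▸ s8) (hQ ▸ s9) ?_
    · rw [hL, mul_pow, Real.sq_sqrt hQ0.le]
    · filter_upwards [ae_restrict_mem (hΩm.diff (hSm t)), ae_restrict_of_ae ae_coord_ne_zero]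
        with x hx hx0
      obtain ⟨q1, q2, q3⟩ := hbd t x (hR x hx.1) hx0
      exact ⟨q1, q2, q3, htr _⟩
  -- The value of the integrand on the solid; integrated in time and multiplied by the volume of the
  -- body it gives inertia minus weight.
  obtain ⟨k, hk⟩ : ∃ k : ℝ → ℝ, k = fun t => D.ρS * (deriv ζ t * w.V t - g * ζ t) := ⟨_, rfl⟩
  have hsolid : ∀ᵐ t ∂volume.restrict (Ioo 0 T'), MeasurableSet (bodyAt B (w.h t)) ∧
      bodyAt B (w.h t) ⊆ Ω ∧ volume (bodyAt B (w.h t)) = volume B ∧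
      ∀ᵐ x ∂volume.restrict (bodyAt B (w.h t)), I (t, x) = k t := by
    filter_upwards [ae_mono hIoo hw.ρ_solid, ae_mono hIoo hw.u_solid,
      ae_restrict_mem measurableSet_Ioo] with t h1 h2 h3
    have h3' := Ioo_subset_Icc_self h3
    refine ⟨hSm t, hsub t h3', volume_bodyAt _ _, ?_⟩
    filter_upwards [h1, h2, ae_restrict_mem (hSm t)] with x hx1 hx2 hx3
    have hr := hrigid t h3' x hx3
    rw [hI, hk]
    simp only []
    rw [jacX_eq_zero_of_eventuallyEq (c := fun s => ζ s • e3) hr,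
      dt_of_eventuallyEq (hζd' t) hr, hr.self_of_nhds, momentumDensity_rigid, hx1, hx2,
      rigidVelocity_apply_two]
  -- the solid part
  have hζc : Continuous ζ := hζs.continuous
  have hdζc : Continuous (deriv ζ) := hζs.continuous_deriv (by simp)
  have hVint : IntegrableOn w.V (Ioo 0 T') := by
    have h1 := (intervalIntegrable_iff_integrableOn_Ioo_of_le (hT'.trans hTT).le).1
      hw.velocity_integrable
    exact h1.mono_set (Ioo_subset_Ioo_right hTT.le)
  have hζint : IntegrableOn ζ (Ioo 0 T') :=
    (hζc.integrableOn_Icc).mono_set Ioo_subset_Icc_self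
  have hζV : IntegrableOn (fun t => deriv ζ t * w.V t) (Ioo 0 T') :=
    Integrable.bdd_mul (c := Cb / T') hVint hdζc.aestronglyMeasurable
      (.of_forall fun t => hζd t)
  have hkint : IntegrableOn k (Ioo 0 T') := by
    rw [hk]
    exact (hζV.sub (hζint.const_mul g)).const_mul _
  have hβint : ∫⁻ t in Ioo 0 T', (ENNReal.ofReal a + ENNReal.ofReal b * X t
      + ENNReal.ofReal C₂ * Y t) ≤ ENNReal.ofReal (a * T' + b * Q + C₂ * Q) := by
    have hXs : AEMeasurable X (volume.restrict (Ioo 0 T')) := hX ▸ hXm.lintegral_prod_right'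
    rw [lintegral_add_left' ((hXs.const_mul _).const_add _), lintegral_add_left measurable_const,
      lintegral_const_mul' _ _ ENNReal.ofReal_ne_top, lintegral_const_mul' _ _ ENNReal.ofReal_ne_top,
      setLIntegral_const, Real.volume_Ioo, sub_zero, ← ENNReal.ofReal_mul ha0,
      ENNReal.ofReal_add (by positivity) (by positivity),
      ENNReal.ofReal_add (by positivity) (by positivity), ENNReal.ofReal_mul hb0,
      ENNReal.ofReal_mul hC₂.le]
    gcongr
  have hfinal := abs_mul_integral_le_of_sections hIm hgeo.body_compact.measure_lt_top hkint
    (by positivity) hsolid hest hβint hmom'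
  have hkval : (volume B).toReal * ∫ t in Ioo 0 T', k t
      = m * ((∫ t in Ioo 0 T', deriv ζ t * w.V t) - g * (cb * T')) := by
    rw [hk, integral_const_mul, integral_sub hζV (hζint.const_mul g), integral_const_mul, hζi, hm,
      Geometry.mass_eq]
    ring
  have hV2 : |∫ t in Ioo 0 T', deriv ζ t * w.V t| ≤ Cb * L := by
    have h1 : ‖∫ t in Ioo 0 T', deriv ζ t * w.V t‖
        ≤ Cb / T' * L * (volume : Measure ℝ).real (Ioo 0 T') := by
      refine norm_setIntegral_le_of_norm_le_const_ae measure_Ioo_lt_top ?_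
      filter_upwards [hVle] with t ht
      rw [norm_mul, Real.norm_eq_abs, Real.norm_eq_abs]
      gcongr
      exact hζd t
    rw [Real.volume_real_Ioo_of_le hT'.le, sub_zero, Real.norm_eq_abs] at h1
    refine h1.trans_eq ?_
    field_simp
  rw [hkval] at hfinal
  have h1 := neg_le_of_abs_le hfinal
  have h2 := (abs_le.1 hV2).2
  have h3 : m * (∫ t in Ioo 0 T', deriv ζ t * w.V t) ≤ m * (Cb * L) := by gcongr
  linarith

end Collision

theorem mainTheorem2
    (M : FluidModel) (hM : M.Admissible) (hγ : 3 < M.γ) (hβ : 2 < M.β)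
    (α : ℝ) (hα₀ : 0 < α)
    (hα : α < min (3 * (M.γ - 3) / (4 * M.γ + 3)) (3 * (M.β - 2) / (9 * M.β + 2)))
    (g r₀ d₀ K : ℝ) (hg : 0 < g) (hr₀ : 0 < r₀) (hd₀ : 0 < d₀) (hK : 0 < K)
    (Ω B : Set E3) (hgeo : Geometry Ω B α r₀) :
    ∃ C₀ : ℝ, 0 < C₀ ∧
      ∀ (D : InitialData) (T : ℝ) (w : Motion),
        D.Admissible M Ω B →
        IsWeakSolution M Ω B g D T w →
        CollisionOnlyAtTip Ω B r₀ d₀ T w →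
        UniformBounds M Ω B D T K w →
        smallness C₀ M Ω B D < 1 →
        smallness C₀ M Ω B D / (1 - smallness C₀ M Ω B D) < T →
        ∃ t : ℝ, 0 < t ∧ t ≤ smallness C₀ M Ω B D / (1 - smallness C₀ M Ω B D) ∧
          (w.solid B t ∩ frontier Ω).Nonempty := by
  obtain ⟨Cb, cb, C₂, hCb, hcb, hC₂, hbal⟩ :=
    exists_momentum_balance_le hM hγ hβ hα₀ hα hg hr₀ hd₀ hK hgeo
  obtain ⟨C₀, hC₀, hcon⟩ := exists_smallness_constant (γ := M.γ) (K := K) (by linarith) hK hg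
    hCb hcb hC₂
  refine ⟨C₀, hC₀, fun D T w hD hw hcol hUB hA1 hAT => ?_⟩
  have hm := hgeo.mass_pos hD.solid_density_pos
  have hE := hD.energy_nonneg hM (by linarith)
  by_contra hno
  push Not at hno
  have hA0 : 0 < smallness C₀ M Ω B D := by
    unfold smallness
    have : 0 < D.mass B ^ (-(1 / 2) : ℝ) := by positivity
    have := lt_max_of_lt_left (c := D.mass B ^ (-(3 / 2) : ℝ)) this
    positivity
  exact hcon _ _ _ _ _ _ hm hE rfl rfl hA1 rfl rfl
    (hbal D T w hD hw hcol hUB _ _ _ _ (div_pos hA0 (sub_pos.2 hA1)) hAT rfl rfl rfl hno)
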